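/- **Muir's law for Sklyanin determinants.** Let $\mathbb K$ be a field of characteristic $0$ (for instance $\mathbb C$, or $\mathbb C(q)$ with $q$ an indeterminate) and let $q\in\mathbb K$ be non-zero and not a root of unity. Put $$R(u,v)=(u-v)\sum_{i\ne j}E_{ii}\otimes E_{jj}+(q^{-1}u-qv)\sum_iE_{ii}\otimes E_{ii}+(q^{-1}-q)u\sum_{i>j}E_{ij}\otimes E_{ji}+(q^{-1}-q)v\sum_{i<j}E_{ij}\otimes E_{ji},$$ let $R^t$ be its transpose in the first tensor factor, and let $\overline R(x)=R(x,1)/(x-1)$. *The algebras.* $\mathrm Y_q^{\mathrm{tw}}(\mathfrak o_N)$ is the unital associative $\mathbb K$-algebra generated by $s_{ij}^{(r)}$ ($1\le i,j\le N$, $r\ge0$) subject to $s_{ij}^{(0)}=0$ for $i<j$, $s_{ii}^{(0)}=1$, and $$R(u,v)S_1(u)R^t(u^{-1},v)S_2(v)=S_2(v)R^t(u^{-1},v)S_1(u)R(u,v),$$ where $S(u)=(s_{ij}(u))$ and $s_{ij}(u)=\sum_{r\ge0}s_{ij}^{(r)}u^{-r}$. For even $N$, with $(2k-1)'=2k$ and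 $(2k)'=2k-1$, $\mathrm Y_q^{\mathrm{tw}}(\mathfrak{sp}_N)$ is generated by $s_{ij}^{(r)}$ ($1\le i,j\le N$, $r\ge0$) and $(s_{ii'}^{(0)})^{-1}$ ($i=1,3,\dots,N-1$), subject to the same quadratic relation, $s_{ij}^{(0)}=0$ for $i<j$ with $j\ne i'$, and, for $i=1,3,\dots,N-1$, $s_{i'i'}^{(0)}s_{ii}^{(0)}-q^2s_{i'i}^{(0)}s_{ii'}^{(0)}=q^3$ and $s_{ii'}^{(0)}(s_{ii'}^{(0)})^{-1}=(s_{ii'}^{(0)})^{-1}s_{ii'}^{(0)}=1$. Write $\mathrm Y_N$ for $\mathrm Y_q^{\mathrm{tw}}(\mathfrak o_N)$ for all $N$ (orthogonal case), or for $\mathrm Y_q^{\mathrm{tw}}(\mathfrak{sp}_N)$ for all even $N$ (symplectic case). *Sklyanin determinants.* Let $P^q=\sum_iE_{ii}\otimes E_{ii}+q\sum_{i>j}E_{ij}\otimes E_{ji}+q^{-1}\sum_{i<j}E_{ij}\otimes E_{ji}$ and $A_m^q=\frac1{m!}\sum_{\sigma\in\mathfrak S_m}\mathrm{sgn}(\sigma)P^q_\sigma$,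 where $\sigma\mapsto P^q_\sigma$ is the action of $\mathfrak S_m$ on $(\mathbb K^m)^{\otimes m}$ in which the transposition $(k,k+1)$ acts as $P^q_{k,k+1}$. For an $m\times m$ matrix $T(u)$ of formal power series in $u^{-1}$ over a $\mathbb K$-algebra, $\mathrm{sdet}_q\,T(u)$ is the coefficient of $E_{11}\otimes E_{22}\otimes\cdots\otimes E_{mm}$ in $m!\,A_m^q\langle T_1,\dots,T_m\rangle$, where $$\langle T_1,\dots,T_m\rangle=T_1(u_1)\,(\overline R^t_{12}\cdots\overline R^t_{1m})\,T_2(u_2)\,(\overline R^t_{23}\cdots\overline R^t_{2m})\cdots T_m(u_m),\qquad u_i=q^{-2i+2}u,\quad \overline R^t_{ij}=\overline R^t_{ij}(u_i^{-1}u_j^{-1}),$$ and $\overline R^t_{ij}$ is expanded as a power series in $u^{-1}$; for $m=0$ it is $1$. For a set $I$ of indices, $S_I(u)$ is the submatrix of $S(u)$ with rows and columns in $I$, taken in increasing order. *Statement.* Let $N,M\ge0$, both even in the symplectic case. Suppose that the identity $$\sum_{i=1}^{k}b_i\prod_{j=1}^{m_i}\mathrm{sdet}_q\,S_{I_{ij}}(u)=0$$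 holds in $\mathrm Y_N[[u^{-1}]]$, where $b_i\in\mathbb K$, the $I_{ij}$ are subsets of $\{1,\dots,N\}$, and products are taken in increasing order of $j$. Let $J=\{N+1,\dots,N+M\}$ and let $S(u)$ now be the generator matrix of $\mathrm Y_{N+M}$. Then $\mathrm{sdet}_q\,S_J(u)$ is invertible in $\mathrm Y_{N+M}[[u^{-1}]]$, and in this ring $$\sum_{i=1}^{k}b_i\prod_{j=1}^{m_i}\mathrm{sdet}_q\,(S_J(u))^{-1}\,\mathrm{sdet}_q\,S_{I_{ij}\cup J}(u)=0 .$$ -/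

import Mathlib

namespace TwistedYangian

/-! ### Operators on tensor powers

An operator on the `m`-th tensor power of the space with basis `e_1, …, e_n` is a matrix indexed by
the maps `Fin m → Fin n`; the map `a` stands for `e_{a 0} ⊗ ⋯ ⊗ e_{a (m-1)}`.  An operator on two
tensor factors is a matrix indexed by `Fin n × Fin n`; the unit `E_{ik} ⊗ E_{jl}` has its only
non-zero entry at row `(i, j)` and column `(k, l)`. -/

section Operators

variable {L : Type*} [Ring L] {n m : ℕ}

/-- The operator `A` acting in the `i`-th tensor factor. -/
def oneSite (i : Fin m) (A : Matrix (Fin n) (Fin n) L) :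
    Matrix (Fin m → Fin n) (Fin m → Fin n) L :=
  Matrix.of fun a b => if ∀ k, k ≠ i → a k = b k then A (a i) (b i) else 0

/-- The operator `A` acting in the tensor factors `i` and `j`, in this order. -/
def twoSite (i j : Fin m) (A : Matrix (Fin n × Fin n) (Fin n × Fin n) L) :
    Matrix (Fin m → Fin n) (Fin m → Fin n) L :=
  Matrix.of fun a b =>
    if ∀ k, k ≠ i → k ≠ j → a k = b k then A (a i, a j) (b i, b j) else 0

/-- The transposition in the first tensor factor, `E_{ik} ⊗ E_{jl} ↦ E_{ki} ⊗ E_{jl}`. -/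
def partialTranspose (A : Matrix (Fin n × Fin n) (Fin n × Fin n) L) :
    Matrix (Fin n × Fin n) (Fin n × Fin n) L :=
  Matrix.of fun a b => A (b.1, a.2) (a.1, b.2)

/-- The trigonometric `R`-matrix `R(u, v)`. -/
def rMatrix {K : Type*} [Field K] [Algebra K L] (n : ℕ) (q : K) (u v : L) :
    Matrix (Fin n × Fin n) (Fin n × Fin n) L :=
  Matrix.of fun a b =>
    if a = b then (if a.1 = a.2 then q⁻¹ • u - q • v else u - v)
    else if a.1 = b.2 ∧ a.2 = b.1 then (if a.2 < a.1 then (q⁻¹ - q) • u else (q⁻¹ - q) • v)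
    else 0

open Matrix Kronecker in
/-- The `R`-matrix in terms of matrix units. -/
theorem rMatrix_eq_sum {K : Type*} [Field K] [Algebra K L] (n : ℕ) (q : K) (u v : L) :
    rMatrix n q u v =
      (∑ i : Fin n, ∑ j : Fin n, if i ≠ j then
        (u - v) • (single i i (1 : L) ⊗ₖ single j j (1 : L)) else 0)
      + (∑ i : Fin n, (q⁻¹ • u - q • v) • (single i i (1 : L) ⊗ₖ single i i (1 : L)))
      + (∑ i : Fin n, ∑ j : Fin n, if j < i then
        ((q⁻¹ - q) • u) • (single i j (1 : L) ⊗ₖ single j i (1 : L)) else 0)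
      + (∑ i : Fin n, ∑ j : Fin n, if i < j then
        ((q⁻¹ - q) • v) • (single i j (1 : L) ⊗ₖ single j i (1 : L)) else 0) := by
  ext a b
  obtain ⟨a1, a2⟩ := a
  obtain ⟨b1, b2⟩ := b
  simp only [rMatrix, of_apply, Matrix.add_apply, Matrix.sum_apply, kroneckerMap_apply,
    Matrix.smul_apply, single_apply, apply_ite (fun X : Matrix (Fin n × Fin n) (Fin n × Fin n) L =>
      X (a1, a2) (b1, b2)), Matrix.zero_apply, Prod.mk.injEq]
  have h1 : ∀ (P : Fin n → Fin n → Prop) [∀ i j, Decidable (P i j)] (c : L),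
      (∑ i : Fin n, ∑ j : Fin n, if P i j then
        c • ((if i = a1 ∧ i = b1 then (1 : L) else 0) * (if j = a2 ∧ j = b2 then 1 else 0))
        else 0) = if P a1 a2 ∧ a1 = b1 ∧ a2 = b2 then c else 0 := by
    intro P _ c
    rw [Finset.sum_eq_single a1, Finset.sum_eq_single a2]
    · by_cases hp : P a1 a2 <;> by_cases hx : a1 = b1 <;> by_cases hy : a2 = b2 <;>
        simp [hp, hx, hy]
    · intro j _ hj
      simp [hj]
    · simp
    · intro i _ hi
      simp [hi]
    · simp
  have h2 : ∀ (P : Fin n → Fin n → Prop) [∀ i j, Decidable (P i j)] (c : L),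
      (∑ i : Fin n, ∑ j : Fin n, if P i j then
        c • ((if i = a1 ∧ j = b1 then (1 : L) else 0) * (if j = a2 ∧ i = b2 then 1 else 0))
        else 0) = if P a1 a2 ∧ a1 = b2 ∧ a2 = b1 then c else 0 := by
    intro P _ c
    rw [Finset.sum_eq_single a1, Finset.sum_eq_single a2]
    · by_cases hp : P a1 a2 <;> by_cases hx : a1 = b2 <;> by_cases hy : a2 = b1 <;>
        simp [hp, hx, hy]
    · intro j _ hj
      simp [hj]
    · simp
    · intro i _ hi
      simp [hi]
    · simp
  have h3 : ∀ c : L,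
      (∑ i : Fin n,
        c • ((if i = a1 ∧ i = b1 then (1 : L) else 0) * (if i = a2 ∧ i = b2 then 1 else 0)))
        = if a1 = a2 ∧ a1 = b1 ∧ a2 = b2 then c else 0 := by
    intro c
    rw [Finset.sum_eq_single a1]
    · by_cases hp : a1 = a2 <;> by_cases hx : a1 = b1 <;> by_cases hy : a2 = b2 <;>
        simp_all
    · intro i _ hi
      simp [hi]
    · simp
  rw [h1, h3, h2 (fun i j => j < i), h2 (fun i j => i < j)]
  by_cases e : a1 = a2
  · subst e
    by_cases hx : a1 = b1 <;> by_cases hy : a1 = b2 <;> simp_all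
  · by_cases hx : a1 = b1 ∧ a2 = b2
    · obtain ⟨rfl, rfl⟩ := hx
      have e' : ¬ a2 = a1 := fun h => e h.symm
      simp [e]
    · by_cases hy : a1 = b2 ∧ a2 = b1
      · obtain ⟨rfl, rfl⟩ := hy
        rcases lt_or_gt_of_ne e with h | h
        · simp [h, h.not_gt, e]
        · simp [h, h.not_gt, e]
      · simp [hx, hy]

end Operators

/-! ### The `q`-antisymmetrizer -/

section Antisymmetrizer

variable {K : Type*} [Field K]

/-- The number of inversions of a sequence. -/
def inversions {m n : ℕ} (a : Fin m → Fin n) : ℕ :=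
  (Finset.univ.filter fun p : Fin m × Fin m => p.1 < p.2 ∧ a p.2 < a p.1).card

/-- The `q`-permutation operator
`P^q = ∑ E_ii ⊗ E_ii + q ∑_{i>j} E_ij ⊗ E_ji + q⁻¹ ∑_{i<j} E_ij ⊗ E_ji`. -/
def qFlip (n : ℕ) (q : K) : Matrix (Fin n × Fin n) (Fin n × Fin n) K :=
  Matrix.of fun a b =>
    if a.1 = b.2 ∧ a.2 = b.1 then
      (if a.1 = a.2 then 1 else if a.2 < a.1 then q else q⁻¹)
    else 0

/-- The operator `P^q_σ`, in closed form.  It is characterized by `qPerm_mul` and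
`qPerm_adjacent`: it is multiplicative in `σ`, and it is `P^q_{k,k+1}` when `σ` is the
transposition `(k, k+1)`. -/
def qPerm {m : ℕ} (n : ℕ) (q : K) (σ : Equiv.Perm (Fin m)) :
    Matrix (Fin m → Fin n) (Fin m → Fin n) K :=
  Matrix.of fun b a =>
    if b = a ∘ σ.symm then q ^ ((inversions b : ℤ) - (inversions a : ℤ)) else 0

theorem qPerm_mul {m n : ℕ} {q : K} (hq : q ≠ 0) (σ τ : Equiv.Perm (Fin m)) :
    qPerm n q (σ * τ) = qPerm n q σ * qPerm n q τ := by
  ext b a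
  rw [Matrix.mul_apply, Finset.sum_eq_single (a ∘ τ.symm)]
  · have e : a ∘ (σ * τ).symm = (a ∘ τ.symm) ∘ σ.symm := rfl
    simp only [qPerm, Matrix.of_apply, e, if_true]
    split_ifs with h
    · rw [← zpow_add₀ hq]
      congr 1
      ring
    · simp
  · intro c _ hc
    simp [qPerm, hc]
  · simp

theorem qPerm_adjacent {m n : ℕ} {q : K} (k l : Fin m) (h : (l : ℕ) = k + 1) :
    qPerm n q (Equiv.swap k l) = twoSite k l (qFlip n q) := by
  have hkl : k ≠ l := by
    intro e
    rw [e] at h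
    omega
  have hlt : k < l := by
    rw [Fin.lt_def]
    omega
  have split : ∀ a : Fin m → Fin n, inversions a =
      ((Finset.univ.filter fun p : Fin m × Fin m =>
        p.1 < p.2 ∧ a p.2 < a p.1).erase (k, l)).card + if a l < a k then 1 else 0 := by
    intro a
    by_cases hc : a l < a k
    · rw [if_pos hc, Finset.card_erase_add_one]
      · rfl
      · simp [hc, hlt]
    · rw [if_neg hc, Finset.erase_eq_of_notMem]
      · rfl
      · simp [hc]
  have hs : ∀ x y : Fin m, x < y → (x, y) ≠ (k, l) →
      Equiv.swap k l x < Equiv.swap k l y ∧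
        (Equiv.swap k l x, Equiv.swap k l y) ≠ (k, l) := by
    intro x y hxy hne
    simp only [ne_eq, Prod.mk.injEq, Equiv.swap_apply_def, Fin.lt_def, Fin.ext_iff] at *
    constructor
    · split_ifs <;> omega
    · split_ifs <;> omega
  have same : ∀ a : Fin m → Fin n,
      ((Finset.univ.filter fun p : Fin m × Fin m =>
        p.1 < p.2 ∧ (a ∘ Equiv.swap k l) p.2 < (a ∘ Equiv.swap k l) p.1).erase (k, l)).card =
      ((Finset.univ.filter fun p : Fin m × Fin m =>
        p.1 < p.2 ∧ a p.2 < a p.1).erase (k, l)).card := by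
    intro a
    refine Finset.card_bij (fun p _ => (Equiv.swap k l p.1, Equiv.swap k l p.2)) ?_ ?_ ?_
    · rintro ⟨x, y⟩ hp
      simp only [Finset.mem_erase, Finset.mem_filter, Finset.mem_univ, true_and,
        Function.comp_apply] at hp ⊢
      obtain ⟨h1, h2, h3⟩ := hp
      exact ⟨(hs x y h2 h1).2, (hs x y h2 h1).1, h3⟩
    · rintro ⟨x, y⟩ _ ⟨x', y'⟩ _ he
      simpa using he
    · rintro ⟨x, y⟩ hp
      simp only [Finset.mem_erase, Finset.mem_filter, Finset.mem_univ, true_and] at hp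
      obtain ⟨h1, h2, h3⟩ := hp
      refine ⟨(Equiv.swap k l x, Equiv.swap k l y), ?_, by simp⟩
      simp only [Finset.mem_erase, Finset.mem_filter, Finset.mem_univ, true_and,
        Function.comp_apply, Equiv.swap_apply_self]
      exact ⟨(hs x y h2 h1).2, (hs x y h2 h1).1, h3⟩
  have cond : ∀ a b : Fin m → Fin n, b = a ∘ Equiv.swap k l ↔
      (∀ x, x ≠ k → x ≠ l → b x = a x) ∧ b k = a l ∧ b l = a k := by
    intro a b
    constructor
    · rintro rfl
      refine ⟨fun x hx hy => ?_, by simp, by simp⟩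
      simp [Equiv.swap_apply_of_ne_of_ne hx hy]
    · rintro ⟨h1, h2, h3⟩
      funext x
      by_cases hx : x = k
      · subst hx
        simpa using h2
      · by_cases hy : x = l
        · subst hy
          simpa using h3
        · simpa [Equiv.swap_apply_of_ne_of_ne hx hy] using h1 x hx hy
  ext b a
  simp only [qPerm, twoSite, qFlip, Matrix.of_apply, Equiv.symm_swap, ← ite_and, cond]
  by_cases hc : (∀ x, x ≠ k → x ≠ l → b x = a x) ∧ b k = a l ∧ b l = a k
  · have hb := (cond a b).2 hc
    rw [if_pos hc, if_pos hc, split a, split b, hb, same a, hb.symm, hc.2.1, hc.2.2]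
    rcases lt_trichotomy (a k) (a l) with hh | hh | hh
    · simp [hh, hh.not_gt, hh.ne']
    · simp [hh]
    · simp [hh, hh.not_gt, hh.ne]
  · rw [if_neg hc, if_neg hc]

/-- The `q`-antisymmetrizer `A_m^q = (1/m!) ∑_σ sgn(σ) P^q_σ`. -/
noncomputable def qAntisymmetrizer (m n : ℕ) (q : K) :
    Matrix (Fin m → Fin n) (Fin m → Fin n) K :=
  ((m.factorial : K))⁻¹ • ∑ σ : Equiv.Perm (Fin m), (Equiv.Perm.sign σ : ℤ) • qPerm n q σ

end Antisymmetrizer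

/-! ### Sklyanin minors

A series `s(u) = ∑_r s^{(r)} u^{-r}` with coefficients in `A` is an element of `PowerSeries A`;
the variable of the power series is `u⁻¹`. -/

section Sklyanin

variable {K : Type*} [Field K] {A : Type*} [Ring A] [Algebra K A]

/-- The substitution `u⁻¹ ↦ c u⁻¹`. -/
noncomputable def dilate (c : K) (f : PowerSeries A) : PowerSeries A :=
  PowerSeries.mk fun r => c ^ r • PowerSeries.coeff r f

/-- The transpose `R̄ᵗ(x)` in the first factor of `R̄(x) = R(x, 1) / (x - 1)`, for a series `x` in
`u⁻¹` without constant term. -/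
noncomputable def rBarT (n : ℕ) (q : K) (x : PowerSeries K) :
    Matrix (Fin n × Fin n) (Fin n × Fin n) (PowerSeries K) :=
  partialTranspose ((x - 1)⁻¹ • rMatrix n q x 1)

/-- The product `⟨S_1, …, S_m⟩`, that is, `S_1(u_1) R̄ᵗ_{12} ⋯ R̄ᵗ_{1m} S_2(u_2) R̄ᵗ_{23} ⋯ S_m(u_m)`
with `R̄ᵗ_{ij} = R̄ᵗ(u_i⁻¹ u_j⁻¹)`, at `u_i = u q^{-2i+2}`.  Here the positions `i` run from `0` to
`m - 1`, so that `u_i⁻¹ = q^{2i} u⁻¹`. -/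
noncomputable def bracket (m : ℕ) {n : ℕ} (q : K) (S : Matrix (Fin n) (Fin n) (PowerSeries A)) :
    Matrix (Fin m → Fin n) (Fin m → Fin n) (PowerSeries A) :=
  ((List.finRange m).map fun i : Fin m =>
    oneSite i (S.map (dilate (q ^ (2 * (i : ℕ))))) *
      (((List.finRange m).filter fun j => i < j).map fun j : Fin m =>
        twoSite i j
          ((rBarT n q
            ((PowerSeries.C (q ^ (2 * (i : ℕ))) * PowerSeries.X) *
              (PowerSeries.C (q ^ (2 * (j : ℕ))) * PowerSeries.X))).map
            (PowerSeries.map (algebraMap K A)))).prod).prod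

/-- The Sklyanin minor with rows `i_1 ⋯ i_m` and columns `j_1 ⋯ j_m`: the coefficient of
`E_{i_1 j_1} ⊗ ⋯ ⊗ E_{i_m j_m}` in `m! A_m^q ⟨S_1, …, S_m⟩`. -/
noncomputable def sklyaninMinor {m n : ℕ} (q : K) (S : Matrix (Fin n) (Fin n) (PowerSeries A))
    (i j : Fin m → Fin n) : PowerSeries A :=
  (m.factorial : K) •
    (((qAntisymmetrizer m n q).map (algebraMap K (PowerSeries A))) * bracket m q S) i j

/-- The Sklyanin determinant of a matrix of size `m`: its minor with rows and columns
`1, 2, …, m`. -/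
noncomputable def sdet {m : ℕ} (q : K) (S : Matrix (Fin m) (Fin m) (PowerSeries A)) :
    PowerSeries A :=
  sklyaninMinor q S id id

/-- The Sklyanin determinant of the submatrix `S_I` of `S` with rows and columns in `I`. -/
noncomputable def sdetOn {n : ℕ} (q : K) (S : Matrix (Fin n) (Fin n) (PowerSeries A))
    (I : Finset (Fin n)) : PowerSeries A :=
  sdet q (S.submatrix (I.orderEmbOfFin rfl) (I.orderEmbOfFin rfl))

/-! ### The reflection equation

`R(u,v) S_1(u) Rᵗ(u⁻¹,v) S_2(v) = S_2(v) Rᵗ(u⁻¹,v) S_1(u) R(u,v)`, where both sides are multiplied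
by `u⁻¹ v⁻²` so that they become double power series in `x = u⁻¹` (the outer variable) and
`y = v⁻¹` (the inner variable). Since `R` is homogeneous of degree one, this is the same equation as
the one with `R(u/v)` and `Rᵗ(1/uv)`, in any normalization of the `R`-matrix. -/

/-- `u⁻¹ v⁻¹ R(u, v) = R(y, x)`. -/
noncomputable def reflR (N : ℕ) (q : K) :
    Matrix (Fin 2 → Fin N) (Fin 2 → Fin N) (PowerSeries (PowerSeries A)) :=
  twoSite 0 1 (rMatrix N q (PowerSeries.C PowerSeries.X) PowerSeries.X)

/-- `v⁻¹ Rᵗ(u⁻¹, v) = Rᵗ(x y, 1)`. -/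
noncomputable def reflRT (N : ℕ) (q : K) :
    Matrix (Fin 2 → Fin N) (Fin 2 → Fin N) (PowerSeries (PowerSeries A)) :=
  twoSite 0 1 (partialTranspose
    (rMatrix N q (PowerSeries.X * PowerSeries.C PowerSeries.X) 1))

/-- `S_1(u)`. -/
noncomputable def reflS₁ {N : ℕ} (S : Matrix (Fin N) (Fin N) (PowerSeries A)) :
    Matrix (Fin 2 → Fin N) (Fin 2 → Fin N) (PowerSeries (PowerSeries A)) :=
  oneSite 0 (S.map (PowerSeries.map PowerSeries.C))

/-- `S_2(v)`. -/
noncomputable def reflS₂ {N : ℕ} (S : Matrix (Fin N) (Fin N) (PowerSeries A)) :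
    Matrix (Fin 2 → Fin N) (Fin 2 → Fin N) (PowerSeries (PowerSeries A)) :=
  oneSite 1 (S.map PowerSeries.C)

/-- The left-hand side of the reflection equation. -/
noncomputable def reflLeft {N : ℕ} (q : K) (S : Matrix (Fin N) (Fin N) (PowerSeries A)) :
    Matrix (Fin 2 → Fin N) (Fin 2 → Fin N) (PowerSeries (PowerSeries A)) :=
  reflR N q * reflS₁ S * reflRT N q * reflS₂ S

/-- The right-hand side of the reflection equation. -/
noncomputable def reflRight {N : ℕ} (q : K) (S : Matrix (Fin N) (Fin N) (PowerSeries A)) :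
    Matrix (Fin 2 → Fin N) (Fin 2 → Fin N) (PowerSeries (PowerSeries A)) :=
  reflS₂ S * reflRT N q * reflS₁ S * reflR N q

end Sklyanin

/-! ### The twisted `q`-Yangians -/

/-- The two families of twisted `q`-Yangians. -/
inductive Family : Type
  | orthogonal : Family
  | symplectic : Family

/-- The generators: `s i j r` is `s_{ij}^{(r)}` and, in the symplectic case, `inv k` is the inverse
of `s_{ii'}^{(0)}` for the `k`-th index `i` among `1, 3, 5, …`. -/
inductive Generator : Family → ℕ → Type
  | s {g : Family} {N : ℕ} (i j : Fin N) (r : ℕ) : Generator g N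
  | inv {N : ℕ} (k : Fin (N / 2)) : Generator Family.symplectic N

/-- The `k`-th index in the list `1, 3, 5, …`; it is `2k` when indices are counted from `0`. -/
def oddIndex {N : ℕ} (k : Fin (N / 2)) : Fin N := ⟨2 * (k : ℕ), by omega⟩

/-- The partner `i'` of the `k`-th index `i` in the list `1, 3, 5, …`. -/
def oddIndex' {N : ℕ} (k : Fin (N / 2)) : Fin N := ⟨2 * (k : ℕ) + 1, by omega⟩

section Yangian

variable {K : Type*} [Field K]

/-- The generator `s_{ij}^{(r)}` in the free algebra. -/
def freeGen (K : Type*) [Field K] (g : Family) {N : ℕ} (i j : Fin N) (r : ℕ) :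
    FreeAlgebra K (Generator g N) :=
  FreeAlgebra.ι K (Generator.s i j r)

/-- The matrix `S(u)` over the free algebra. -/
noncomputable def freeMatrix (K : Type*) [Field K] (g : Family) (N : ℕ) :
    Matrix (Fin N) (Fin N) (PowerSeries (FreeAlgebra K (Generator g N))) :=
  Matrix.of fun i j => PowerSeries.mk fun r => freeGen K g i j r

/-- The defining relations of the twisted `q`-Yangians. -/
inductive Relation (q : K) : (g : Family) → (N : ℕ) →
    FreeAlgebra K (Generator g N) → FreeAlgebra K (Generator g N) → Prop
  | reflection {g : Family} {N : ℕ} (a b : Fin 2 → Fin N) (r t : ℕ) :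
      Relation q g N
        (PowerSeries.coeff t (PowerSeries.coeff r (reflLeft q (freeMatrix K g N) a b)))
        (PowerSeries.coeff t (PowerSeries.coeff r (reflRight q (freeMatrix K g N) a b)))
  | orthogonal_upper {N : ℕ} (i j : Fin N) (h : i < j) :
      Relation q Family.orthogonal N (freeGen K Family.orthogonal i j 0) 0
  | orthogonal_diag {N : ℕ} (i : Fin N) :
      Relation q Family.orthogonal N (freeGen K Family.orthogonal i i 0) 1
  | symplectic_upper {N : ℕ} (i j : Fin N) (h : i < j)
      (h' : ¬ ∃ k : Fin (N / 2), i = oddIndex k ∧ j = oddIndex' k) :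
      Relation q Family.symplectic N (freeGen K Family.symplectic i j 0) 0
  | symplectic_block {N : ℕ} (k : Fin (N / 2)) :
      Relation q Family.symplectic N
        (freeGen K Family.symplectic (oddIndex' k) (oddIndex' k) 0 *
            freeGen K Family.symplectic (oddIndex k) (oddIndex k) 0 -
          q ^ 2 • (freeGen K Family.symplectic (oddIndex' k) (oddIndex k) 0 *
            freeGen K Family.symplectic (oddIndex k) (oddIndex' k) 0))
        (algebraMap K _ (q ^ 3))
  | symplectic_mul_inv {N : ℕ} (k : Fin (N / 2)) :
      Relation q Family.symplectic N
        (freeGen K Family.symplectic (oddIndex k) (oddIndex' k) 0 *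
          FreeAlgebra.ι K (Generator.inv k)) 1
  | symplectic_inv_mul {N : ℕ} (k : Fin (N / 2)) :
      Relation q Family.symplectic N
        (FreeAlgebra.ι K (Generator.inv k) *
          freeGen K Family.symplectic (oddIndex k) (oddIndex' k) 0) 1

/-- The twisted `q`-Yangian: `Y_q^tw(o_N)` in the orthogonal family and, for even `N`, `Y_q^tw(sp_N)`
in the symplectic family. -/
abbrev TwistedQYangian (q : K) (g : Family) (N : ℕ) : Type _ :=
  RingQuot (Relation q g N)

/-- The generator matrix `S(u)` of the twisted `q`-Yangian. -/
noncomputable def genMatrix (q : K) (g : Family) (N : ℕ) :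
    Matrix (Fin N) (Fin N) (PowerSeries (TwistedQYangian q g N)) :=
  Matrix.of fun i j => PowerSeries.mk fun r =>
    RingQuot.mkAlgHom K (Relation q g N) (freeGen K g i j r)

end Yangian

end TwistedYangian

/-! The law comes from a ring homomorphism. Let `σ(u)` be the Schur complement of `S_J(u)` in
`S(u)`, that is, the inverse of the upper left `N × N` block of `S(u)⁻¹`. The matrix obtained from
`σ` by `u⁻¹ ↦ q^M u⁻¹` satisfies the defining relations of `Y_N` (`reflection_schur`,
`exists_algHom`) and so defines `φ : Y_N → Y_{N+M}`. If `Θ` denotes `φ` followed by the same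
dilation, then `sdet S_{I ∪ J} = sdet S_J · Θ(sdet S_I)` (`sklyaninMinor_union`). Since `sdet S_J`
is invertible (`isUnit_sdet`), applying `Θ` to the given identity yields the wanted one.

Relations for `σ`: the reflection equation is inverted, compressed to the first `N` basis vectors,
and inverted again. Compression respects the products involved because a nonzero path of matrix
entries whose two ends avoid an index must avoid it throughout (`pathClosed_bracketLabels`). The
inverse of `R̄ᵗ(x)` in size `N + M` compresses to the inverse of `R̄ᵗ(q^{-2M} x)` in size `N`, by
eliminating one index at a time (`weightBar_schur`); the dilation by `q^M` absorbs this shift.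

Factorization: at `v = q⁻² u` the reflection equation has `1 - P^q` in place of `R`. With the
Yang–Baxter equation this carries `1 - P^q` through the bracket `⟨S_1, …, S_m⟩` (`push_bracket`), so
the rows of `m! A_m^q ⟨S_1, …, S_m⟩` are `q`-antisymmetric. Placing the indices of `J` first,
antisymmetry forces the other positions to carry indices at most `N`; inverting and compressing the
part of the bracket on these positions replaces `S` by `σ`.

The inverses exist because constant terms are invertible: the constant term of `S` is unitriangular
in the orthogonal case and block triangular with invertible `2 × 2` blocks in the symplectic one
(`IsConstant.isUnit`). -/

set_option linter.unusedSectionVars false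

namespace TwistedYangian

/-! ### Operators embedded along an injection of sites -/

section Embedding

variable {L : Type*} [Ring L] {n : ℕ}
variable {κ μ ι : Type*} [Fintype κ] [DecidableEq κ] [Fintype μ] [DecidableEq μ]
  [Fintype ι] [DecidableEq ι]

/-- The operator `Y` on the sites `κ`, acting in the sites `f k`. -/
def siteEmb (f : κ → ι) (Y : Matrix (κ → Fin n) (κ → Fin n) L) :
    Matrix (ι → Fin n) (ι → Fin n) L :=
  Matrix.of fun a b => if ∀ x, (∀ k, f k ≠ x) → a x = b x then Y (a ∘ f) (b ∘ f) else 0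

theorem siteEmb_apply (f : κ → ι) (Y : Matrix (κ → Fin n) (κ → Fin n) L) (a b : ι → Fin n) :
    siteEmb f Y a b = if ∀ x, (∀ k, f k ≠ x) → a x = b x then Y (a ∘ f) (b ∘ f) else 0 := rfl

theorem extend_comp_self {f : κ → ι} (hf : Function.Injective f) (d : κ → Fin n)
    (a : ι → Fin n) : Function.extend f d a ∘ f = d := by
  funext k
  exact hf.extend_apply d a k

theorem extend_of_forall_ne {f : κ → ι} (d : κ → Fin n) (a : ι → Fin n) {x : ι}
    (hx : ∀ k, f k ≠ x) : Function.extend f d a x = a x :=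
  Function.extend_apply' _ _ _ (by rintro ⟨k, hk⟩; exact hx k hk)

theorem eq_extend_iff {f : κ → ι} (hf : Function.Injective f) (c a : ι → Fin n) (d : κ → Fin n) :
    c = Function.extend f d a ↔ c ∘ f = d ∧ ∀ x, (∀ k, f k ≠ x) → c x = a x := by
  constructor
  · rintro rfl
    exact ⟨extend_comp_self hf d a, fun x hx => extend_of_forall_ne d a hx⟩
  · rintro ⟨rfl, h⟩
    funext x
    by_cases hx : ∃ k, f k = x
    · obtain ⟨k, rfl⟩ := hx
      rw [hf.extend_apply]
      rfl
    · rw [Function.extend_apply' _ _ _ hx]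
      exact h x (by simpa using hx)

/-- An embedded operator only links tuples that agree off the image of `f`, so the sums in matrix
products collapse to sums over the `κ`-part. -/
theorem sum_eq_sum_extend {f : κ → ι} (hf : Function.Injective f) (F : (ι → Fin n) → L)
    (a : ι → Fin n) (h : ∀ c, F c ≠ 0 → ∀ x, (∀ k, f k ≠ x) → c x = a x) :
    ∑ c, F c = ∑ d : κ → Fin n, F (Function.extend f d a) := by
  symm
  refine Finset.sum_of_injOn (fun d => Function.extend f d a) ?_ ?_ ?_ ?_
  · intro d _ d' _ e
    have := congrArg (· ∘ f) e
    simpa [extend_comp_self hf] using this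
  · intro d _
    simp
  · intro c _ hc
    by_contra hne
    exact hc ⟨c ∘ f, by simp, ((eq_extend_iff hf c a _).2 ⟨rfl, h c hne⟩).symm⟩
  · intro d _
    rfl

theorem siteEmb_mul_apply {f : κ → ι} (hf : Function.Injective f)
    (Y : Matrix (κ → Fin n) (κ → Fin n) L) (Z : Matrix (ι → Fin n) (ι → Fin n) L)
    (a b : ι → Fin n) :
    (siteEmb f Y * Z) a b = ∑ d, Y (a ∘ f) d * Z (Function.extend f d a) b := by
  rw [Matrix.mul_apply, sum_eq_sum_extend hf _ a]
  · refine Finset.sum_congr rfl fun d _ => ?_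
    rw [siteEmb_apply, if_pos, extend_comp_self hf]
    intro x hx
    rw [extend_of_forall_ne d a hx]
  · intro c hc x hx
    by_contra hne
    apply hc
    rw [siteEmb_apply, if_neg, zero_mul]
    intro H
    exact hne (H x hx).symm

theorem mul_siteEmb_apply {f : κ → ι} (hf : Function.Injective f)
    (Y : Matrix (κ → Fin n) (κ → Fin n) L) (Z : Matrix (ι → Fin n) (ι → Fin n) L)
    (a b : ι → Fin n) :
    (Z * siteEmb f Y) a b = ∑ d, Z a (Function.extend f d b) * Y d (b ∘ f) := by
  rw [Matrix.mul_apply, sum_eq_sum_extend hf _ b]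
  · refine Finset.sum_congr rfl fun d _ => ?_
    rw [siteEmb_apply, if_pos, extend_comp_self hf]
    intro x hx
    rw [extend_of_forall_ne d b hx]
  · intro c hc x hx
    by_contra hne
    apply hc
    rw [siteEmb_apply, if_neg, mul_zero]
    intro H
    exact hne (H x hx)

theorem siteEmb_mul {f : κ → ι} (hf : Function.Injective f)
    (Y Z : Matrix (κ → Fin n) (κ → Fin n) L) :
    siteEmb f (Y * Z) = siteEmb f Y * siteEmb f Z := by
  ext a b
  rw [siteEmb_mul_apply hf, siteEmb_apply]
  split_ifs with h
  · rw [Matrix.mul_apply]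
    refine Finset.sum_congr rfl fun d _ => ?_
    rw [siteEmb_apply, if_pos, extend_comp_self hf]
    intro x hx
    rw [extend_of_forall_ne d a hx, h x hx]
  · symm
    refine Finset.sum_eq_zero fun d _ => ?_
    rw [siteEmb_apply, if_neg, mul_zero]
    intro H
    apply h
    intro x hx
    rw [← H x hx, extend_of_forall_ne d a hx]

theorem siteEmb_one {f : κ → ι} :
    siteEmb f (1 : Matrix (κ → Fin n) (κ → Fin n) L) = 1 := by
  ext a b
  rw [siteEmb_apply, Matrix.one_apply, Matrix.one_apply, ← ite_and]
  congr 1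
  apply propext
  constructor
  · rintro ⟨h1, h2⟩
    funext x
    by_cases hx : ∃ k, f k = x
    · obtain ⟨k, rfl⟩ := hx
      exact congrFun h2 k
    · exact h1 x (by simpa using hx)
  · rintro rfl
    exact ⟨fun _ _ => rfl, rfl⟩

/-- `siteEmb` as a ring homomorphism. -/
def siteEmbHom (f : κ → ι) (hf : Function.Injective f) :
    Matrix (κ → Fin n) (κ → Fin n) L →+* Matrix (ι → Fin n) (ι → Fin n) L where
  toFun := siteEmb f
  map_one' := siteEmb_one
  map_mul' := siteEmb_mul hf
  map_zero' := by ext a b; simp [siteEmb_apply]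
  map_add' Y Z := by
    ext a b
    simp only [siteEmb_apply, Matrix.add_apply]
    split_ifs <;> simp

theorem siteEmbHom_apply (f : κ → ι) (hf : Function.Injective f)
    (Y : Matrix (κ → Fin n) (κ → Fin n) L) : siteEmbHom f hf Y = siteEmb f Y := rfl

theorem siteEmb_siteEmb {f : κ → ι} (hf : Function.Injective f) (g : μ → κ)
    (Y : Matrix (μ → Fin n) (μ → Fin n) L) :
    siteEmb f (siteEmb g Y) = siteEmb (f ∘ g) Y := by
  ext a b
  simp only [siteEmb_apply, ← ite_and, Function.comp_assoc]
  congr 1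
  apply propext
  constructor
  · rintro ⟨h1, h2⟩ x hx
    by_cases h : ∃ k, f k = x
    · obtain ⟨k, rfl⟩ := h
      exact h2 k fun j hj => hx j (by simp [hj])
    · exact h1 x (by simpa using h)
  · intro h
    exact ⟨fun x hx => h x fun k => hx (g k), fun k hk => h (f k) fun j hj => hk j (hf hj)⟩

theorem extend_eq_off_swap {f : κ → ι} {g : μ → ι} (hg : Function.Injective g)
    {a : ι → Fin n} (b : ι → Fin n)
    (H : ∀ x, (∀ j, g j ≠ x) → Function.extend f (b ∘ f) a x = b x) (x : ι)
    (hx : ∀ k, f k ≠ x) : Function.extend g (b ∘ g) a x = b x := by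
  by_cases hgx : ∃ j, g j = x
  · obtain ⟨j, rfl⟩ := hgx
    rw [hg.extend_apply]
    rfl
  · rw [Function.extend_apply' _ _ _ hgx]
    have := H x (by simpa using hgx)
    rwa [Function.extend_apply' _ _ _ (by simpa using hx)] at this

/-- Disjoint sites are not enough, as the coefficients need not commute with each other. In either
product a single intermediate tuple contributes. -/
theorem siteEmb_commute {f : κ → ι} {g : μ → ι} (hf : Function.Injective f)
    (hg : Function.Injective g) (hfg : ∀ k j, f k ≠ g j)
    (Y : Matrix (κ → Fin n) (κ → Fin n) L) (Z : Matrix (μ → Fin n) (μ → Fin n) L)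
    (hYZ : ∀ a b c d, Commute (Y a b) (Z c d)) :
    Commute (siteEmb f Y) (siteEmb g Z) := by
  have key : ∀ (Y' : Matrix (κ → Fin n) (κ → Fin n) L) (d : κ → Fin n) (a : ι → Fin n),
      Function.extend f d a ∘ g = a ∘ g := by
    intro _ d a
    funext j
    exact extend_of_forall_ne d a fun k => hfg k j
  have key' : ∀ (d : μ → Fin n) (a : ι → Fin n), Function.extend g d a ∘ f = a ∘ f := by
    intro d a
    funext k
    exact extend_of_forall_ne d a fun j => (hfg k j).symm
  ext a b
  rw [siteEmb_mul_apply hf, siteEmb_mul_apply hg]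
  rw [Finset.sum_eq_single (b ∘ f), Finset.sum_eq_single (b ∘ g)]
  · rw [siteEmb_apply, siteEmb_apply, key Y, key']
    have e : (∀ x, (∀ k, g k ≠ x) → Function.extend f (b ∘ f) a x = b x) ↔
        (∀ x, (∀ k, f k ≠ x) → Function.extend g (b ∘ g) a x = b x) := by
      exact ⟨extend_eq_off_swap hg b, extend_eq_off_swap hf b⟩
    by_cases h : ∀ x, (∀ k, g k ≠ x) → Function.extend f (b ∘ f) a x = b x
    · rw [if_pos h, if_pos (e.1 h)]
      exact hYZ _ _ _ _
    · rw [if_neg h, if_neg (fun h' => h (e.2 h'))]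
      simp
  · intro d _ hd
    rw [siteEmb_apply, if_neg, mul_zero]
    intro H
    apply hd
    funext j
    have := H (g j) fun k => hfg k j
    rwa [hg.extend_apply] at this
  · simp
  · intro d _ hd
    rw [siteEmb_apply, if_neg, mul_zero]
    intro H
    apply hd
    funext k
    have := H (f k) fun j => (hfg k j).symm
    rwa [hf.extend_apply] at this
  · simp

end Embedding

/-! ### Operators on one and two tensor factors as embedded operators. -/

section Sites

variable {L : Type*} [Ring L] {n m : ℕ}

/-- An operator on one factor, as an operator on the first tensor power. -/
def toOne (A : Matrix (Fin n) (Fin n) L) : Matrix (Fin 1 → Fin n) (Fin 1 → Fin n) L :=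
  Matrix.of fun a b => A (a 0) (b 0)

/-- An operator on two factors, as an operator on the second tensor power. -/
def toTwo (A : Matrix (Fin n × Fin n) (Fin n × Fin n) L) :
    Matrix (Fin 2 → Fin n) (Fin 2 → Fin n) L :=
  Matrix.of fun a b => A (a 0, a 1) (b 0, b 1)

theorem oneSite_eq (i : Fin m) (A : Matrix (Fin n) (Fin n) L) :
    oneSite i A = siteEmb ![i] (toOne A) := by
  ext a b
  simp only [oneSite, siteEmb, toOne, Matrix.of_apply, Function.comp_apply, Matrix.cons_val_zero,
    Fin.forall_fin_one]
  congr 1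
  simp only [ne_comm]

theorem twoSite_eq (i j : Fin m) (A : Matrix (Fin n × Fin n) (Fin n × Fin n) L) :
    twoSite i j A = siteEmb ![i, j] (toTwo A) := by
  ext a b
  simp only [twoSite, siteEmb, toTwo, Matrix.of_apply, Function.comp_apply, Matrix.cons_val_zero,
    Matrix.cons_val_one, Fin.forall_fin_two]
  congr 1
  simp only [ne_comm, and_imp]

theorem injective_one (i : Fin m) : Function.Injective ![i] :=
  fun _ _ _ => Subsingleton.elim _ _

theorem injective_two {i j : Fin m} (h : i ≠ j) : Function.Injective ![i, j] := by
  intro x y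
  fin_cases x <;> fin_cases y <;> simp [h, h.symm]

theorem toOne_mul (A B : Matrix (Fin n) (Fin n) L) : toOne (A * B) = toOne A * toOne B := by
  ext a b
  simp only [toOne, Matrix.mul_apply, Matrix.of_apply]
  exact (Fintype.sum_equiv (Equiv.funUnique (Fin 1) (Fin n)) _ _ fun c => rfl).symm

theorem toOne_one : toOne (1 : Matrix (Fin n) (Fin n) L) = 1 := by
  ext a b
  simp only [toOne, Matrix.of_apply, Matrix.one_apply]
  congr 1
  apply propext
  constructor
  · intro h
    funext x
    rwa [Subsingleton.elim x 0]
  · rintro rfl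
    rfl

theorem toTwo_mul (A B : Matrix (Fin n × Fin n) (Fin n × Fin n) L) :
    toTwo (A * B) = toTwo A * toTwo B := by
  ext a b
  simp only [toTwo, Matrix.mul_apply, Matrix.of_apply]
  exact (Fintype.sum_equiv (finTwoArrowEquiv (Fin n)) _ _ fun c => rfl).symm

theorem toTwo_one : toTwo (1 : Matrix (Fin n × Fin n) (Fin n × Fin n) L) = 1 := by
  ext a b
  simp only [toTwo, Matrix.of_apply, Matrix.one_apply, Prod.mk.injEq]
  congr 1
  apply propext
  constructor
  · intro h
    funext x
    fin_cases x
    exacts [h.1, h.2]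
  · rintro rfl
    exact ⟨rfl, rfl⟩

/-- `oneSite i` as a ring homomorphism. -/
def oneSiteHom (i : Fin m) :
    Matrix (Fin n) (Fin n) L →+* Matrix (Fin m → Fin n) (Fin m → Fin n) L where
  toFun := oneSite i
  map_one' := by rw [oneSite_eq, toOne_one, siteEmb_one]
  map_mul' A B := by
    rw [oneSite_eq, oneSite_eq, oneSite_eq, toOne_mul, siteEmb_mul (injective_one i)]
  map_zero' := by ext a b; simp [oneSite]
  map_add' Y Z := by
    ext a b
    simp only [oneSite, Matrix.add_apply, Matrix.of_apply]
    split_ifs <;> simp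

theorem oneSiteHom_apply (i : Fin m) (A : Matrix (Fin n) (Fin n) L) :
    oneSiteHom i A = oneSite i A := rfl

/-- `twoSite i j` as a ring homomorphism. -/
def twoSiteHom (i j : Fin m) (h : i ≠ j) :
    Matrix (Fin n × Fin n) (Fin n × Fin n) L →+* Matrix (Fin m → Fin n) (Fin m → Fin n) L where
  toFun := twoSite i j
  map_one' := by rw [twoSite_eq, toTwo_one, siteEmb_one]
  map_mul' A B := by
    rw [twoSite_eq, twoSite_eq, twoSite_eq, toTwo_mul, siteEmb_mul (injective_two h)]
  map_zero' := by ext a b; simp [twoSite]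
  map_add' Y Z := by
    ext a b
    simp only [twoSite, Matrix.add_apply, Matrix.of_apply]
    split_ifs <;> simp

theorem twoSiteHom_apply (i j : Fin m) (h : i ≠ j)
    (A : Matrix (Fin n × Fin n) (Fin n × Fin n) L) : twoSiteHom i j h A = twoSite i j A := rfl

theorem oneSite_map {L' : Type*} [Ring L'] (φ : L →+* L') (i : Fin m)
    (A : Matrix (Fin n) (Fin n) L) : (oneSite i A).map φ = oneSite i (A.map φ) := by
  ext a b
  simp only [oneSite, Matrix.of_apply, Matrix.map_apply]
  split_ifs <;> simp

theorem twoSite_map {L' : Type*} [Ring L'] (φ : L →+* L') (i j : Fin m)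
    (A : Matrix (Fin n × Fin n) (Fin n × Fin n) L) :
    (twoSite i j A).map φ = twoSite i j (A.map φ) := by
  ext a b
  simp only [twoSite, Matrix.of_apply, Matrix.map_apply]
  split_ifs <;> simp

theorem twoSite_smul (c : L) (i j : Fin m) (A : Matrix (Fin n × Fin n) (Fin n × Fin n) L) :
    twoSite i j (c • A) = c • twoSite i j A := by
  ext a b
  simp only [twoSite, Matrix.of_apply, Matrix.smul_apply]
  split_ifs <;> simp

theorem siteEmb_oneSite {m' : ℕ} {f : Fin m → Fin m'} (hf : Function.Injective f) (i : Fin m)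
    (A : Matrix (Fin n) (Fin n) L) : siteEmb f (oneSite i A) = oneSite (f i) A := by
  rw [oneSite_eq, oneSite_eq, siteEmb_siteEmb hf]
  congr 1
  funext k
  fin_cases k
  rfl

theorem siteEmb_twoSite {m' : ℕ} {f : Fin m → Fin m'} (hf : Function.Injective f) (i j : Fin m)
    (A : Matrix (Fin n × Fin n) (Fin n × Fin n) L) :
    siteEmb f (twoSite i j A) = twoSite (f i) (f j) A := by
  rw [twoSite_eq, twoSite_eq, siteEmb_siteEmb hf]
  congr 1
  funext k
  fin_cases k <;> rfl

theorem oneSite_commute_twoSite {i j k : Fin m} (hij : i ≠ j) (hk : k ≠ i) (hk' : k ≠ j)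
    (A : Matrix (Fin n) (Fin n) L) (B : Matrix (Fin n × Fin n) (Fin n × Fin n) L)
    (h : ∀ a b c, Commute (B a b) c) :
    Commute (oneSite k A) (twoSite i j B) := by
  rw [oneSite_eq, twoSite_eq]
  refine siteEmb_commute (injective_one k) (injective_two hij) ?_ _ _
    fun a b c d => (h _ _ _).symm
  intro x y
  fin_cases x
  fin_cases y <;> simp [hk, hk']

theorem twoSite_commute_twoSite {i j k l : Fin m} (hij : i ≠ j) (hkl : k ≠ l)
    (h1 : i ≠ k) (h2 : i ≠ l) (h3 : j ≠ k) (h4 : j ≠ l)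
    (A B : Matrix (Fin n × Fin n) (Fin n × Fin n) L)
    (h : ∀ a b c, Commute (B a b) c) :
    Commute (twoSite i j A) (twoSite k l B) := by
  rw [twoSite_eq, twoSite_eq]
  refine siteEmb_commute (injective_two hij) (injective_two hkl) ?_ _ _
    fun a b c d => (h _ _ _).symm
  intro x y
  fin_cases x <;> fin_cases y <;> simp [h1, h2, h3, h4]

end Sites

/-! ### Homomorphisms of power series rings -/

section Series

variable {K : Type*} [Field K] {A : Type*} [Ring A] [Algebra K A]

/-- A ring homomorphism with central image. -/
def IsCentralHom {R S : Type*} [Ring R] [Ring S] (φ : R →+* S) : Prop :=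
  ∀ r s, Commute (φ r) s

theorem isCentralHom_algebraMap : IsCentralHom (algebraMap K A) := fun r s =>
  Algebra.commutes r s

theorem IsCentralHom.powerSeries_map {R S : Type*} [Ring R] [Ring S] {φ : R →+* S}
    (h : IsCentralHom φ) : IsCentralHom (PowerSeries.map φ) := by
  intro r s
  ext k
  rw [PowerSeries.coeff_mul, PowerSeries.coeff_mul, ← Finset.Nat.sum_antidiagonal_swap]
  refine Finset.sum_congr rfl fun p _ => ?_
  rw [PowerSeries.coeff_map]
  exact h _ _

/-- `dilate c` as a ring homomorphism. -/
noncomputable def dilateHom (c : K) : PowerSeries A →+* PowerSeries A where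
  toFun := dilate c
  map_one' := by
    ext k
    simp only [dilate, PowerSeries.coeff_mk, PowerSeries.coeff_one]
    split_ifs with h
    · simp [h]
    · simp
  map_mul' f g := by
    ext k
    simp only [dilate, PowerSeries.coeff_mk, PowerSeries.coeff_mul, Finset.smul_sum]
    refine Finset.sum_congr rfl fun p hp => ?_
    rw [smul_mul_smul_comm, ← pow_add, Finset.HasAntidiagonal.mem_antidiagonal.1 hp]
  map_zero' := by ext k; simp [dilate]
  map_add' f g := by ext k; simp [dilate]

theorem dilateHom_apply (c : K) (f : PowerSeries A) : dilateHom c f = dilate c f := rfl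

theorem coeff_dilate (c : K) (f : PowerSeries A) (r : ℕ) :
    PowerSeries.coeff r (dilate c f) = c ^ r • PowerSeries.coeff r f := by
  simp [dilate]

theorem dilate_dilate (c d : K) (f : PowerSeries A) :
    dilate c (dilate d f) = dilate (c * d) f := by
  ext k
  simp [coeff_dilate, mul_pow, smul_smul]

theorem dilate_one (f : PowerSeries A) : dilate (1 : K) f = f := by
  ext k
  simp [coeff_dilate]

theorem dilate_C_mul_X (c d : K) :
    dilate c (PowerSeries.C d * PowerSeries.X) = PowerSeries.C (c * d) * PowerSeries.X := by
  ext k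
  simp only [coeff_dilate, PowerSeries.coeff_C_mul, PowerSeries.coeff_X, smul_eq_mul]
  split_ifs with h
  · simp [h]
  · simp

theorem dilate_smul (c b : K) (f : PowerSeries A) : dilate c (b • f) = b • dilate c f := by
  ext k
  rw [coeff_dilate, PowerSeries.coeff_smul, PowerSeries.coeff_smul, coeff_dilate, smul_comm]

theorem dilate_map {A' : Type*} [Ring A'] [Algebra K A'] (φ : A →ₐ[K] A') (c : K)
    (f : PowerSeries A) :
    dilate c (PowerSeries.map (φ : A →+* A') f) = PowerSeries.map (φ : A →+* A') (dilate c f) := by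
  ext k
  simp [coeff_dilate]

theorem dilate_map_algebraMap (c : K) (f : PowerSeries K) :
    dilate c (PowerSeries.map (algebraMap K A) f) =
      PowerSeries.map (algebraMap K A) (dilate c f) := by
  ext k
  simp [coeff_dilate, Algebra.smul_def]

/-- The specialization of a double power series at `x = c w`, `y = d w`. -/
noncomputable def lineHom (c d : K) : PowerSeries (PowerSeries A) →+* PowerSeries A where
  toFun f := PowerSeries.mk fun r => ∑ p ∈ Finset.HasAntidiagonal.antidiagonal r,
    (c ^ p.1 * d ^ p.2) • PowerSeries.coeff p.2 (PowerSeries.coeff p.1 f)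
  map_one' := by
    ext r
    rw [PowerSeries.coeff_mk, PowerSeries.coeff_one]
    split_ifs with h
    · subst h
      simp
    · refine Finset.sum_eq_zero fun p hp => ?_
      rw [PowerSeries.coeff_one]
      split_ifs with h1
      · rw [PowerSeries.coeff_one, if_neg, smul_zero]
        intro h2
        apply h
        rw [← Finset.HasAntidiagonal.mem_antidiagonal.1 hp, h1, h2]
      · simp
  map_mul' f g := by
    ext r
    simp only [PowerSeries.coeff_mk, PowerSeries.coeff_mul, map_sum, Finset.smul_sum,
      Finset.sum_mul, Finset.mul_sum]
    simp only [Finset.sum_sigma']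
    -- The four exponents (of `x` and of `y`, in `f` and in `g`) are grouped by variable on one side
    -- and by factor on the other. The order of the coefficients is kept, so no commutativity of `A`
    -- is needed.
    refine Finset.sum_nbij'
      (fun s => ⟨(s.2.1.1 + s.2.2.1, s.2.1.2 + s.2.2.2),
        ⟨(s.2.1.2, s.2.2.2), (s.2.1.1, s.2.2.1)⟩⟩)
      (fun s => ⟨(s.2.2.1 + s.2.1.1, s.2.2.2 + s.2.1.2),
        ⟨(s.2.2.1, s.2.1.1), (s.2.2.2, s.2.1.2)⟩⟩)
      ?_ ?_ ?_ ?_ ?_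
    · rintro ⟨⟨i, j⟩, ⟨⟨a, b⟩, ⟨c', d'⟩⟩⟩ h
      simp only [Finset.mem_sigma, Finset.HasAntidiagonal.mem_antidiagonal, and_true] at h ⊢
      omega
    · rintro ⟨⟨i, j⟩, ⟨⟨a, b⟩, ⟨c', d'⟩⟩⟩ h
      simp only [Finset.mem_sigma, Finset.HasAntidiagonal.mem_antidiagonal, and_true] at h ⊢
      omega
    · rintro ⟨⟨i, j⟩, ⟨⟨a, b⟩, ⟨c', d'⟩⟩⟩ h
      simp only [Finset.mem_sigma, Finset.HasAntidiagonal.mem_antidiagonal] at h ⊢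
      obtain ⟨-, rfl, rfl⟩ := h
      rfl
    · rintro ⟨⟨i, j⟩, ⟨⟨a, b⟩, ⟨c', d'⟩⟩⟩ h
      simp only [Finset.mem_sigma, Finset.HasAntidiagonal.mem_antidiagonal] at h ⊢
      obtain ⟨-, rfl, rfl⟩ := h
      rfl
    · rintro ⟨⟨i, j⟩, ⟨⟨a, b⟩, ⟨c', d'⟩⟩⟩ h
      simp only [Finset.mem_sigma, Finset.HasAntidiagonal.mem_antidiagonal] at h ⊢
      obtain ⟨-, rfl, rfl⟩ := h
      rw [smul_mul_smul_comm]
      congr 1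
      ring
  map_zero' := by ext r; simp
  map_add' f g := by ext r; simp [smul_add, Finset.sum_add_distrib]

theorem coeff_lineHom (c d : K) (f : PowerSeries (PowerSeries A)) (r : ℕ) :
    PowerSeries.coeff r (lineHom c d f) = ∑ p ∈ Finset.HasAntidiagonal.antidiagonal r,
      (c ^ p.1 * d ^ p.2) • PowerSeries.coeff p.2 (PowerSeries.coeff p.1 f) := by
  simp [lineHom]

theorem lineHom_C (c d : K) (f : PowerSeries A) :
    lineHom c d (PowerSeries.C f) = dilate d f := by
  ext r
  rw [coeff_lineHom, coeff_dilate, Finset.sum_eq_single (0, r)]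
  · simp
  · rintro ⟨i, j⟩ h hne
    have h' := Finset.HasAntidiagonal.mem_antidiagonal.1 h
    have : i ≠ 0 := by
      rintro rfl
      apply hne
      simp at h'
      rw [h']
    simp [PowerSeries.coeff_C, this]
  · simp

theorem lineHom_map_C (c d : K) (f : PowerSeries A) :
    lineHom c d (PowerSeries.map PowerSeries.C f) = dilate c f := by
  ext r
  rw [coeff_lineHom, coeff_dilate, Finset.sum_eq_single (r, 0)]
  · simp
  · rintro ⟨i, j⟩ h hne
    have h' := Finset.HasAntidiagonal.mem_antidiagonal.1 h
    have : j ≠ 0 := by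
      rintro rfl
      apply hne
      simp at h'
      rw [h']
    simp [PowerSeries.coeff_C, this]
  · simp

theorem lineHom_X (c d : K) :
    lineHom c d (PowerSeries.X : PowerSeries (PowerSeries A)) = c • PowerSeries.X := by
  have : (PowerSeries.X : PowerSeries (PowerSeries A)) =
      PowerSeries.map PowerSeries.C (PowerSeries.X : PowerSeries A) := by simp
  rw [this, lineHom_map_C]
  ext r
  rw [coeff_dilate, PowerSeries.coeff_smul, PowerSeries.coeff_X]
  split_ifs with h
  · simp [h]
  · simp

theorem lineHom_C_X (c d : K) :
    lineHom c d (PowerSeries.C (PowerSeries.X : PowerSeries A)) = d • PowerSeries.X := by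
  rw [lineHom_C]
  ext r
  rw [coeff_dilate, PowerSeries.coeff_smul, PowerSeries.coeff_X]
  split_ifs with h
  · simp [h]
  · simp

theorem lineHom_smul (c d b : K) (f : PowerSeries (PowerSeries A)) :
    lineHom c d (b • f) = b • lineHom c d f := by
  ext r
  simp only [coeff_lineHom, PowerSeries.coeff_smul, Finset.smul_sum]
  refine Finset.sum_congr rfl fun p _ => ?_
  rw [smul_comm]

/-- The substitution `x ↦ c x`, `y ↦ c y` in a double power series. -/
noncomputable def dilateHom₂ (c : K) :
    PowerSeries (PowerSeries A) →+* PowerSeries (PowerSeries A) :=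
  (dilateHom c).comp (PowerSeries.map (dilateHom c))

theorem dilateHom₂_X (c : K) :
    dilateHom₂ c (PowerSeries.X : PowerSeries (PowerSeries A)) = c • PowerSeries.X := by
  rw [dilateHom₂, RingHom.comp_apply, PowerSeries.map_X, dilateHom_apply]
  ext1 r
  rw [coeff_dilate, PowerSeries.coeff_smul, PowerSeries.coeff_X]
  split_ifs with h
  · simp [h]
  · simp

theorem dilateHom₂_C (c : K) (f : PowerSeries A) :
    dilateHom₂ c (PowerSeries.C f) = PowerSeries.C (dilate c f) := by
  rw [dilateHom₂, RingHom.comp_apply, PowerSeries.map_C, dilateHom_apply, dilateHom_apply]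
  ext1 r
  rw [coeff_dilate, PowerSeries.coeff_C]
  split_ifs with h
  · simp [h]
  · simp

theorem dilate_X (c : K) : dilate c (PowerSeries.X : PowerSeries A) = c • PowerSeries.X := by
  ext r
  rw [coeff_dilate, PowerSeries.coeff_smul, PowerSeries.coeff_X]
  split_ifs with h
  · simp [h]
  · simp

theorem dilateHom₂_map_C (c : K) (f : PowerSeries A) :
    dilateHom₂ c (PowerSeries.map PowerSeries.C f) =
      PowerSeries.map PowerSeries.C (dilate c f) := by
  rw [dilateHom₂, RingHom.comp_apply, dilateHom_apply]
  ext r s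
  simp only [coeff_dilate, PowerSeries.coeff_map, PowerSeries.coeff_smul, dilateHom_apply,
    PowerSeries.coeff_C]
  split_ifs with h
  · simp [h]
  · simp

theorem dilateHom₂_smul (c b : K) (f : PowerSeries (PowerSeries A)) :
    dilateHom₂ c (b • f) = b • dilateHom₂ c f := by
  rw [dilateHom₂, RingHom.comp_apply, RingHom.comp_apply, dilateHom_apply, dilateHom_apply]
  ext r s
  simp only [coeff_dilate, PowerSeries.coeff_map, PowerSeries.coeff_smul, dilateHom_apply]
  rw [smul_comm b (c ^ r), smul_comm b (c ^ s)]

end Series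

/-! ### Invertibility of matrices of power series. -/

section MatrixSeries

variable {A : Type*} [Ring A] {ι : Type*} [Fintype ι] [DecidableEq ι]

/-- A power series of matrices as a matrix of power series. -/
noncomputable def matrixSeriesHom :
    PowerSeries (Matrix ι ι A) →+* Matrix ι ι (PowerSeries A) where
  toFun f := Matrix.of fun i j => PowerSeries.mk fun r => PowerSeries.coeff r f i j
  map_one' := by
    ext i j r
    simp only [Matrix.of_apply, PowerSeries.coeff_mk, PowerSeries.coeff_one, Matrix.one_apply,
      apply_ite (fun f : Matrix ι ι A => f i j), Matrix.zero_apply]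
    split_ifs with h1 h2 <;> simp_all [PowerSeries.coeff_one]
  map_mul' f g := by
    ext i j r
    simp only [Matrix.of_apply, PowerSeries.coeff_mk, PowerSeries.coeff_mul, Matrix.sum_apply,
      Matrix.mul_apply, map_sum]
    rw [Finset.sum_comm]
  map_zero' := by ext i j r; simp
  map_add' f g := by ext i j r; simp

/-- Over a noncommutative ring there is no determinant to test. Instead `S` is read as a power
series over the matrix ring, where an invertible constant term suffices. -/
theorem isUnit_matrix_of_constantCoeff (S : Matrix ι ι (PowerSeries A))
    (h : IsUnit (S.map PowerSeries.constantCoeff)) : IsUnit S := by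
  have e : S = matrixSeriesHom (PowerSeries.mk fun r => S.map (PowerSeries.coeff r)) := by
    ext i j r
    simp [matrixSeriesHom]
  rw [e]
  refine IsUnit.map _ ?_
  rw [PowerSeries.isUnit_iff_constantCoeff, ← PowerSeries.coeff_zero_eq_constantCoeff_apply,
    PowerSeries.coeff_mk]
  convert h using 1
  ext i j
  simp

end MatrixSeries

/-! ### The weight-zero block of `R̄ᵗ` and its Schur complements -/

section Crossing

variable {L : Type*} [Ring L] {n : ℕ}

/-- The operator on two factors equal to `c` on the span of the `e_i ⊗ e_i` and to the identity on
the other `e_i ⊗ e_j`. -/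
def zeroWeight (c : Matrix (Fin n) (Fin n) L) :
    Matrix (Fin n × Fin n) (Fin n × Fin n) L :=
  Matrix.of fun a b =>
    if a.1 = a.2 ∧ b.1 = b.2 then c a.1 b.1 else if a = b then 1 else 0

theorem zeroWeight_apply (c : Matrix (Fin n) (Fin n) L) (a b : Fin n × Fin n) :
    zeroWeight c a b =
      if a.1 = a.2 ∧ b.1 = b.2 then c a.1 b.1 else if a = b then 1 else 0 := rfl

theorem zeroWeight_one : zeroWeight (1 : Matrix (Fin n) (Fin n) L) = 1 := by
  ext ⟨a1, a2⟩ ⟨b1, b2⟩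
  simp only [zeroWeight_apply, Matrix.one_apply, Prod.mk.injEq]
  by_cases h : a1 = a2 ∧ b1 = b2
  · obtain ⟨rfl, rfl⟩ := h
    simp
  · rw [if_neg h]

/-- The span of the `e_i ⊗ e_i` and the span of the other basis vectors are both invariant, so only
the first block multiplies. In particular the inverse of `R̄ᵗ` has the same shape, which the
compression arguments rely on. -/
theorem zeroWeight_mul (c d : Matrix (Fin n) (Fin n) L) :
    zeroWeight (c * d) = zeroWeight c * zeroWeight d := by
  ext ⟨a1, a2⟩ ⟨b1, b2⟩
  rw [Matrix.mul_apply]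
  by_cases ha : a1 = a2
  · subst ha
    by_cases hb : b1 = b2
    · subst hb
      rw [Fintype.sum_prod_type]
      simp only [zeroWeight_apply, Matrix.mul_apply]
      simp only [true_and, and_true, if_true]
      refine Finset.sum_congr rfl fun i _ => ?_
      rw [Finset.sum_eq_single i]
      · simp
      · intro j _ hj
        have h1 : ¬ i = j := fun h => hj h.symm
        have h2 : ¬ (a1 = i ∧ a1 = j) := fun h => h1 (h.1.symm.trans h.2)
        simp [h1, h2]
      · simp
    · have h1 : ¬ (a1 = b1 ∧ a1 = b2) := fun h => hb (h.1.symm.trans h.2)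
      have e : zeroWeight (c * d) (a1, a1) (b1, b2) = 0 := by
        simp [zeroWeight_apply, hb, h1]
      rw [e]
      symm
      refine Finset.sum_eq_zero ?_
      rintro ⟨i, j⟩ _
      by_cases hij : i = j
      · subst hij
        have h2 : ¬ (i = b1 ∧ i = b2) := fun h => hb (h.1.symm.trans h.2)
        simp [zeroWeight_apply, hb, h2]
      · have h2 : ¬ (a1 = i ∧ a1 = j) := fun h => hij (h.1.symm.trans h.2)
        simp [zeroWeight_apply, hij, h2]
  · rw [Finset.sum_eq_single (a1, a2)]
    · simp [zeroWeight_apply, ha]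
    · rintro ⟨i, j⟩ _ hne
      have h2 : ¬ (a1 = i ∧ a2 = j) := fun h => hne (by rw [h.1, h.2])
      simp [zeroWeight_apply, ha, h2]
    · simp

theorem zeroWeight_map {L' : Type*} [Ring L'] (φ : L →+* L') (c : Matrix (Fin n) (Fin n) L) :
    (zeroWeight c).map φ = zeroWeight (c.map φ) := by
  ext a b
  simp only [zeroWeight_apply, Matrix.map_apply]
  split_ifs <;> simp

theorem zeroWeight_submatrix {N : ℕ} {f : Fin N → Fin n} (hf : Function.Injective f)
    (c : Matrix (Fin n) (Fin n) L) :
    (zeroWeight c).submatrix (Prod.map f f) (Prod.map f f) = zeroWeight (c.submatrix f f) := by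
  ext ⟨a1, a2⟩ ⟨b1, b2⟩
  simp only [zeroWeight_apply, Matrix.submatrix_apply, Prod.map_apply, hf.eq_iff, Prod.mk.injEq]

end Crossing

/-! ### Crossing: inverses of `R̄ᵗ` and their compressions. -/

section Weight

variable {K : Type*} [Field K] {L : Type*} [CommRing L] [Algebra K L]

/-- The matrix of `t Rᵗ(x, 1)` on the span of the `e_i ⊗ e_i`. -/
def weightMatrix (n : ℕ) (q : K) (x t : L) : Matrix (Fin n) (Fin n) L :=
  Matrix.of fun i j => t * if i = j then q⁻¹ • x - q • 1 else
    if i < j then (q⁻¹ - q) • x else (q⁻¹ - q) • 1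

/-- Transposing the first factor turns `E_ij ⊗ E_ji` into `E_ji ⊗ E_ji`, which only sees the vectors
`e_i ⊗ e_i`; on the other basis vectors the scalar `x - 1` remains, and `t` normalizes it to `1`. -/
theorem smul_partialTranspose_rMatrix (n : ℕ) (q : K) (x t : L) (ht : t * (x - 1) = 1) :
    t • partialTranspose (rMatrix n q x 1) = zeroWeight (weightMatrix n q x t) := by
  ext ⟨a1, a2⟩ ⟨b1, b2⟩
  simp only [zeroWeight_apply, weightMatrix, rMatrix, partialTranspose, Matrix.smul_apply,
    Matrix.of_apply, smul_eq_mul, Prod.mk.injEq]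
  by_cases h1 : a1 = a2
  · subst h1
    by_cases h2 : b1 = b2
    · subst h2
      by_cases h3 : a1 = b1
      · subst h3
        simp
      · have h3' : ¬ b1 = a1 := fun h => h3 h.symm
        simp [h3, h3']
    · have : ¬ (b1 = a1 ∧ a1 = b2) := fun h => h2 (h.1.trans h.2)
      have h' : ¬ (a1 = b1 ∧ a1 = b2) := fun h => h2 (h.1.symm.trans h.2)
      simp [h2, this, h']
  · by_cases h3 : a1 = b1 ∧ a2 = b2
    · obtain ⟨rfl, rfl⟩ := h3
      simp [h1, ht]
    · have h3' : ¬ (b1 = a1 ∧ a2 = b2) := fun h => h3 ⟨h.1.symm, h.2⟩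
      have h1' : ¬ a2 = a1 := fun h => h1 h.symm
      simp [h1, h3, h3', h1']

/-- A scalar at which the `R`-matrix can be normalized and inverted. -/
def IsSmall (K : Type*) [Field K] {L : Type*} [CommRing L] [Algebra K L] (x : L) : Prop :=
  ∀ c : K, IsUnit (1 - c • x)

theorem IsSmall.smul {x : L} (hx : IsSmall K x) (d : K) : IsSmall K (d • x) := fun c => by
  rw [smul_smul]
  exact hx _

theorem IsSmall.isUnit_sub_one {x : L} (hx : IsSmall K x) : IsUnit (x - 1) := by
  have := (hx 1).neg
  simpa using this

/-- The matrix of `R̄ᵗ(x)` on the span of the `e_i ⊗ e_i`. -/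
noncomputable def weightBar (n : ℕ) (q : K) (x : L) : Matrix (Fin n) (Fin n) L :=
  weightMatrix n q x (Ring.inverse (x - 1))

theorem exists_inverse_weight {q : K} (hq : q ≠ 0) {x : L} (hx : IsSmall K x) :
    ∃ e : L, e * (q⁻¹ • x - q • 1) = 1 ∧
      Ring.inverse ((q⁻¹ ^ 2) • x - 1) = algebraMap K L q * e := by
  have hu : IsUnit ((q⁻¹ ^ 2) • x - 1) := (hx.smul _).isUnit_sub_one
  have hPQ : algebraMap K L q⁻¹ * algebraMap K L q = 1 := by
    rw [← map_mul, inv_mul_cancel₀ hq, map_one]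
  refine ⟨algebraMap K L q⁻¹ * Ring.inverse ((q⁻¹ ^ 2) • x - 1), ?_, ?_⟩
  · have h := Ring.inverse_mul_cancel _ hu
    simp only [Algebra.smul_def, map_pow, mul_one] at h ⊢
    linear_combination h - Ring.inverse (algebraMap K L q⁻¹ ^ 2 * x - 1) * hPQ
  · linear_combination (-Ring.inverse ((q⁻¹ ^ 2) • x - 1)) * hPQ

/-- The pivot in the last diagonal place is `t (q⁻¹ x - q)`, with inverse `(x - 1) e`. Eliminating
it reproduces the same family in size one smaller, at `q⁻² x`. Every power of `q` in the later
dilations originates here. -/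
theorem weightBar_schur {n : ℕ} {q : K} (hq : q ≠ 0) {x : L} (hx : IsSmall K x) {e : L}
    (he : e * (q⁻¹ • x - q • 1) = 1)
    (he' : Ring.inverse ((q⁻¹ ^ 2) • x - 1) = algebraMap K L q * e) (i j : Fin n) :
    weightBar (n + 1) q x i.castSucc j.castSucc -
      weightBar (n + 1) q x i.castSucc (Fin.last n) * ((x - 1) * e) *
        weightBar (n + 1) q x (Fin.last n) j.castSucc =
      weightBar n q ((q⁻¹ ^ 2) • x) i j := by
  have hPQ : algebraMap K L q⁻¹ * algebraMap K L q = 1 := by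
    rw [← map_mul, inv_mul_cancel₀ hq, map_one]
  have h1 := Ring.inverse_mul_cancel _ hx.isUnit_sub_one
  set t := Ring.inverse (x - 1)
  have ei : i.castSucc ≠ Fin.last n := (Fin.castSucc_lt_last i).ne
  have ej : Fin.last n ≠ j.castSucc := (Fin.castSucc_lt_last j).ne'
  have lj : ¬ Fin.last n < j.castSucc := (Fin.castSucc_lt_last j).not_gt
  have li : i.castSucc < Fin.last n := Fin.castSucc_lt_last i
  simp only [weightBar, weightMatrix, Matrix.of_apply, ei, ej, lj, li, if_true, if_false, he',
    Fin.castSucc_inj, Fin.castSucc_lt_castSucc_iff]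
  simp only [Algebra.smul_def, map_pow, map_sub, mul_one] at he ⊢
  generalize algebraMap K L q⁻¹ = P at *
  generalize algebraMap K L q = Q at *
  split_ifs
  · grind
  · grind
  · grind

/-- A corner of an inverse matrix is the inverse of the complementary Schur complement. -/
theorem submatrix_mul_weightBar {n : ℕ} {q : K} (hq : q ≠ 0) {x : L} (hx : IsSmall K x)
    {G : Matrix (Fin (n + 1)) (Fin (n + 1)) L} (hG : G * weightBar (n + 1) q x = 1) :
    G.submatrix Fin.castSucc Fin.castSucc * weightBar n q ((q⁻¹ ^ 2) • x) = 1 := by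
  obtain ⟨e, he, he'⟩ := exists_inverse_weight hq hx
  have hll : weightBar (n + 1) q x (Fin.last n) (Fin.last n) * ((x - 1) * e) = 1 := by
    have h1 := Ring.inverse_mul_cancel _ hx.isUnit_sub_one
    simp only [weightBar, weightMatrix, Matrix.of_apply, if_true]
    linear_combination (e * (q⁻¹ • x - q • 1)) * h1 + he
  ext i j
  have h := fun b => congrFun (congrFun hG i.castSucc) b
  simp only [Matrix.mul_apply, Fin.sum_univ_castSucc] at h
  have hj := h j.castSucc
  have hl := h (Fin.last n)
  rw [Matrix.one_apply_ne (Fin.castSucc_lt_last i).ne] at hl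
  have e1 : (1 : Matrix (Fin (n + 1)) (Fin (n + 1)) L) i.castSucc j.castSucc =
      (1 : Matrix (Fin n) (Fin n) L) i j := by
    simp [Matrix.one_apply]
  rw [e1] at hj
  rw [← hj, Matrix.mul_apply]
  simp only [Matrix.submatrix_apply, ← weightBar_schur hq hx he he', mul_sub, ← mul_assoc,
    Finset.sum_sub_distrib, ← Finset.sum_mul]
  -- The last column of `G * w = 1` determines the entry of `G` in its last column through the
  -- inverse pivot; that value is substituted into column `j`.
  linear_combination (-(x - 1) * e * weightBar (n + 1) q x (Fin.last n) j.castSucc) * hl +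
    (G i.castSucc (Fin.last n) * weightBar (n + 1) q x (Fin.last n) j.castSucc) * hll

/-- Induction on the size: with an invertible pivot, invertibility is that of the Schur complement,
which is the smaller matrix at `q⁻² x`. Smallness is stable under scaling, so the induction
continues. -/
theorem isUnit_weightBar {q : K} (hq : q ≠ 0) (n : ℕ) {x : L} (hx : IsSmall K x) :
    IsUnit (weightBar n q x) := by
  induction n generalizing x with
  | zero =>
    rw [Matrix.isUnit_iff_isUnit_det, Matrix.det_fin_zero]
    exact isUnit_one
  | succ n ih =>
    obtain ⟨e, he, he'⟩ := exists_inverse_weight hq hx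
    have hll : weightBar (n + 1) q x (Fin.last n) (Fin.last n) * ((x - 1) * e) = 1 := by
      have h1 := Ring.inverse_mul_cancel _ hx.isUnit_sub_one
      simp only [weightBar, weightMatrix, Matrix.of_apply, if_true]
      linear_combination (e * (q⁻¹ • x - q • 1)) * h1 + he
    set w := weightBar (n + 1) q x
    let f : Fin n ⊕ Unit → Fin (n + 1) := Sum.elim Fin.castSucc fun _ => Fin.last n
    have hf : Function.Bijective f := by
      rw [Fintype.bijective_iff_injective_and_card]
      refine ⟨?_, by simp⟩
      rintro (i | i) (j | j) h
      · simpa [f] using h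
      · exact absurd h (Fin.castSucc_lt_last i).ne
      · exact absurd h (Fin.castSucc_lt_last j).ne'
      · rfl
    let D : Matrix Unit Unit L := Matrix.of fun _ _ => w (Fin.last n) (Fin.last n)
    let D' : Matrix Unit Unit L := Matrix.of fun _ _ => (x - 1) * e
    let _ : Invertible D := ⟨D', by ext; rw [Matrix.mul_apply]; simpa [D, D', mul_comm] using hll,
      by ext; rw [Matrix.mul_apply]; simpa [D, D'] using hll⟩
    have hinv : ⅟D = D' := rfl
    have hw : w.submatrix f f = Matrix.fromBlocks
        (w.submatrix Fin.castSucc Fin.castSucc)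
        (Matrix.of fun i _ => w i.castSucc (Fin.last n))
        (Matrix.of fun _ j => w (Fin.last n) j.castSucc) D := by
      ext (i | i) (j | j) <;> rfl
    rw [Matrix.isUnit_iff_isUnit_det, ← Matrix.det_submatrix_equiv_self (Equiv.ofBijective f hf)]
    change IsUnit (w.submatrix f f).det
    rw [← Matrix.isUnit_iff_isUnit_det, hw, Matrix.isUnit_fromBlocks_iff_of_invertible₂₂]
    convert ih (hx.smul (q⁻¹ ^ 2)) using 1
    ext i j
    rw [← weightBar_schur hq hx he he']
    simp [hinv, D', Matrix.mul_apply, w]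

theorem submatrix_castAdd_mul_weightBar {q : K} (hq : q ≠ 0) (N M : ℕ) {x : L}
    (hx : IsSmall K x) {G : Matrix (Fin (N + M)) (Fin (N + M)) L}
    (hG : G * weightBar (N + M) q x = 1) :
    G.submatrix (Fin.castAdd M) (Fin.castAdd M) * weightBar N q ((q⁻¹ ^ (2 * M)) • x) = 1 := by
  induction M generalizing x with
  | zero =>
    simpa using hG
  | succ M ih =>
    have := ih (hx.smul _) (submatrix_mul_weightBar hq hx hG)
    rw [smul_smul, ← pow_add] at this
    exact this

/-- The operator `R̄ᵗ(x)`. -/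
noncomputable def rBarCross (n : ℕ) (q : K) (x : L) :
    Matrix (Fin n × Fin n) (Fin n × Fin n) L :=
  zeroWeight (weightBar n q x)

theorem rBarCross_eq (n : ℕ) (q : K) {x : L} (hx : IsSmall K x) :
    rBarCross n q x = Ring.inverse (x - 1) • partialTranspose (rMatrix n q x 1) :=
  (smul_partialTranspose_rMatrix n q x _ (Ring.inverse_mul_cancel _ hx.isUnit_sub_one)).symm

theorem isUnit_rBarCross {q : K} (hq : q ≠ 0) (n : ℕ) {x : L} (hx : IsSmall K x) :
    IsUnit (rBarCross n q x) := by
  obtain ⟨u, hu⟩ := isUnit_weightBar hq n hx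
  refine ⟨⟨zeroWeight (weightBar n q x), zeroWeight (↑u⁻¹ : Matrix (Fin n) (Fin n) L), ?_, ?_⟩,
    rfl⟩
  · rw [← zeroWeight_mul, ← hu, Units.mul_inv, zeroWeight_one]
  · rw [← zeroWeight_mul, ← hu, Units.inv_mul, zeroWeight_one]

/-- Since the inverse is again of weight-zero shape, its compression can be computed on the span of
the `e_i ⊗ e_i`, where eliminating `M` indices multiplies the argument by `q^{-2M}`. -/
theorem submatrix_inverse_mul_rBarCross {q : K} (hq : q ≠ 0) (N M : ℕ) {x : L}
    (hx : IsSmall K x)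
    {G : Matrix (Fin (N + M) × Fin (N + M)) (Fin (N + M) × Fin (N + M)) L}
    (hG : G * rBarCross (N + M) q x = 1) :
    (∃ g, G = zeroWeight g) ∧
    G.submatrix (Prod.map (Fin.castAdd M) (Fin.castAdd M))
        (Prod.map (Fin.castAdd M) (Fin.castAdd M)) *
      rBarCross N q ((q⁻¹ ^ (2 * M)) • x) = 1 := by
  obtain ⟨u, hu⟩ := isUnit_weightBar hq (N + M) hx
  have e : G = zeroWeight (↑u⁻¹ : Matrix (Fin (N + M)) (Fin (N + M)) L) := by
    have h : rBarCross (N + M) q x *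
        zeroWeight (↑u⁻¹ : Matrix (Fin (N + M)) (Fin (N + M)) L) = 1 := by
      rw [rBarCross, ← zeroWeight_mul, ← hu, Units.mul_inv, zeroWeight_one]
    calc G = G * (rBarCross (N + M) q x *
        zeroWeight (↑u⁻¹ : Matrix (Fin (N + M)) (Fin (N + M)) L)) := by rw [h, mul_one]
      _ = _ := by rw [← mul_assoc, hG, one_mul]
  refine ⟨⟨_, e⟩, ?_⟩
  rw [e, zeroWeight_submatrix (Fin.castAdd_injective N M), rBarCross, ← zeroWeight_mul,
    submatrix_castAdd_mul_weightBar hq N M hx (by rw [← hu, Units.inv_mul]), zeroWeight_one]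

theorem weightBar_submatrix {n N : ℕ} (q : K) (x : L) {f : Fin N → Fin n} (hf : StrictMono f) :
    (weightBar n q x).submatrix f f = weightBar N q x := by
  ext i j
  simp [weightBar, weightMatrix, hf.lt_iff_lt, hf.injective.eq_iff]

theorem rBarCross_submatrix {n N : ℕ} (q : K) (x : L) {f : Fin N → Fin n} (hf : StrictMono f) :
    (rBarCross n q x).submatrix (Prod.map f f) (Prod.map f f) = rBarCross N q x := by
  rw [rBarCross, zeroWeight_submatrix hf.injective, weightBar_submatrix q x hf, rBarCross]

theorem weightBar_map {n : ℕ} {L' : Type*} [CommRing L'] [Algebra K L'] (q : K) {x : L}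
    (hx : IsSmall K x) (φ : L →+* L') (hφ : ∀ (c : K) y, φ (c • y) = c • φ y) :
    (weightBar n q x).map φ = weightBar n q (φ x) := by
  have e : φ (Ring.inverse (x - 1)) = Ring.inverse (φ x - 1) := by
    obtain ⟨u, hu⟩ := hx.isUnit_sub_one
    have : φ x - 1 = ((Units.map (φ : L →* L') u : L'ˣ) : L') := by
      simp [hu]
    rw [this, ← hu, Ring.inverse_unit, Ring.inverse_unit]
    simp
  ext i j
  simp only [weightBar, weightMatrix, Matrix.map_apply, Matrix.of_apply, map_mul, e]
  congr 1
  split_ifs <;> simp [hφ]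

end Weight

/-! ### Yang–Baxter relations for the partial transposes -/

section YangBaxter

variable {L : Type*} [CommRing L] {n : ℕ}

theorem sum_pair_eq_sum_extend {m : ℕ} (Y : Matrix (Fin m → Fin n) (Fin m → Fin n) L)
    {i j : Fin m} (hij : i ≠ j) (X : Matrix (Fin n × Fin n) (Fin n × Fin n) L)
    (a b : Fin m → Fin n) :
    (Y * twoSite i j X) a b =
      ∑ c, ∑ d, Y a (Function.update (Function.update b i c) j d) * X (c, d) (b i, b j) := by
  rw [twoSite_eq, mul_siteEmb_apply (injective_two hij)]
  rw [← Fintype.sum_prod_type'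
    (f := fun c d => Y a (Function.update (Function.update b i c) j d) * X (c, d) (b i, b j))]
  refine Fintype.sum_equiv (finTwoArrowEquiv (Fin n)) _ _ fun p => ?_
  have e : Function.extend ![i, j] p b = Function.update (Function.update b i (p 0)) j (p 1) := by
    symm
    rw [eq_extend_iff (injective_two hij)]
    constructor
    · funext k
      fin_cases k <;> simp [hij]
    · intro x hx
      have h0 := hx 0
      have h1 := hx 1
      simp only [Matrix.cons_val_zero, Matrix.cons_val_one] at h0 h1
      rw [Function.update_of_ne h1.symm, Function.update_of_ne h0.symm]
  rw [e]
  rfl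

/-- An operator on two factors which is a combination of the identity and of a weighted flip. -/
def iceMatrix (β : Fin n → Fin n → L) : Matrix (Fin n × Fin n) (Fin n × Fin n) L :=
  Matrix.of fun a b => (if a = b then 1 else 0) + if a = b.swap then β b.1 b.2 else 0

/-- Only the identity and the flip contribute to a column, so a product of three such operators is
an explicit sum of eight terms. -/
theorem mul_twoSite_iceMatrix {m : ℕ} (Y : Matrix (Fin m → Fin n) (Fin m → Fin n) L)
    {i j : Fin m} (hij : i ≠ j) (β : Fin n → Fin n → L) (a b : Fin m → Fin n) :
    (Y * twoSite i j (iceMatrix β)) a b =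
      Y a b + Y a (Function.update (Function.update b i (b j)) j (b i)) * β (b i) (b j) := by
  rw [sum_pair_eq_sum_extend Y hij]
  simp only [iceMatrix, Matrix.of_apply, mul_add, Finset.sum_add_distrib]
  congr 1
  · rw [Finset.sum_eq_single (b i), Finset.sum_eq_single (b j)]
    · simp
    · intro d _ hd
      simp [hd]
    · simp
    · intro c _ hc
      simp [hc]
    · simp
  · rw [Finset.sum_eq_single (b j), Finset.sum_eq_single (b i)]
    · simp
    · intro d _ hd
      simp [hd]
    · simp
    · intro c _ hc
      simp [hc]
    · simp

/-- The transposition in the second tensor factor. -/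
def transposeSnd (A : Matrix (Fin n × Fin n) (Fin n × Fin n) L) :
    Matrix (Fin n × Fin n) (Fin n × Fin n) L :=
  Matrix.of fun a b => A (a.1, b.2) (b.1, a.2)

/-- The transposition in the factor `k` of a tensor power. -/
def transposeSite {m : ℕ} (k : Fin m) (Y : Matrix (Fin m → Fin n) (Fin m → Fin n) L) :
    Matrix (Fin m → Fin n) (Fin m → Fin n) L :=
  Matrix.of fun a b => Y (Function.update a k (b k)) (Function.update b k (a k))

theorem transposeSite_apply {m : ℕ} (k : Fin m) (Y : Matrix (Fin m → Fin n) (Fin m → Fin n) L)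
    (a b : Fin m → Fin n) : transposeSite k Y a b =
      Y (Function.update a k (b k)) (Function.update b k (a k)) := rfl

theorem transposeSite_injective {m : ℕ} (k : Fin m) :
    Function.Injective (transposeSite (n := n) (L := L) k) := by
  intro Y Z h
  ext a b
  have := congrFun (congrFun h (Function.update a k (b k))) (Function.update b k (a k))
  simpa [transposeSite] using this

theorem eta_three (b : Fin 3 → Fin n) : b = ![b 0, b 1, b 2] := by
  funext k
  fin_cases k <;> rfl

theorem update_three_zero (x y z c : Fin n) : Function.update ![x, y, z] 0 c = ![c, y, z] := by
  funext k
  fin_cases k <;> rfl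

theorem update_three_one (x y z c : Fin n) : Function.update ![x, y, z] 1 c = ![x, c, z] := by
  funext k
  fin_cases k <;> rfl

theorem update_three_two (x y z c : Fin n) : Function.update ![x, y, z] 2 c = ![x, y, c] := by
  funext k
  fin_cases k <;> rfl

theorem three_val_two {α : Type*} (x y z : α) : (![x, y, z] : Fin 3 → α) 2 = z := rfl

theorem twoSite_three_zero_one (A : Matrix (Fin n × Fin n) (Fin n × Fin n) L)
    (x y z x' y' z' : Fin n) :
    twoSite 0 1 A ![x, y, z] ![x', y', z'] =
      if z = z' then A (x, y) (x', y') else 0 := by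
  by_cases h : z = z' <;> simp [twoSite, Fin.forall_fin_succ, h]

theorem twoSite_three_zero_two (A : Matrix (Fin n × Fin n) (Fin n × Fin n) L)
    (x y z x' y' z' : Fin n) :
    twoSite 0 2 A ![x, y, z] ![x', y', z'] =
      if y = y' then A (x, z) (x', z') else 0 := by
  by_cases h : y = y' <;> simp [twoSite, Fin.forall_fin_succ, h]

theorem twoSite_three_one_two (A : Matrix (Fin n × Fin n) (Fin n × Fin n) L)
    (x y z x' y' z' : Fin n) :
    twoSite 1 2 A ![x, y, z] ![x', y', z'] =
      if x = x' then A (y, z) (y', z') else 0 := by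
  by_cases h : x = x' <;> simp [twoSite, Fin.forall_fin_succ, h]

theorem transposeSite_mul_twoSite {m : ℕ} {i j k : Fin m} (hij : i ≠ j) (hi : i ≠ k) (hj : j ≠ k)
    (A : Matrix (Fin n × Fin n) (Fin n × Fin n) L)
    (Y : Matrix (Fin m → Fin n) (Fin m → Fin n) L) :
    transposeSite k (Y * twoSite i j A) = transposeSite k Y * twoSite i j A := by
  ext a b
  rw [sum_pair_eq_sum_extend _ hij, transposeSite_apply, sum_pair_eq_sum_extend _ hij]
  simp only [transposeSite_apply]
  simp only [Function.update_of_ne hi, Function.update_of_ne hj]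
  refine Finset.sum_congr rfl fun c _ => Finset.sum_congr rfl fun d _ => ?_
  have e : Function.update (Function.update (Function.update b k (a k)) i c) j d =
      Function.update (Function.update (Function.update b i c) j d) k
        (a k) := by
    rw [Function.update_comm hi.symm, Function.update_comm hj.symm]
  rw [Function.update_of_ne hj.symm, Function.update_of_ne hi.symm]
  exact congrArg (fun z => Y _ z * _) e

theorem transpose_twoSite {m : ℕ} (i j : Fin m) (A : Matrix (Fin n × Fin n) (Fin n × Fin n) L) :
    (twoSite i j A).transpose = twoSite i j A.transpose := by
  ext a b
  simp only [Matrix.transpose_apply, twoSite, Matrix.of_apply, eq_comm]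

theorem transposeSite_transpose {m : ℕ} (k : Fin m)
    (Y : Matrix (Fin m → Fin n) (Fin m → Fin n) L) :
    transposeSite k Y.transpose = (transposeSite k Y).transpose := rfl

theorem transposeSite_twoSite_mul {m : ℕ} {i j k : Fin m} (hij : i ≠ j) (hi : i ≠ k) (hj : j ≠ k)
    (A : Matrix (Fin n × Fin n) (Fin n × Fin n) L)
    (Y : Matrix (Fin m → Fin n) (Fin m → Fin n) L) :
    transposeSite k (twoSite i j A * Y) = twoSite i j A * transposeSite k Y := by
  apply Matrix.transpose_injective
  rw [← transposeSite_transpose, Matrix.transpose_mul, Matrix.transpose_mul, transpose_twoSite,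
    transposeSite_mul_twoSite hij hi hj, transposeSite_transpose]

/-- Transposing the only shared factor reverses the order of the two operators; this uses
commutativity of `L`. -/
theorem transposeSite_two_mul (X Z : Matrix (Fin n × Fin n) (Fin n × Fin n) L) :
    transposeSite 2 (twoSite 0 2 X * twoSite 1 2 Z) =
      twoSite 1 2 (transposeSnd Z) * twoSite (0 : Fin 3) 2 (transposeSnd X) := by
  ext a b
  rw [sum_pair_eq_sum_extend _ (by decide)]
  simp only [transposeSite, Matrix.of_apply]
  rw [sum_pair_eq_sum_extend _ (by decide)]
  conv_lhs => rw [Finset.sum_comm]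
  conv_rhs => rw [Finset.sum_comm]
  rw [eta_three a, eta_three b]
  simp [update_three_zero, update_three_one, update_three_two, twoSite_three_zero_two,
    twoSite_three_one_two, transposeSnd]
  refine Finset.sum_congr rfl fun d _ => ?_
  exact mul_comm _ _

theorem transposeSite_two_mul' (X Z : Matrix (Fin n × Fin n) (Fin n × Fin n) L) :
    transposeSite 2 (twoSite 1 2 Z * twoSite 0 2 X) =
      twoSite 0 2 (transposeSnd X) * twoSite (1 : Fin 3) 2 (transposeSnd Z) := by
  ext a b
  rw [sum_pair_eq_sum_extend _ (by decide)]
  simp only [transposeSite, Matrix.of_apply]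
  rw [sum_pair_eq_sum_extend _ (by decide)]
  conv_lhs => rw [Finset.sum_comm]
  conv_rhs => rw [Finset.sum_comm]
  rw [eta_three a, eta_three b]
  simp [update_three_zero, update_three_one, update_three_two, twoSite_three_zero_two,
    twoSite_three_one_two, transposeSnd]
  refine Finset.sum_congr rfl fun d _ => ?_
  exact mul_comm _ _

theorem transposeSite_zero_mul (X Z : Matrix (Fin n × Fin n) (Fin n × Fin n) L) :
    transposeSite 0 (twoSite 0 1 X * twoSite 0 2 Z) =
      twoSite 0 2 (partialTranspose Z) * twoSite (0 : Fin 3) 1 (partialTranspose X) := by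
  ext a b
  rw [sum_pair_eq_sum_extend _ (by decide)]
  simp only [transposeSite, Matrix.of_apply]
  rw [sum_pair_eq_sum_extend _ (by decide)]
  rw [eta_three a, eta_three b]
  simp [update_three_zero, update_three_one, update_three_two, twoSite_three_zero_two,
    twoSite_three_zero_one, partialTranspose]
  refine Finset.sum_congr rfl fun d _ => ?_
  exact mul_comm _ _

theorem transposeSite_zero_mul' (X Z : Matrix (Fin n × Fin n) (Fin n × Fin n) L) :
    transposeSite 0 (twoSite 0 2 Z * twoSite 0 1 X) =
      twoSite 0 1 (partialTranspose X) * twoSite (0 : Fin 3) 2 (partialTranspose Z) := by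
  ext a b
  rw [sum_pair_eq_sum_extend _ (by decide)]
  simp only [transposeSite, Matrix.of_apply]
  rw [sum_pair_eq_sum_extend _ (by decide)]
  rw [eta_three a, eta_three b]
  simp [update_three_zero, update_three_one, update_three_two, twoSite_three_zero_two,
    twoSite_three_zero_one, partialTranspose]
  refine Finset.sum_congr rfl fun d _ => ?_
  exact mul_comm _ _

/-- The weights of the flip in `1 - P^q`. -/
def flipWeight (Q P : L) (i j : Fin n) : L := -if i = j then 1 else if i < j then Q else P

/-- The weights of the flip in `R̄(x)`. -/
def barWeight (Q P x t : L) (i j : Fin n) : L :=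
  if i = j then t * (P * x - Q) - 1 else if i < j then t * ((P - Q) * x) else t * (P - Q)

theorem flipWeight_self (Q P : L) (i : Fin n) : flipWeight Q P i i = -1 := by simp [flipWeight]

theorem flipWeight_of_lt (Q P : L) {i j : Fin n} (h : i < j) : flipWeight Q P i j = -Q := by
  simp [flipWeight, h, h.ne]

theorem flipWeight_of_gt (Q P : L) {i j : Fin n} (h : j < i) : flipWeight Q P i j = -P := by
  simp [flipWeight, h.not_gt, h.ne']

theorem barWeight_self (Q P x t : L) (i : Fin n) :
    barWeight Q P x t i i = t * (P * x - Q) - 1 := by simp [barWeight]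

theorem barWeight_of_lt (Q P x t : L) {i j : Fin n} (h : i < j) :
    barWeight Q P x t i j = t * ((P - Q) * x) := by
  simp [barWeight, h, h.ne]

theorem barWeight_of_gt (Q P x t : L) {i j : Fin n} (h : j < i) :
    barWeight Q P x t i j = t * (P - Q) := by
  simp [barWeight, h.not_gt, h.ne']

/-- The Yang–Baxter equation for `R̄`, with `1 - P^q` standing for the `R`-matrix at spectral ratio
`q²`. The factor `Y` on the left makes each row a free function `ρ`, so the identity becomes linear
in the values of `ρ` and is checked for each relative order of the three indices. -/
theorem yangBaxter_barWeight {Q P x t s : L} (hPQ : P * Q = 1) (ht : t * (x - 1) = 1)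
    (hs : s * (Q ^ 2 * x - 1) = 1) (Y : Matrix (Fin 3 → Fin n) (Fin 3 → Fin n) L) :
    Y * twoSite 1 2 (iceMatrix (flipWeight Q P)) *
        twoSite 0 2 (iceMatrix (barWeight Q P (Q ^ 2 * x) s)) *
        twoSite 0 1 (iceMatrix (barWeight Q P x t)) =
      Y * twoSite 0 1 (iceMatrix (barWeight Q P x t)) *
        twoSite 0 2 (iceMatrix (barWeight Q P (Q ^ 2 * x) s)) *
        twoSite 1 2 (iceMatrix (flipWeight Q P)) := by
  ext a b
  rw [eta_three b]
  generalize b 0 = b0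
  generalize b 1 = b1
  generalize b 2 = b2
  simp only [mul_twoSite_iceMatrix _ (show (0 : Fin 3) ≠ 1 by decide),
    mul_twoSite_iceMatrix _ (show (0 : Fin 3) ≠ 2 by decide),
    mul_twoSite_iceMatrix _ (show (1 : Fin 3) ≠ 2 by decide), update_three_zero, update_three_one,
    update_three_two, Matrix.cons_val_zero, Matrix.cons_val_one, three_val_two]
  generalize Y a = ρ
  rcases lt_trichotomy b0 b1 with h | h | h <;> rcases lt_trichotomy b1 b2 with h' | h' | h' <;>
    rcases lt_trichotomy b0 b2 with h'' | h'' | h'' <;> first | omega | skip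
  all_goals
    try subst h
    try subst h'
    try subst h''
  all_goals
    simp (disch := assumption) only [flipWeight_self, flipWeight_of_lt, flipWeight_of_gt,
      barWeight_self, barWeight_of_lt, barWeight_of_gt]
    grind

theorem yangBaxter_barWeight_swap {Q P x t s : L} (hPQ : P * Q = 1) (ht : t * (x - 1) = 1)
    (hs : s * (Q ^ 2 * x - 1) = 1) (Y : Matrix (Fin 3 → Fin n) (Fin 3 → Fin n) L) :
    Y * twoSite 0 1 (iceMatrix (flipWeight Q P)) *
        twoSite 1 2 (iceMatrix fun i j => barWeight Q P (Q ^ 2 * x) s j i) *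
        twoSite 0 2 (iceMatrix fun i j => barWeight Q P x t j i) =
      Y * twoSite 0 2 (iceMatrix fun i j => barWeight Q P x t j i) *
        twoSite 1 2 (iceMatrix fun i j => barWeight Q P (Q ^ 2 * x) s j i) *
        twoSite 0 1 (iceMatrix (flipWeight Q P)) := by
  ext a b
  rw [eta_three b]
  generalize b 0 = b0
  generalize b 1 = b1
  generalize b 2 = b2
  simp only [mul_twoSite_iceMatrix _ (show (0 : Fin 3) ≠ 1 by decide),
    mul_twoSite_iceMatrix _ (show (0 : Fin 3) ≠ 2 by decide),
    mul_twoSite_iceMatrix _ (show (1 : Fin 3) ≠ 2 by decide), update_three_zero, update_three_one,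
    update_three_two, Matrix.cons_val_zero, Matrix.cons_val_one, three_val_two]
  generalize Y a = ρ
  rcases lt_trichotomy b0 b1 with h | h | h <;> rcases lt_trichotomy b1 b2 with h' | h' | h' <;>
    rcases lt_trichotomy b0 b2 with h'' | h'' | h'' <;> first | omega | skip
  all_goals
    try subst h
    try subst h'
    try subst h''
  all_goals
    simp (disch := assumption) only [flipWeight_self, flipWeight_of_lt, flipWeight_of_gt,
      barWeight_self, barWeight_of_lt, barWeight_of_gt]
    grind

end YangBaxter

/-! ### Exchange relations between `1 - P^q` and `R̄ᵗ`. -/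

section CrossRelations

variable {K : Type*} [Field K] {L : Type*} [CommRing L] [Algebra K L] {n : ℕ}

/-- The operator `1 - P^q` on two factors. -/
def antiFlip (n : ℕ) (q : K) (L : Type*) [CommRing L] [Algebra K L] :
    Matrix (Fin n × Fin n) (Fin n × Fin n) L :=
  (1 - qFlip n q).map (algebraMap K L)

theorem antiFlip_eq (q : K) : antiFlip n q L =
    iceMatrix (flipWeight (algebraMap K L q) (algebraMap K L q⁻¹)) := by
  ext ⟨a1, a2⟩ ⟨b1, b2⟩
  have e1 : algebraMap K L ((1 : Matrix (Fin n × Fin n) (Fin n × Fin n) K) (a1, a2) (b1, b2)) =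
      if ((a1, a2) : Fin n × Fin n) = (b1, b2) then 1 else 0 := by
    rw [Matrix.one_apply]
    split_ifs <;> simp
  have e2 : -algebraMap K L (qFlip n q (a1, a2) (b1, b2)) =
      if ((a1, a2) : Fin n × Fin n) = Prod.swap (b1, b2) then
        flipWeight (algebraMap K L q) (algebraMap K L q⁻¹) b1 b2 else 0 := by
    simp only [qFlip, Matrix.of_apply, Prod.swap, Prod.mk.injEq, flipWeight]
    by_cases h : a1 = b2 ∧ a2 = b1
    · obtain ⟨rfl, rfl⟩ := h
      by_cases h : a1 = a2
      · simp [h]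
      · have h' : ¬ a2 = a1 := fun e => h e.symm
        by_cases h3 : a2 < a1 <;> simp [h, h', h3]
    · simp [h]
  rw [antiFlip, Matrix.map_apply, Matrix.sub_apply, map_sub, sub_eq_add_neg, e1, e2]
  rfl

theorem partialTranspose_rBarCross (q : K) (x : L) :
    partialTranspose (rBarCross n q x) = iceMatrix (barWeight (algebraMap K L q)
      (algebraMap K L q⁻¹) x (Ring.inverse (x - 1))) := by
  ext ⟨a1, a2⟩ ⟨b1, b2⟩
  simp only [partialTranspose, rBarCross, zeroWeight, weightBar, weightMatrix, Matrix.of_apply,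
    iceMatrix, barWeight, Prod.swap, Prod.mk.injEq, Algebra.smul_def, map_sub, mul_one]
  by_cases h : b1 = a2 ∧ a1 = b2
  · obtain ⟨rfl, rfl⟩ := h
    by_cases h : a1 = b1
    · subst h
      simp
    · have h' : ¬ b1 = a1 := fun e => h e.symm
      by_cases h3 : b1 < a1 <;> simp [h, h', h3]
  · have h2 : ¬ (a1 = b2 ∧ a2 = b1) := fun e => h ⟨e.2.symm, e.1⟩
    rw [if_neg h, if_neg h2, add_zero]
    simp only [eq_comm]

theorem transposeSnd_rBarCross (q : K) (x : L) :
    transposeSnd (rBarCross n q x) = iceMatrix fun i j => barWeight (algebraMap K L q)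
      (algebraMap K L q⁻¹) x (Ring.inverse (x - 1)) j i := by
  ext ⟨a1, a2⟩ ⟨b1, b2⟩
  simp only [transposeSnd, rBarCross, zeroWeight, weightBar, weightMatrix, Matrix.of_apply,
    iceMatrix, barWeight, Prod.swap, Prod.mk.injEq, Algebra.smul_def, map_sub, mul_one]
  by_cases h : a1 = b2 ∧ b1 = a2
  · obtain ⟨rfl, rfl⟩ := h
    by_cases h : a1 = b1
    · subst h
      simp
    · have h' : ¬ b1 = a1 := fun e => h e.symm
      by_cases h3 : a1 < b1 <;> simp [h, h', h3]
  · have h2 : ¬ (a1 = b2 ∧ a2 = b1) := fun e => h ⟨e.1, e.2.symm⟩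
    rw [if_neg h, if_neg h2, add_zero]
    simp only [eq_comm]

/-- Transposing the third factor, which `1 - P^q` does not touch, turns each `R̄ᵗ` into the full
transpose of `R̄` and reverses the two crossings. What remains is the Yang–Baxter equation with the
flip weights transposed. -/
theorem antiFlip_mul_cross_left {q : K} (hq : q ≠ 0) {x : L} (hx : IsSmall K x) :
    twoSite 0 1 (antiFlip n q L) *
        (twoSite 0 2 (rBarCross n q x) * twoSite 1 2 (rBarCross n q (q ^ 2 • x))) =
      twoSite 1 2 (rBarCross n q (q ^ 2 • x)) * twoSite 0 2 (rBarCross n q x) *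
        twoSite (0 : Fin 3) 1 (antiFlip n q L) := by
  apply transposeSite_injective 2
  have hPQ : algebraMap K L q⁻¹ * algebraMap K L q = 1 := by
    rw [← map_mul, inv_mul_cancel₀ hq, map_one]
  have h1 := Ring.inverse_mul_cancel _ hx.isUnit_sub_one
  have h2 := Ring.inverse_mul_cancel _ (hx.smul (q ^ 2)).isUnit_sub_one
  rw [transposeSite_twoSite_mul (by decide) (by decide) (by decide),
    transposeSite_mul_twoSite (by decide) (by decide) (by decide) (antiFlip n q L), transposeSite_two_mul,
    transposeSite_two_mul', transposeSnd_rBarCross, transposeSnd_rBarCross, antiFlip_eq]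
  rw [Algebra.smul_def, map_pow] at h2 ⊢
  simpa [mul_assoc] using yangBaxter_barWeight_swap (n := n) hPQ h1 h2 1

/-- Here the transposition is in the first factor and undoes the one in `R̄ᵗ`. -/
theorem antiFlip_mul_cross_right {q : K} (hq : q ≠ 0) {x : L} (hx : IsSmall K x) :
    twoSite 1 2 (antiFlip n q L) *
        (twoSite 0 1 (rBarCross n q x) * twoSite 0 2 (rBarCross n q (q ^ 2 • x))) =
      twoSite 0 2 (rBarCross n q (q ^ 2 • x)) * twoSite 0 1 (rBarCross n q x) *
        twoSite (1 : Fin 3) 2 (antiFlip n q L) := by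
  apply transposeSite_injective 0
  have hPQ : algebraMap K L q⁻¹ * algebraMap K L q = 1 := by
    rw [← map_mul, inv_mul_cancel₀ hq, map_one]
  have h1 := Ring.inverse_mul_cancel _ hx.isUnit_sub_one
  have h2 := Ring.inverse_mul_cancel _ (hx.smul (q ^ 2)).isUnit_sub_one
  rw [transposeSite_twoSite_mul (by decide) (by decide) (by decide),
    transposeSite_mul_twoSite (by decide) (by decide) (by decide) (antiFlip n q L), transposeSite_zero_mul,
    transposeSite_zero_mul', partialTranspose_rBarCross, partialTranspose_rBarCross, antiFlip_eq]
  rw [Algebra.smul_def, map_pow] at h2 ⊢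
  simpa [mul_assoc] using yangBaxter_barWeight (n := n) hPQ h1 h2 1

theorem antiFlip_mul_cross_left_sites {m : ℕ} {q : K} (hq : q ≠ 0) {x : L} (hx : IsSmall K x)
    {i j k : Fin m} (hij : i ≠ j) (hik : i ≠ k) (hjk : j ≠ k) :
    twoSite i j (antiFlip n q L) *
        (twoSite i k (rBarCross n q x) * twoSite j k (rBarCross n q (q ^ 2 • x))) =
      twoSite j k (rBarCross n q (q ^ 2 • x)) * twoSite i k (rBarCross n q x) *
        twoSite i j (antiFlip n q L) := by
  have hf : Function.Injective ![i, j, k] := by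
    intro x y
    fin_cases x <;> fin_cases y <;> simp [hij, hik, hjk, hij.symm, hik.symm, hjk.symm]
  have := congrArg (siteEmb ![i, j, k]) (antiFlip_mul_cross_left (n := n) hq hx)
  simp only [siteEmb_mul hf, siteEmb_twoSite hf] at this
  exact this

theorem antiFlip_mul_cross_right_sites {m : ℕ} {q : K} (hq : q ≠ 0) {x : L} (hx : IsSmall K x)
    {i j k : Fin m} (hij : i ≠ j) (hik : i ≠ k) (hjk : j ≠ k) :
    twoSite j k (antiFlip n q L) *
        (twoSite i j (rBarCross n q x) * twoSite i k (rBarCross n q (q ^ 2 • x))) =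
      twoSite i k (rBarCross n q (q ^ 2 • x)) * twoSite i j (rBarCross n q x) *
        twoSite j k (antiFlip n q L) := by
  have hf : Function.Injective ![i, j, k] := by
    intro x y
    fin_cases x <;> fin_cases y <;> simp [hij, hik, hjk, hij.symm, hik.symm, hjk.symm]
  have := congrArg (siteEmb ![i, j, k]) (antiFlip_mul_cross_right (n := n) hq hx)
  simp only [siteEmb_mul hf, siteEmb_twoSite hf] at this
  exact this

end CrossRelations

/-! ### Passing an element through an ordered product -/

section Push

variable {M : Type*} [Monoid M]

/-- `x` is invertible, and `a x = y a` for an invertible `y`. -/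
def Push (a x : M) : Prop := IsUnit x ∧ ∃ y, IsUnit y ∧ a * x = y * a

theorem Push.mul {a x x' : M} (h : Push a x) (h' : Push a x') : Push a (x * x') := by
  obtain ⟨hx, y, hy, e⟩ := h
  obtain ⟨hx', y', hy', e'⟩ := h'
  exact ⟨hx.mul hx', y * y', hy.mul hy', by
    rw [← mul_assoc, e, mul_assoc, e', mul_assoc]⟩

theorem Push.of_commute {a x : M} (hx : IsUnit x) (h : Commute a x) : Push a x :=
  ⟨hx, x, hx, h⟩

theorem Push.one (a : M) : Push a 1 := Push.of_commute isUnit_one (Commute.one_right a)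

/-- This is where invertibility of `y` matters: `a x = y a` gives `a x⁻¹ = y⁻¹ a`, so the inverse of
a bracket can be treated like the bracket itself. -/
theorem Push.inv {a : M} {u : Mˣ} (h : Push a (u : M)) : Push a (↑u⁻¹ : M) := by
  obtain ⟨-, y, ⟨v, rfl⟩, e⟩ := h
  refine ⟨⟨u⁻¹, rfl⟩, ↑v⁻¹, ⟨v⁻¹, rfl⟩, ?_⟩
  calc a * (↑u⁻¹ : M) = ↑v⁻¹ * (↑v * a) * ↑u⁻¹ := by
        rw [← mul_assoc, Units.inv_mul, one_mul]
    _ = ↑v⁻¹ * a := by rw [← e, mul_assoc, mul_assoc, Units.mul_inv, mul_one]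

theorem Push.list_prod {a : M} {ι : Type*} (l : List ι) (T : ι → M) (h : ∀ i ∈ l, Push a (T i)) :
    Push a (l.map T).prod := by
  induction l with
  | nil => exact Push.one a
  | cons i l ih =>
    rw [List.map_cons, List.prod_cons]
    exact (h i (by simp)).mul (ih fun j hj => h j (by simp [hj]))

theorem prod_finRange_succ {m : ℕ} (T : Fin (m + 1) → M) :
    ((List.finRange (m + 1)).map T).prod =
      T 0 * ((List.finRange m).map fun i => T i.succ).prod := by
  rw [List.finRange_succ, List.map_cons, List.prod_cons, List.map_map]
  rfl

/-- For `a = 1 - P^q` in sites `k` and `k + 1`, the factors at other positions can be passed singly,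
but those at `k` and `k + 1` only as a pair. -/
theorem Push.prod_of_adjacent {a : M} {m : ℕ} (T : Fin m → M) (k l : Fin m)
    (hkl : (l : ℕ) = k + 1) (h : ∀ j, j ≠ k → j ≠ l → Push a (T j))
    (h' : Push a (T k * T l)) : Push a ((List.finRange m).map T).prod := by
  induction m with
  | zero => exact k.elim0
  | succ m ih =>
    rw [prod_finRange_succ]
    induction k using Fin.cases with
    | zero =>
      cases m with
      | zero => omega
      | succ m =>
        have hl : l = Fin.succ 0 := by
          ext
          simpa using hkl
        subst hl
        rw [prod_finRange_succ, ← mul_assoc]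
        refine h'.mul (Push.list_prod _ _ fun i _ => h _ (Fin.succ_ne_zero _) ?_)
        intro e
        exact Fin.succ_ne_zero _ (Fin.succ_injective _ e)
    | succ k =>
      induction l using Fin.cases with
      | zero => simp at hkl
      | succ l =>
        refine (h 0 (Fin.succ_ne_zero _).symm (Fin.succ_ne_zero _).symm).mul
          (ih _ k l (by simpa using hkl) (fun j hj hj' => h _ ?_ ?_) h')
        · simpa using hj
        · simpa using hj'

theorem prod_finRange_pull {m : ℕ} (T T' : Fin m → M) (l : Fin m) (h1 : ∀ j, j < l → T j = 1)
    (h2 : T' l = 1) (h3 : ∀ j, j ≠ l → T j = T' j) :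
    ((List.finRange m).map T).prod = T l * ((List.finRange m).map T').prod := by
  induction m with
  | zero => exact l.elim0
  | succ m ih =>
    rw [prod_finRange_succ, prod_finRange_succ]
    induction l using Fin.cases with
    | zero =>
      rw [h2, one_mul]
      congr 3
      funext i
      exact h3 _ (Fin.succ_ne_zero _)
    | succ l =>
      rw [h1 0 (Fin.succ_pos l), ← h3 0 (Fin.succ_ne_zero _).symm, h1 0 (Fin.succ_pos l), one_mul,
        one_mul]
      exact ih (fun i => T i.succ) (fun i => T' i.succ) l
        (fun j hj => h1 _ (Fin.succ_lt_succ_iff.2 hj)) h2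
        fun j hj => h3 _ (by simpa using hj)

theorem commute_list_prod {ι : Type*} (l : List ι) (T : ι → M) (a : M)
    (h : ∀ i ∈ l, Commute a (T i)) : Commute a (l.map T).prod := by
  refine Commute.list_prod_right _ _ fun x hx => ?_
  obtain ⟨i, hi, rfl⟩ := List.mem_map.1 hx
  exact h i hi

theorem prod_mul_prod_of_commute {ι : Type*} (l : List ι) (hl : l.Nodup) (T U : ι → M)
    (h : ∀ i ∈ l, ∀ j ∈ l, i ≠ j → Commute (T i) (U j)) :
    (l.map T).prod * (l.map U).prod = (l.map fun i => T i * U i).prod := by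
  induction l with
  | nil => simp
  | cons i l ih =>
    rw [List.nodup_cons] at hl
    simp only [List.map_cons, List.prod_cons]
    rw [← ih hl.2 fun a ha b hb => h a (by simp [ha]) b (by simp [hb])]
    have : Commute (U i) (l.map T).prod := commute_list_prod _ _ _ fun j hj =>
      (h j (by simp [hj]) i (by simp) (by rintro rfl; exact hl.1 hj)).symm
    rw [mul_assoc, mul_assoc, ← mul_assoc (l.map T).prod, ← this.eq, mul_assoc]

end Push

/-! ### Fusion -/

section Fusion

variable {K : Type*} [Field K] {A : Type*} [Ring A] [Algebra K A]

theorem isSmall_of_constantCoeff {x : PowerSeries K} (h : PowerSeries.constantCoeff x = 0) :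
    IsSmall K x := by
  intro c
  rw [PowerSeries.isUnit_iff_constantCoeff]
  simp [h, PowerSeries.smul_eq_C_mul]

theorem rBarT_eq (n : ℕ) (q : K) {x : PowerSeries K} (h : PowerSeries.constantCoeff x = 0) :
    rBarT n q x = rBarCross n q x := by
  rw [rBarCross, weightBar, ← smul_partialTranspose_rMatrix n q x _
    (Ring.inverse_mul_cancel _ (isSmall_of_constantCoeff h).isUnit_sub_one)]
  have e : (x - 1)⁻¹ = Ring.inverse (x - 1) := by
    have hu := (isSmall_of_constantCoeff h).isUnit_sub_one
    have h1 : (x - 1)⁻¹ * (x - 1) = 1 := PowerSeries.inv_mul_cancel _ (by simp [h])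
    calc (x - 1)⁻¹ = (x - 1)⁻¹ * ((x - 1) * Ring.inverse (x - 1)) := by
          rw [Ring.mul_inverse_cancel _ hu, mul_one]
      _ = _ := by rw [← mul_assoc, h1, one_mul]
  rw [rBarT, e]
  rfl

/-- The coefficient embedding of scalar series. -/
noncomputable abbrev scalarHom (K A : Type*) [Field K] [Ring A] [Algebra K A] :
    PowerSeries K →+* PowerSeries A := PowerSeries.map (algebraMap K A)

theorem isCentralHom_scalarHom : IsCentralHom (scalarHom K A) :=
  isCentralHom_algebraMap.powerSeries_map

/-- The argument `u_i⁻¹ u_j⁻¹`. -/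
noncomputable def siteArg (q : K) (i j : ℕ) : PowerSeries K :=
  (PowerSeries.C (q ^ (2 * i)) * PowerSeries.X) * (PowerSeries.C (q ^ (2 * j)) * PowerSeries.X)

theorem isSmall_siteArg (q : K) (i j : ℕ) : IsSmall K (siteArg q i j) :=
  isSmall_of_constantCoeff (by simp [siteArg])

theorem siteArg_succ_left (q : K) (i j : ℕ) : siteArg q (i + 1) j = q ^ 2 • siteArg q i j := by
  rw [siteArg, siteArg, PowerSeries.smul_eq_C_mul, mul_add, pow_add, map_mul]
  ring

theorem siteArg_succ_right (q : K) (i j : ℕ) : siteArg q i (j + 1) = q ^ 2 • siteArg q i j := by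
  rw [siteArg, siteArg, PowerSeries.smul_eq_C_mul, mul_add, pow_add, map_mul]
  ring

variable (A) in
/-- The operator `R̄ᵗ(u_i⁻¹ u_j⁻¹)` on two factors. -/
noncomputable def crossOp (n : ℕ) (q : K) (i j : ℕ) :
    Matrix (Fin n × Fin n) (Fin n × Fin n) (PowerSeries A) :=
  (rBarCross n q (siteArg q i j)).map (scalarHom K A)

variable (A) in
/-- The operator `1 - P^q` on two factors, over power series. -/
noncomputable def antiOp (n : ℕ) (q : K) :
    Matrix (Fin n × Fin n) (Fin n × Fin n) (PowerSeries A) :=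
  (antiFlip n q (PowerSeries K)).map (scalarHom K A)

theorem isUnit_crossOp {q : K} (hq : q ≠ 0) (n i j : ℕ) : IsUnit (crossOp A n q i j) :=
  (isUnit_rBarCross hq n (isSmall_siteArg q i j)).map (scalarHom K A).mapMatrix

theorem crossOp_central (n : ℕ) (q : K) (i j : ℕ) (a b : Fin n × Fin n) (c : PowerSeries A) :
    Commute (crossOp A n q i j a b) c := isCentralHom_scalarHom _ _

theorem antiOp_central (n : ℕ) (q : K) (a b : Fin n × Fin n) (c : PowerSeries A) :
    Commute (antiOp A n q a b) c := isCentralHom_scalarHom _ _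

theorem antiOp_eq (n : ℕ) (q : K) :
    antiOp A n q = 1 - (qFlip n q).map (algebraMap K (PowerSeries A)) := by
  have h1 : (1 : Matrix (Fin n × Fin n) (Fin n × Fin n) (PowerSeries A)) =
      (1 : Matrix (Fin n × Fin n) (Fin n × Fin n) K).map (algebraMap K (PowerSeries A)) := by
    rw [Matrix.map_one _ (map_zero _) (map_one _)]
  rw [h1]
  refine Matrix.ext fun a b => ?_
  have h2 : ∀ c : K, scalarHom K A (algebraMap K (PowerSeries K) c) =
      algebraMap K (PowerSeries A) c := fun c => by
    rw [PowerSeries.algebraMap_apply, PowerSeries.algebraMap_apply, PowerSeries.map_C]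
    rfl
  exact (h2 _).trans (map_sub _ _ _)

theorem bracket_eq (m : ℕ) {n : ℕ} (q : K) (S : Matrix (Fin n) (Fin n) (PowerSeries A)) :
    bracket m q S = ((List.finRange m).map fun i : Fin m =>
      oneSite i (S.map (dilate (q ^ (2 * (i : ℕ))))) *
        ((List.finRange m).map fun j : Fin m =>
          if i < j then twoSite i j (crossOp A n q i j) else 1).prod).prod := by
  rw [bracket]
  congr 2
  funext i
  congr 1
  induction List.finRange m with
  | nil => rfl
  | cons j l ih =>
    rw [List.map_cons, List.prod_cons, ← ih, List.filter_cons]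
    by_cases h : i < j
    · rw [if_pos (by simpa using h), if_pos h, List.map_cons, List.prod_cons]
      congr 2
      rw [rBarT_eq]
      · rfl
      · simp
    · rw [if_neg (by simpa using h), if_neg h, one_mul]

/-- The reflection equation at `v = q⁻² u`. -/
def IsFused {n : ℕ} (q : K) (S : Matrix (Fin n) (Fin n) (PowerSeries A)) : Prop :=
  twoSite 0 1 (antiOp A n q) *
      (oneSite 0 S * twoSite 0 1 (crossOp A n q 0 1) * oneSite (1 : Fin 2) (S.map (dilate (q ^ 2)))) =
    oneSite 1 (S.map (dilate (q ^ 2))) * twoSite 0 1 (crossOp A n q 0 1) * oneSite 0 S *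
      twoSite 0 1 (antiOp A n q)

theorem mapMatrix_dilate_crossOp {n : ℕ} (q : K) (c : K) (i j : ℕ) :
    (crossOp A n q i j).map (dilate c) =
      (rBarCross n q (c ^ 2 • siteArg q i j)).map (scalarHom K A) := by
  refine Matrix.ext fun a b => ?_
  have h := congrFun (congrFun (congrArg (fun w => zeroWeight (n := n) w)
    (weightBar_map (n := n) q (isSmall_siteArg q i j) (dilateHom c)
      fun d y => dilate_smul c d y)) a) b
  rw [← zeroWeight_map] at h
  have e : dilateHom c (siteArg q i j) = c ^ 2 • siteArg q i j := by
    rw [siteArg, map_mul, dilateHom_apply, dilateHom_apply, dilate_C_mul_X, dilate_C_mul_X,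
      PowerSeries.smul_eq_C_mul]
    simp only [map_mul, map_pow]
    ring
  rw [e] at h
  simp only [crossOp, Matrix.map_apply] at h ⊢
  rw [dilate_map_algebraMap]
  exact congrArg _ h

theorem siteArg_shift (q : K) (k i j : ℕ) :
    (q ^ (2 * k)) ^ 2 • siteArg q i j = siteArg q (k + i) (k + j) := by
  rw [siteArg, siteArg, PowerSeries.smul_eq_C_mul, mul_add, mul_add, pow_add, pow_add, map_mul,
    map_mul, map_pow]
  ring

theorem mapMatrix_dilate_antiOp {n : ℕ} (q : K) (c : K) :
    (antiOp A n q).map (dilate c) = antiOp A n q := by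
  refine Matrix.ext fun a b => ?_
  simp only [antiOp, antiFlip, Matrix.map_apply, dilate_map_algebraMap]
  congr 1
  ext r
  rw [coeff_dilate, ← PowerSeries.C_eq_algebraMap, PowerSeries.coeff_C]
  split_ifs with h
  · simp [h]
  · simp

/-- The fused relation holds at `u` and `q⁻² u`; dilating by `q^{2k}` moves it to the consecutive
arguments `u_k` and `u_{k+1}`. -/
theorem IsFused.sites {n m : ℕ} {q : K} {S : Matrix (Fin n) (Fin n) (PowerSeries A)}
    (hS : IsFused q S) {k l : Fin m} (hkl : (l : ℕ) = k + 1) :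
    twoSite k l (antiOp A n q) *
        (oneSite k (S.map (dilate (q ^ (2 * (k : ℕ))))) * twoSite k l (crossOp A n q k l) *
          oneSite l (S.map (dilate (q ^ (2 * (l : ℕ)))))) =
      oneSite l (S.map (dilate (q ^ (2 * (l : ℕ))))) * twoSite k l (crossOp A n q k l) *
        oneSite k (S.map (dilate (q ^ (2 * (k : ℕ))))) * twoSite k l (antiOp A n q) := by
  have hne : k ≠ l := by
    rintro rfl
    omega
  have h := congrArg (fun Y => siteEmb ![k, l] (Matrix.map Y (dilateHom (q ^ (2 * (k : ℕ)))))) hS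
  simp only [Matrix.map_mul, siteEmb_mul (injective_two hne), twoSite_map, oneSite_map,
    siteEmb_twoSite (injective_two hne), siteEmb_oneSite (injective_two hne)] at h
  have e1 : (crossOp A n q 0 1).map (dilateHom (q ^ (2 * (k : ℕ)))) = crossOp A n q k l := by
    refine (mapMatrix_dilate_crossOp (A := A) q _ 0 1).trans ?_
    rw [siteArg_shift, hkl]
    rfl
  have e2 : (antiOp A n q).map (dilateHom (q ^ (2 * (k : ℕ)))) = antiOp A n q :=
    mapMatrix_dilate_antiOp q _
  have e3 : (S.map (dilate (q ^ 2))).map (dilateHom (q ^ (2 * (k : ℕ)))) =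
      S.map (dilate (q ^ (2 * (l : ℕ)))) := by
    refine Matrix.ext fun a b => ?_
    simp only [Matrix.map_apply, dilateHom_apply, dilate_dilate]
    rw [hkl, ← pow_add]
    rfl
  rw [e1, e2, e3] at h
  exact h

theorem isUnit_oneSite_dilate {n m : ℕ} {S : Matrix (Fin n) (Fin n) (PowerSeries A)}
    (hS : IsUnit S) (c : K) (i : Fin m) : IsUnit (oneSite i (S.map (dilate c))) :=
  (hS.map (dilateHom c).mapMatrix).map (oneSiteHom i)

theorem isUnit_twoSite_crossOp {m : ℕ} {q : K} (hq : q ≠ 0) (n a b : ℕ) {i j : Fin m}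
    (hij : i ≠ j) : IsUnit (twoSite i j (crossOp A n q a b)) :=
  (isUnit_crossOp hq n a b).map (twoSiteHom i j hij)

theorem isUnit_list_prod {M : Type*} [Monoid M] {ι : Type*} (l : List ι) (T : ι → M)
    (h : ∀ i ∈ l, IsUnit (T i)) : IsUnit (l.map T).prod := by
  induction l with
  | nil => exact isUnit_one
  | cons i l ih =>
    rw [List.map_cons, List.prod_cons]
    exact (h i (by simp)).mul (ih fun j hj => h j (by simp [hj]))

theorem isUnit_bracket {m n : ℕ} {q : K} (hq : q ≠ 0)
    {S : Matrix (Fin n) (Fin n) (PowerSeries A)} (hS : IsUnit S) : IsUnit (bracket m q S) := by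
  rw [bracket_eq]
  refine isUnit_list_prod _ _ fun i _ => (isUnit_oneSite_dilate hS _ i).mul
    (isUnit_list_prod _ _ fun j _ => ?_)
  split_ifs with h
  · exact isUnit_twoSite_crossOp hq n _ _ h.ne
  · exact isUnit_one

/-- The factors attached to a position outside `{k, l}` are passed with the Yang–Baxter relations or
by disjointness of sites; the two blocks at `k` and `l` need the fused reflection equation. Only the
existence of the resulting left factor matters, not its form. -/
theorem push_bracket {m n : ℕ} {q : K} (hq : q ≠ 0)
    {S : Matrix (Fin n) (Fin n) (PowerSeries A)} (hS : IsUnit S) (hF : IsFused q S)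
    {k l : Fin m} (hkl : (l : ℕ) = k + 1) :
    Push (twoSite k l (antiOp A n q)) (bracket m q S) := by
  have hklt : k < l := by
    rw [Fin.lt_def]
    omega
  have hne := hklt.ne
  have commS : ∀ (i : Fin m) (c : K), i ≠ k → i ≠ l →
      Push (twoSite k l (antiOp A n q)) (oneSite i (S.map (dilate c))) := fun i c h1 h2 =>
    Push.of_commute (isUnit_oneSite_dilate hS _ i)
      (oneSite_commute_twoSite hne h1 h2 _ _ (antiOp_central n q)).symm
  have commX : ∀ (i j : Fin m) (a b : ℕ), i ≠ j → i ≠ k → i ≠ l → j ≠ k → j ≠ l →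
      Push (twoSite k l (antiOp A n q)) (twoSite i j (crossOp A n q a b)) :=
    fun i j a b h h1 h2 h3 h4 =>
    Push.of_commute (isUnit_twoSite_crossOp hq n _ _ h)
      (twoSite_commute_twoSite h hne h1 h2 h3 h4 _ _ (antiOp_central n q)).symm
  rw [bracket_eq]
  refine Push.prod_of_adjacent _ k l hkl (fun i hik hil => (commS i _ hik hil).mul ?_) ?_
  -- A position before the pair is linked to both `k` and `l`, and its two adjacent crossings pass
  -- together. A position after the pair shares no site with it.
  · rcases lt_or_gt_of_ne hik with h | h
    · have hil' : i < l := h.trans hklt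
      refine Push.prod_of_adjacent _ k l hkl (fun j hjk hjl => ?_) ?_
      · split_ifs with hij
        · exact commX i j _ _ hij.ne hik hil hjk hjl
        · exact Push.one _
      · rw [if_pos h, if_pos hil']
        refine ⟨(isUnit_twoSite_crossOp hq n _ _ hik).mul (isUnit_twoSite_crossOp hq n _ _ hil),
          _, (isUnit_twoSite_crossOp hq n i l hil).mul (isUnit_twoSite_crossOp hq n i k hik), ?_⟩
        have := congrArg (fun Y => Matrix.map Y (scalarHom K A))
          (antiFlip_mul_cross_right_sites (n := n) hq (isSmall_siteArg q i k) hik hil hne)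
        simp only [Matrix.map_mul, twoSite_map, ← siteArg_succ_right] at this
        rw [← hkl] at this
        exact this
    · refine Push.list_prod _ _ fun j _ => ?_
      split_ifs with hij
      · have hl : l < i := by
          rw [Fin.lt_def] at h ⊢
          have : (i : ℕ) ≠ l := fun e => hil (Fin.ext e)
          omega
        exact commX i j _ _ hij.ne hik hil (h.trans hij).ne' (hl.trans hij).ne'
      · exact Push.one _
  -- The two blocks are rearranged as `S_k R̄ᵗ_{kl} S_l` times the crossings to later sites: after
  -- `R̄ᵗ_{kl}` is split off, `S_l` commutes with the remaining `R̄ᵗ_{kj}`.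
  · have e : ((List.finRange m).map fun j : Fin m =>
          if k < j then twoSite k j (crossOp A n q k j) else 1).prod =
        twoSite k l (crossOp A n q k l) * ((List.finRange m).map fun j : Fin m =>
          if l < j then twoSite k j (crossOp A n q k j) else 1).prod := by
      rw [prod_finRange_pull _ (fun j : Fin m =>
          if l < j then twoSite k j (crossOp A n q k j) else 1) l ?_ ?_ ?_, if_pos hklt]
      · intro j hj
        rw [if_neg]
        rw [Fin.lt_def] at hj ⊢
        omega
      · simp
      · intro j hj
        have : k < j ↔ l < j := by
          have : (j : ℕ) ≠ l := fun e => hj (Fin.ext e)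
          rw [Fin.lt_def, Fin.lt_def]
          omega
        simp only [this]
    have hc : Commute ((List.finRange m).map fun j : Fin m =>
          if l < j then twoSite k j (crossOp A n q k j) else 1).prod
        (oneSite l (S.map (dilate (q ^ (2 * (l : ℕ)))))) := by
      refine (commute_list_prod _ _ _ fun j _ => ?_).symm
      split_ifs with hj
      · exact oneSite_commute_twoSite (hklt.trans hj).ne hne.symm hj.ne _ _
          (crossOp_central n q _ _)
      · exact Commute.one_right _
    rw [e]
    have e2 : ∀ (a x p b r : Matrix (Fin m → Fin n) (Fin m → Fin n) (PowerSeries A)),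
        Commute p b → a * (x * p) * (b * r) = a * x * b * (p * r) := by
      intro a x p b r h
      rw [mul_assoc a, mul_assoc x, ← mul_assoc p, h.eq]
      simp only [mul_assoc]
    rw [e2 _ _ _ _ _ hc]
    refine Push.mul ⟨((isUnit_oneSite_dilate hS _ k).mul
      (isUnit_twoSite_crossOp hq n _ _ hne)).mul (isUnit_oneSite_dilate hS _ l), _,
      ((isUnit_oneSite_dilate hS _ l).mul
      (isUnit_twoSite_crossOp hq n _ _ hne)).mul (isUnit_oneSite_dilate hS _ k),
      hF.sites hkl⟩ ?_
    -- The crossings to later sites are interleaved into pairs `R̄ᵗ_{kj} R̄ᵗ_{lj}`, each of which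
    -- passes by the Yang–Baxter relation.
    rw [prod_mul_prod_of_commute _ (List.nodup_finRange m)]
    · refine Push.list_prod _ _ fun j _ => ?_
      split_ifs with hj
      · have hkj : k ≠ j := (hklt.trans hj).ne
        refine ⟨(isUnit_twoSite_crossOp hq n _ _ hkj).mul (isUnit_twoSite_crossOp hq n _ _ hj.ne),
          _, (isUnit_twoSite_crossOp hq n l j hj.ne).mul (isUnit_twoSite_crossOp hq n k j hkj), ?_⟩
        have := congrArg (fun Y => Matrix.map Y (scalarHom K A))
          (antiFlip_mul_cross_left_sites (n := n) hq (isSmall_siteArg q k j) hne hkj hj.ne)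
        simp only [Matrix.map_mul, twoSite_map, ← siteArg_succ_left] at this
        rw [← hkl] at this
        exact this
      · rw [mul_one]
        exact Push.one _
    · intro i _ j _ hij
      split_ifs with h1 h2
      · exact twoSite_commute_twoSite (hklt.trans h1).ne h2.ne hne (hklt.trans h2).ne h1.ne' hij _ _
          (crossOp_central n q _ _)
      · exact Commute.one_right _
      · exact Commute.one_left _
      · exact Commute.one_left _

end Fusion

/-! ### `q`-antisymmetric functions and Sklyanin minors -/

section Anti

variable {K : Type*} [Field K] {L : Type*} [Ring L] [Algebra K L] {m n : ℕ}

/-- A function of `m` indices that is `q`-antisymmetric. -/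
def IsQAnti (q : K) (g : (Fin m → Fin n) → L) : Prop :=
  ∀ (b : Fin m → Fin n) (σ : Equiv.Perm (Fin m)),
    g (b ∘ σ) = (Equiv.Perm.sign σ : ℤ) •
      (q ^ ((inversions b : ℤ) - (inversions (b ∘ σ) : ℤ)) • g b)

variable (L) in
/-- The operator `P^q_σ` over `L`. -/
def permOp (n : ℕ) (q : K) (σ : Equiv.Perm (Fin m)) :
    Matrix (Fin m → Fin n) (Fin m → Fin n) L :=
  (qPerm n q σ).map (algebraMap K L)

theorem permOp_mul {q : K} (hq : q ≠ 0) (σ τ : Equiv.Perm (Fin m)) :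
    permOp L n q (σ * τ) = permOp L n q σ * permOp L n q τ := by
  rw [permOp, qPerm_mul hq, Matrix.map_mul]
  rfl

theorem permOp_one (q : K) : permOp L n q (1 : Equiv.Perm (Fin m)) = 1 := by
  ext a b
  simp only [permOp, qPerm, Matrix.map_apply, Matrix.of_apply, Matrix.one_apply]
  by_cases h : a = b
  · subst h
    have h : a = a ∘ (Equiv.symm (1 : Equiv.Perm (Fin m))) := rfl
    rw [if_pos h, if_pos rfl, sub_self, zpow_zero, map_one]
  · rw [if_neg h, if_neg, map_zero]
    exact h

theorem mul_permOp_apply (q : K) (W : Matrix (Fin m → Fin n) (Fin m → Fin n) L)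
    (σ : Equiv.Perm (Fin m)) (a b : Fin m → Fin n) :
    (W * permOp L n q σ) a b =
      q ^ ((inversions (b ∘ σ.symm) : ℤ) - (inversions b : ℤ)) • W a (b ∘ σ.symm) := by
  rw [Matrix.mul_apply, Finset.sum_eq_single (b ∘ σ.symm)]
  · rw [permOp, Matrix.map_apply, qPerm, Matrix.of_apply, if_pos rfl, Algebra.smul_def,
      Algebra.commutes]
  · intro c _ hc
    simp [permOp, qPerm, hc]
  · simp

theorem isQAnti_row {q : K} (hq : q ≠ 0) {W : Matrix (Fin m → Fin n) (Fin m → Fin n) L}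
    (h : ∀ σ : Equiv.Perm (Fin m), W * permOp L n q σ = (Equiv.Perm.sign σ : ℤ) • W)
    (a : Fin m → Fin n) : IsQAnti q (W a) := by
  intro b σ
  have h1 := congrFun (congrFun (h σ⁻¹) a) b
  rw [mul_permOp_apply, Matrix.smul_apply] at h1
  have e : b ∘ (σ⁻¹).symm = b ∘ σ := rfl
  rw [e, Equiv.Perm.sign_inv] at h1
  rw [smul_comm, ← h1, smul_smul, ← zpow_add₀ hq]
  simp

variable (L) in
/-- The operator `m! A_m^q` over `L`. -/
def altSum (m n : ℕ) (q : K) : Matrix (Fin m → Fin n) (Fin m → Fin n) L :=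
  ∑ σ : Equiv.Perm (Fin m), (Equiv.Perm.sign σ : ℤ) • permOp L n q σ

theorem altSum_mul_permOp {q : K} (hq : q ≠ 0) (τ : Equiv.Perm (Fin m)) :
    altSum L m n q * permOp L n q τ = (Equiv.Perm.sign τ : ℤ) • altSum L m n q := by
  rw [altSum, Finset.sum_mul, Finset.smul_sum]
  refine Fintype.sum_equiv (Equiv.mulRight τ) _ _ fun σ => ?_
  rw [Equiv.coe_mulRight, permOp_mul hq, smul_smul, map_mul, smul_mul_assoc]
  congr 1
  rcases Int.units_eq_one_or (Equiv.Perm.sign τ) with h | h <;> simp [h]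

theorem altSum_central (q : K) (a b : Fin m → Fin n) (c : L) :
    Commute (altSum L m n q a b) c := by
  rw [altSum, Matrix.sum_apply]
  refine Commute.sum_left _ _ _ fun σ _ => ?_
  rw [Matrix.smul_apply]
  exact Commute.smul_left (Algebra.commutes _ _) _

theorem altSum_apply_self {q : K} {a : Fin m → Fin n} (ha : Function.Injective a) :
    altSum L m n q a a = 1 := by
  rw [altSum, Matrix.sum_apply, Finset.sum_eq_single 1]
  · simp [permOp_one]
  · intro σ _ hσ
    rw [Matrix.smul_apply, permOp, Matrix.map_apply, qPerm, Matrix.of_apply, if_neg]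
    · simp
    · intro h
      apply hσ
      ext x
      have := congrFun h (σ x)
      simp only [Function.comp_apply, Equiv.symm_apply_apply] at this
      rw [ha this]
      rfl
  · simp

theorem altSum_apply_ne {q : K} {a b : Fin m → Fin n}
    (h : altSum L m n q a b ≠ 0) : ∃ τ : Equiv.Perm (Fin m), b = a ∘ τ := by
  by_contra hne
  push Not at hne
  apply h
  rw [altSum, Matrix.sum_apply]
  refine Finset.sum_eq_zero fun σ _ => ?_
  rw [Matrix.smul_apply, permOp, Matrix.map_apply, qPerm, Matrix.of_apply, if_neg]
  · simp
  · intro e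
    apply hne σ
    rw [e]
    funext x
    simp

theorem isQAnti_altSum {q : K} (hq : q ≠ 0) (a : Fin m → Fin n) :
    IsQAnti q (altSum L m n q a) :=
  isQAnti_row hq (fun τ => altSum_mul_permOp hq τ) a

/-- On the orbit of an injective tuple a `q`-antisymmetric function is determined by one value. The
row `a` of `m! A_m^q` is the one with value `1` at `a`, so it serves as the coefficient. -/
theorem IsQAnti.apply_comp {q : K} (hq : q ≠ 0) {g : (Fin m → Fin n) → L} (hg : IsQAnti q g)
    {a : Fin m → Fin n} (ha : Function.Injective a) (τ : Equiv.Perm (Fin m)) :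
    g (a ∘ τ) = altSum L m n q a (a ∘ τ) * g a := by
  rw [hg, isQAnti_altSum hq a, altSum_apply_self ha, smul_mul_assoc, smul_mul_assoc, one_mul]

/-- Swapping two equal indices changes neither the tuple nor its inversions, so `g b = -g b`. -/
theorem IsQAnti.apply_eq_zero [CharZero K] {q : K} {g : (Fin m → Fin n) → L} (hg : IsQAnti q g)
    {b : Fin m → Fin n} (hb : ¬ Function.Injective b) : g b = 0 := by
  rw [Function.Injective] at hb
  push Not at hb
  obtain ⟨i, j, hij, hne⟩ := hb
  have e : b ∘ Equiv.swap i j = b := by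
    funext x
    rw [Function.comp_apply, Equiv.swap_apply_def]
    split_ifs with h1 h2
    · rw [h1, hij]
    · rw [h2, hij]
    · rfl
  have h := hg b (Equiv.swap i j)
  rw [e, Equiv.Perm.sign_swap hne, sub_self, zpow_zero, one_smul] at h
  have h2 : (2 : K) • g b = 0 := by
    rw [two_smul]
    nth_rewrite 1 [h]
    simp
  have := congrArg (fun y => (2 : K)⁻¹ • y) h2
  simpa [smul_smul] using this

/-- Adjacent transpositions generate the symmetric group, already as a monoid. -/
theorem isQAnti_of_adjacent {q : K} (hq : q ≠ 0)
    {W : Matrix (Fin m → Fin n) (Fin m → Fin n) L}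
    (h : ∀ k l : Fin m, (l : ℕ) = k + 1 → W * permOp L n q (Equiv.swap k l) = -W)
    (a : Fin m → Fin n) : IsQAnti q (W a) := by
  refine isQAnti_row hq (fun σ => ?_) a
  cases m with
  | zero =>
    have : σ = 1 := Subsingleton.elim _ _
    rw [this, permOp_one]
    simp
  | succ m =>
    have hσ : σ ∈ Submonoid.closure
        (Set.range fun i : Fin m => Equiv.swap i.castSucc i.succ) := by
      rw [Equiv.Perm.mclosure_swap_castSucc_succ]
      trivial
    induction hσ using Submonoid.closure_induction with
    | mem x hx =>
      obtain ⟨i, rfl⟩ := hx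
      rw [h _ _ (by simp), Equiv.Perm.sign_swap (Fin.castSucc_lt_succ).ne]
      simp
    | one => simp [permOp_one]
    | mul x y _ _ hx hy =>
      rw [permOp_mul hq, ← mul_assoc, hx, smul_mul_assoc, hy, smul_smul, map_mul]
      simp

end Anti

/-! ### Antisymmetry of Sklyanin minors and invertibility of Sklyanin determinants. -/

section Minor

variable {K : Type*} [Field K] [CharZero K] {A : Type*} [Ring A] [Algebra K A] {m n : ℕ}

theorem sklyaninMinor_eq (q : K) (S : Matrix (Fin n) (Fin n) (PowerSeries A))
    (a b : Fin m → Fin n) :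
    sklyaninMinor q S a b = (altSum (PowerSeries A) m n q * bracket m q S) a b := by
  have e : (m.factorial : K) • (qAntisymmetrizer m n q).map (algebraMap K (PowerSeries A)) =
      altSum (PowerSeries A) m n q := by
    refine Matrix.ext fun a b => ?_
    have hm : (m.factorial : K) ≠ 0 := by exact_mod_cast m.factorial_ne_zero
    rw [Matrix.smul_apply, Matrix.map_apply, qAntisymmetrizer, Matrix.smul_apply, smul_eq_mul,
      Algebra.smul_def, ← map_mul, ← mul_assoc, mul_inv_cancel₀ hm, one_mul, altSum,
      Matrix.sum_apply, Matrix.sum_apply, map_sum]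
    refine Finset.sum_congr rfl fun σ _ => ?_
    exact map_zsmul (algebraMap K (PowerSeries A)) _ _
  rw [sklyaninMinor, ← e, smul_mul_assoc, Matrix.smul_apply]

theorem twoSite_antiOp {q : K} (k l : Fin m) (h : (l : ℕ) = k + 1) :
    twoSite k l (antiOp A n q) = 1 - permOp (PowerSeries A) n q (Equiv.swap k l) := by
  have hne : k ≠ l := by
    rintro rfl
    omega
  rw [antiOp_eq, ← twoSiteHom_apply k l hne, map_sub, map_one, twoSiteHom_apply, permOp,
    qPerm_adjacent k l h, twoSite_map]

/-- Write `E = m! A_m^q` and let `P` be an adjacent `P^q`. From `E (1 - P) = 2 E` and `(1 - P) Y = G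
(1 - P)` one gets `2 E Y (1 + P) = E G (1 - P) (1 + P) = 0`, as `P² = 1`. -/
theorem isQAnti_altSum_mul {q : K} (hq : q ≠ 0)
    {Y : Matrix (Fin m → Fin n) (Fin m → Fin n) (PowerSeries A)}
    (hY : ∀ k l : Fin m, (l : ℕ) = k + 1 → Push (twoSite k l (antiOp A n q)) Y)
    (a : Fin m → Fin n) : IsQAnti q ((altSum (PowerSeries A) m n q * Y) a) := by
  refine isQAnti_of_adjacent hq (fun k l hkl => ?_) a
  have hne : k ≠ l := by
    rintro rfl
    omega
  obtain ⟨-, G, -, hG⟩ := hY k l hkl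
  rw [twoSite_antiOp k l hkl] at hG
  set P := permOp (PowerSeries A) n q (Equiv.swap k l)
  set E := altSum (PowerSeries A) m n q
  have hP : P * P = 1 := by
    rw [← permOp_mul hq, Equiv.swap_mul_self, permOp_one]
  have hE : E * P = -E := by
    rw [altSum_mul_permOp hq, Equiv.Perm.sign_swap hne]
    simp [E]
  have h2 : (2 : K) • (E * Y * P + E * Y) = 0 := by
    have h3 : E * (1 - P) = (2 : K) • E := by
      rw [mul_sub, hE, two_smul, mul_one, sub_neg_eq_add]
    have h4 : (1 - P) * (P + 1) = 0 := by
      rw [sub_mul, mul_add P, hP]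
      simp [add_comm]
    calc (2 : K) • (E * Y * P + E * Y) = ((2 : K) • E) * Y * (P + 1) := by
          rw [mul_add, mul_one, smul_mul_assoc, smul_mul_assoc, smul_add]
      _ = E * ((1 - P) * Y) * (P + 1) := by rw [← h3, mul_assoc E]
      _ = E * G * ((1 - P) * (P + 1)) := by rw [hG]; simp only [mul_assoc]
      _ = 0 := by rw [h4, mul_zero]
  have h5 := congrArg (fun y => (2 : K)⁻¹ • y) h2
  simp only [smul_smul, smul_zero] at h5
  rw [inv_mul_cancel₀ two_ne_zero, one_smul] at h5
  exact eq_neg_of_add_eq_zero_left h5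

theorem IsQAnti.apply_top {L : Type*} [Ring L] [Algebra K L] {q : K} (hq : q ≠ 0)
    {g : (Fin n → Fin n) → L} (hg : IsQAnti q g) (b : Fin n → Fin n) :
    g b = altSum L n n q id b * g id := by
  by_cases hb : Function.Injective b
  · have := hg.apply_comp hq Function.injective_id
      (Equiv.ofBijective b (Finite.injective_iff_bijective.1 hb))
    exact this
  · rw [hg.apply_eq_zero hb, (isQAnti_altSum hq id).apply_eq_zero hb, zero_mul]

/-- When `m = n`, the row `id` of `E v` is the row `id` of `E` times `(E v)_{id,id}` for any `v`
through which all `1 - P^q` pass. Evaluating `E = (E v) v⁻¹` at `(id, id)`, where `E` is `1`, gives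
`(E v)_{id,id} (E v⁻¹)_{id,id} = 1`. -/
theorem isUnit_sdet {q : K} (hq : q ≠ 0) {S : Matrix (Fin n) (Fin n) (PowerSeries A)}
    (hS : IsUnit S) (hF : IsFused q S) : IsUnit (sdet q S) := by
  obtain ⟨u, hu⟩ := isUnit_bracket (m := n) hq hS
  set E := altSum (PowerSeries A) n n q with hE
  have key : ∀ v : (Matrix (Fin n → Fin n) (Fin n → Fin n) (PowerSeries A))ˣ,
      (∀ k l : Fin n, (l : ℕ) = k + 1 → Push (twoSite k l (antiOp A n q)) v.val) →
      (E * v.val) id id * (E * (v⁻¹).val) id id = 1 := by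
    intro v hv
    have h1 : E = E * v.val * (v⁻¹).val := by
      rw [mul_assoc, Units.mul_inv, mul_one]
    have h2 : E id id = 1 := altSum_apply_self Function.injective_id
    rw [← h2]
    nth_rewrite 3 [h1]
    rw [Matrix.mul_apply (M := E * v.val), Matrix.mul_apply (M := E)
      (N := (v⁻¹).val), Finset.mul_sum]
    refine Finset.sum_congr rfl fun c _ => ?_
    rw [(isQAnti_altSum_mul hq hv id).apply_top hq c, ← mul_assoc]
    congr 1
    exact ((altSum_central q id c _).eq).symm
  have hp : ∀ k l : Fin n, (l : ℕ) = k + 1 →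
      Push (twoSite k l (antiOp A n q)) u.val := fun k l hkl => by
    rw [hu]
    exact push_bracket hq hS hF hkl
  have h1 := key u hp
  -- The coefficients do not commute, so the inverse on the other side is obtained by exchanging the
  -- bracket with its inverse.
  have h2 := key u⁻¹ fun k l hkl => (hp k l hkl).inv
  rw [inv_inv] at h2
  rw [sdet, sklyaninMinor_eq, ← hu]
  exact ⟨⟨_, _, h1, h2⟩, rfl⟩

end Minor

/-! ### Restriction of ordered products to a subset of the basis -/

section Paths

variable {Λ α β : Type*}

/-- The composite of the relations with labels in a list. -/
def relComp (r : Λ → α → α → Prop) : List Λ → α → α → Prop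
  | [], a, b => a = b
  | x :: l, a, b => ∃ c, r x a c ∧ relComp r l c b

theorem relComp_append (r : Λ → α → α → Prop) (l l' : List Λ) (a b : α) :
    relComp r (l ++ l') a b ↔ ∃ c, relComp r l a c ∧ relComp r l' c b := by
  induction l generalizing a with
  | nil => simp [relComp]
  | cons x l ih =>
    simp only [List.cons_append, relComp, ih]
    constructor
    · rintro ⟨c, h1, d, h2, h3⟩
      exact ⟨d, ⟨c, h1, h2⟩, h3⟩
    · rintro ⟨d, ⟨c, h1, h2⟩, h3⟩
      exact ⟨c, h1, d, h2, h3⟩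

theorem relComp_reverse {r : Λ → α → α → Prop} (hr : ∀ x a b, r x a b → r x b a) (l : List Λ)
    (a b : α) (h : relComp r l.reverse a b) : relComp r l b a := by
  induction l generalizing b with
  | nil => exact h.symm
  | cons x l ih =>
    rw [List.reverse_cons, relComp_append] at h
    obtain ⟨c, h1, d, h2, rfl⟩ := h
    exact ⟨c, hr _ _ _ h2, ih _ h1⟩

/-- Every path along a list of relations with ends in `P` stays in `P`. -/
def PathClosed (P : α → Prop) (r : Λ → α → α → Prop) (l : List Λ) : Prop :=
  ∀ l₁ l₂, l = l₁ ++ l₂ → ∀ a c b, P a → P b → relComp r l₁ a c → relComp r l₂ c b → P c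

theorem PathClosed.reverse {P : α → Prop} {r : Λ → α → α → Prop}
    (hr : ∀ x a b, r x a b → r x b a) {l : List Λ} (h : PathClosed P r l) :
    PathClosed P r l.reverse := by
  intro l₁ l₂ e a c b ha hb h1 h2
  have e' : l = l₂.reverse ++ l₁.reverse := by
    rw [← List.reverse_append, ← e, List.reverse_reverse]
  refine h _ _ e' b c a hb ha ?_ ?_
  · exact relComp_reverse hr _ _ _ (by rwa [List.reverse_reverse])
  · exact relComp_reverse hr _ _ _ (by rwa [List.reverse_reverse])

theorem PathClosed.tail {P : α → Prop} {r : Λ → α → α → Prop} (hr : ∀ x a, r x a a) {x : Λ}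
    {l : List Λ} (h : PathClosed P r (x :: l)) : PathClosed P r l := by
  intro l₁ l₂ e a c b ha hb h1 h2
  exact h (x :: l₁) l₂ (by rw [e, List.cons_append]) a c b ha hb ⟨a, hr x a, h1⟩ h2

variable {L : Type*} [Ring L] [Fintype α] [DecidableEq α] [Fintype β] [DecidableEq β]

theorem relComp_of_prod_ne_zero {r : Λ → α → α → Prop} {Y : Λ → Matrix α α L}
    (hY : ∀ x a b, Y x a b ≠ 0 → r x a b) (l : List Λ) (a b : α)
    (h : (l.map Y).prod a b ≠ 0) : relComp r l a b := by
  induction l generalizing a with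
  | nil =>
    by_contra hne
    apply h
    rw [List.map_nil, List.prod_nil, Matrix.one_apply_ne hne]
  | cons x l ih =>
    rw [List.map_cons, List.prod_cons, Matrix.mul_apply] at h
    obtain ⟨c, -, hc⟩ := Finset.exists_ne_zero_of_sum_ne_zero h
    exact ⟨c, hY _ _ _ (left_ne_zero_of_mul hc), ih _ (right_ne_zero_of_mul hc)⟩

/-- A nonzero term of a product of matrices is a path through the supports of the factors. If no
path between tuples in the image of `g` leaves that image, then nothing is lost by compressing each
factor separately. -/
theorem submatrix_list_prod {P : α → Prop} {g : β → α} (hg : Function.Injective g)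
    (hP : ∀ a, P a ↔ ∃ b, g b = a) {r : Λ → α → α → Prop} (hr : ∀ x a, r x a a)
    {Y : Λ → Matrix α α L} (hY : ∀ x a b, Y x a b ≠ 0 → r x a b) {l : List Λ}
    (hl : PathClosed P r l) :
    (l.map Y).prod.submatrix g g = (l.map fun x => (Y x).submatrix g g).prod := by
  induction l with
  | nil =>
    rw [List.map_nil, List.prod_nil, List.map_nil, List.prod_nil, Matrix.submatrix_one g hg]
  | cons x l ih =>
    rw [List.map_cons, List.prod_cons, List.map_cons, List.prod_cons, ← ih (hl.tail hr)]
    ext a b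
    rw [Matrix.submatrix_apply, Matrix.mul_apply, Matrix.mul_apply]
    symm
    refine Finset.sum_of_injOn g hg.injOn (fun d _ => Finset.mem_coe.2 (Finset.mem_univ _)) ?_
      fun d _ => rfl
    intro c _ hc
    by_contra hne
    apply hc
    have h1 := hY _ _ _ (left_ne_zero_of_mul hne)
    have h2 := relComp_of_prod_ne_zero hY _ _ _ (right_ne_zero_of_mul hne)
    obtain ⟨d, hd⟩ := (hP c).1 (hl [x] l rfl (g a) c (g b) ((hP _).2 ⟨a, rfl⟩)
      ((hP _).2 ⟨b, rfl⟩) ⟨c, h1, rfl⟩ h2)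
    exact ⟨d, Finset.mem_coe.2 (Finset.mem_univ _), hd⟩

theorem reverse_prod_mul_prod {M : Type*} [Monoid M] {Y Y' : Λ → M} (h : ∀ x, Y' x * Y x = 1)
    (l : List Λ) : (l.reverse.map Y').prod * (l.map Y).prod = 1 := by
  induction l with
  | nil => simp
  | cons x l ih =>
    rw [List.reverse_cons, List.map_append, List.prod_append, List.map_singleton,
      List.prod_singleton, List.map_cons, List.prod_cons, mul_assoc, ← mul_assoc (Y' x), h,
      one_mul, ih]

end Paths

/-! ### Compression of brackets and of their inverses. -/

section Bracket

variable {L : Type*} [Ring L] {n m N : ℕ}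

/-- The labels of the factors of the bracket: `(i, none)` for `S_i` and `(i, some j)` for
`R̄ᵗ_{ij}`. -/
def bracketLabels (m : ℕ) (l : List (Fin m)) : List (Fin m × Option (Fin m)) :=
  l.flatMap fun i => (i, none) :: (List.finRange m).map fun j => (i, some j)

/-- The factors of the bracket. -/
def bracketFactor (T : Fin m → Matrix (Fin n) (Fin n) L)
    (X : Fin m → Fin m → Matrix (Fin n × Fin n) (Fin n × Fin n) L) :
    Fin m × Option (Fin m) → Matrix (Fin m → Fin n) (Fin m → Fin n) L
  | (i, none) => oneSite i (T i)
  | (i, some j) => if i < j then twoSite i j (X i j) else 1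

/-- The supports of the factors of the bracket. -/
def bracketRel (n m : ℕ) : Fin m × Option (Fin m) → (Fin m → Fin n) → (Fin m → Fin n) → Prop
  | (i, none), a, b => ∀ k, k ≠ i → a k = b k
  | (i, some j), a, b =>
    a = b ∨ i < j ∧ (∀ k, k ≠ i → k ≠ j → a k = b k) ∧ a i = a j ∧ b i = b j

theorem bracketRel_refl (x : Fin m × Option (Fin m)) (a : Fin m → Fin n) :
    bracketRel n m x a a := by
  obtain ⟨i, _ | j⟩ := x
  · exact fun _ _ => rfl
  · exact Or.inl rfl

theorem bracketRel_symm (x : Fin m × Option (Fin m)) (a b : Fin m → Fin n)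
    (h : bracketRel n m x a b) : bracketRel n m x b a := by
  obtain ⟨i, _ | j⟩ := x
  · exact fun k hk => (h k hk).symm
  · rcases h with h | ⟨h0, h1, h2, h3⟩
    · exact Or.inl h.symm
    · exact Or.inr ⟨h0, fun k hk hk' => (h1 k hk hk').symm, h3, h2⟩

theorem bracketRel_of_ne_zero {T : Fin m → Matrix (Fin n) (Fin n) L}
    {X : Fin m → Fin m → Matrix (Fin n × Fin n) (Fin n × Fin n) L}
    (hX : ∀ i j, ∃ c, X i j = zeroWeight c) (x : Fin m × Option (Fin m)) (a b : Fin m → Fin n)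
    (h : bracketFactor T X x a b ≠ 0) : bracketRel n m x a b := by
  obtain ⟨i, _ | j⟩ := x
  · by_contra hne
    exact h (if_neg hne)
  · simp only [bracketFactor] at h
    split_ifs at h with hij
    · by_contra hne
      simp only [bracketRel, not_or] at hne
      apply h
      obtain ⟨c, hc⟩ := hX i j
      rw [twoSite, Matrix.of_apply]
      split_ifs with h1
      · rw [hc, zeroWeight_apply, if_neg, if_neg]
        · intro e
          rw [Prod.mk.injEq] at e
          apply hne.1
          funext k
          by_cases hk : k = i
          · rw [hk, e.1]
          · by_cases hk' : k = j
            · rw [hk', e.2]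
            · exact h1 k hk hk'
        · exact fun e => hne.2 ⟨hij, h1, e⟩
      · rfl
    · left
      by_contra hne
      exact h (Matrix.one_apply_ne hne)

theorem relComp_cross_eq {i : Fin m} {l : List (Fin m)} {a b : Fin m → Fin n}
    (h : relComp (bracketRel n m) (l.map fun j => (i, some j)) a b) {k : Fin m} (hk : k ≠ i)
    (hkl : k ∉ l) : a k = b k := by
  induction l generalizing a with
  | nil => exact congrFun h k
  | cons j l ih =>
    obtain ⟨c, h1, h2⟩ := h
    rw [List.mem_cons, not_or] at hkl
    rw [← ih h2 hkl.2]
    rcases h1 with rfl | ⟨-, h1, -, -⟩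
    · rfl
    · exact h1 k hk hkl.1

/-- After `S_i` acts, the index at site `i` is unknown. It can next change only at a crossing where
it equals the index of another site, which is known to lie in `R`; if it never changes, it is the
final value `b i`. -/
theorem relComp_cross_left {R : Set (Fin n)} {i : Fin m} {l : List (Fin m)} (hl : l.Nodup)
    {a b : Fin m → Fin n}
    (h : relComp (bracketRel n m) (l.map fun j => (i, some j)) a b)
    (ha : ∀ j ∈ l, j ≠ i → a j ∈ R) (hb : b i ∈ R) : a i ∈ R := by
  induction l generalizing a with
  | nil =>
    rw [congrFun h i]
    exact hb
  | cons j l ih =>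
    obtain ⟨c, h1, h2⟩ := h
    rw [List.nodup_cons] at hl
    rcases h1 with rfl | ⟨h0, h1, h3, h4⟩
    · exact ih hl.2 h2 fun k hk => ha k (List.mem_cons_of_mem _ hk)
    · rw [h3]
      exact ha j List.mem_cons_self h0.ne'

/-- A crossing that changes site `j` leaves it equal to site `i`, and the index at site `i` lies in
`R` at that moment by `relComp_cross_left` applied to the rest of the path. -/
theorem relComp_cross_right {R : Set (Fin n)} {i : Fin m} {l : List (Fin m)} (hl : l.Nodup)
    {a b : Fin m → Fin n}
    (h : relComp (bracketRel n m) (l.map fun j => (i, some j)) a b)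
    (ha : ∀ j, j ≠ i → a j ∈ R) (hb : b i ∈ R) (k : Fin m) : b k ∈ R := by
  induction l generalizing a with
  | nil =>
    obtain rfl : a = b := h
    by_cases hk : k = i
    · rw [hk]
      exact hb
    · exact ha k hk
  | cons j l ih =>
    have hl' := List.nodup_cons.1 hl
    obtain ⟨c, h1, h2⟩ := h
    have hc : ∀ j', j' ≠ i → j' ≠ j → c j' ∈ R := by
      intro j' hj' hj''
      rcases h1 with rfl | ⟨h0, h1, h3, h4⟩
      · exact ha j' hj'
      · rw [← h1 j' hj' hj'']
        exact ha j' hj'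
    have hci : c i ∈ R := relComp_cross_left hl'.2 h2
      (fun j' hj' hne => hc j' hne (by rintro rfl; exact hl'.1 hj')) hb
    refine ih hl'.2 h2 fun j' hj' => ?_
    by_cases e : j' = j
    · rcases h1 with rfl | ⟨h0, h1, h3, h4⟩
      · exact ha j' hj'
      · rw [e, ← h4]
        exact hci
    · exact hc j' hj' e

theorem relComp_cross_mid {R : Set (Fin n)} {i : Fin m} {l₁ l₂ : List (Fin m)}
    (hl : (l₁ ++ l₂).Nodup) {a c b : Fin m → Fin n}
    (h₁ : relComp (bracketRel n m) (l₁.map fun j => (i, some j)) a c)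
    (h₂ : relComp (bracketRel n m) (l₂.map fun j => (i, some j)) c b)
    (ha : ∀ j, j ≠ i → a j ∈ R) (hb : b i ∈ R) (k : Fin m) : c k ∈ R := by
  rw [List.nodup_append] at hl
  refine relComp_cross_right hl.1 h₁ ha (relComp_cross_left hl.2.1 h₂ ?_ hb) k
  intro j hj hji
  rw [← relComp_cross_eq h₁ hji fun hj' => hl.2.2 j hj' j hj rfl]
  exact ha j hji

theorem relComp_labels_eq {l : List (Fin m)} {i : Fin m} (hi : ∀ j ∈ l, i < j)
    {a b : Fin m → Fin n} (h : relComp (bracketRel n m) (bracketLabels m l) a b) : a i = b i := by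
  have key : ∀ (l' : List (Fin m × Option (Fin m))) (a : Fin m → Fin n),
      (∀ x ∈ l', i < x.1) → relComp (bracketRel n m) l' a b → a i = b i := by
    intro l'
    induction l' with
    | nil => exact fun a _ h => congrFun h i
    | cons x l' ih =>
      rintro a hx ⟨c, h1, h2⟩
      rw [← ih c (fun y hy => hx y (List.mem_cons_of_mem _ hy)) h2]
      have hix := hx x List.mem_cons_self
      obtain ⟨i', _ | j⟩ := x
      · exact h1 i hix.ne
      · rcases h1 with rfl | ⟨h0, h1, -, -⟩
        · rfl
        · exact h1 i hix.ne (hix.trans h0).ne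
  refine key _ a (fun x hx => ?_) h
  simp only [bracketLabels, List.mem_flatMap, List.mem_cons, List.mem_map] at hx
  obtain ⟨j, hj, rfl | ⟨j', -, rfl⟩⟩ := hx
  · exact hi j hj
  · exact hi j hj

/-- Once the block of site `i` is over, later factors touch only sites greater than `i`. Hence the
index of site `i` already has its final value, which lies in `R`, and this is propagated backwards
through the crossings of the block. -/
theorem pathClosed_bracketLabels (R : Set (Fin n)) {l : List (Fin m)} (hl : l.Pairwise (· < ·)) :
    PathClosed (fun a : Fin m → Fin n => ∀ k, a k ∈ R) (bracketRel n m) (bracketLabels m l) := by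
  induction l with
  | nil =>
    intro l₁ l₂ e a c b ha hb h1 h2
    obtain ⟨rfl, rfl⟩ := List.append_eq_nil_iff.1 e.symm
    obtain rfl : a = c := h1
    exact ha
  | cons i l ih =>
    rw [List.pairwise_cons] at hl
    intro l₁ l₂ e a c b ha hb h1 h2
    have e' : bracketLabels m (i :: l) =
        ((i, none) :: (List.finRange m).map fun j => (i, some j)) ++ bracketLabels m l := by
      simp [bracketLabels]
    rw [e'] at e
    -- The tuple `c` on the path is reached either after the block of site `i`, where the induction
    -- hypothesis applies, or within that block.
    rcases List.append_eq_append_iff.1 e with ⟨t, rfl, ht⟩ | ⟨t, ht, rfl⟩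
    · rw [relComp_append] at h1
      obtain ⟨p, ⟨a', h3, h4⟩, h5⟩ := h1
      have hp : ∀ k, p k ∈ R := by
        refine relComp_cross_right (List.nodup_finRange m) h4 (fun j hj => ?_) ?_
        · rw [← h3 j hj]
          exact ha j
        · have h6 : p i = b i := by
            refine relComp_labels_eq hl.1 ?_
            rw [ht, relComp_append]
            exact ⟨c, h5, h2⟩
          rw [h6]
          exact hb i
      exact ih hl.2 t l₂ ht p c b hp hb h5 h2
    · cases l₁ with
      | nil =>
        obtain rfl : a = c := h1
        exact ha
      | cons x l₁ =>
        rw [List.cons_append, List.cons.injEq] at ht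
        obtain ⟨rfl, ht⟩ := ht
        obtain ⟨s₁, s₂, hs, rfl, rfl⟩ := List.map_eq_append_iff.1 ht
        obtain ⟨a', h3, h4⟩ := h1
        rw [relComp_append] at h2
        obtain ⟨p, h5, h6⟩ := h2
        refine relComp_cross_mid (hs ▸ List.nodup_finRange m) h4 h5 (fun j hj => ?_) ?_
        · rw [← h3 j hj]
          exact ha j
        · rw [relComp_labels_eq hl.1 h6]
          exact hb i

theorem oneSite_submatrix {f : Fin N → Fin n} (hf : Function.Injective f) (i : Fin m)
    (T : Matrix (Fin n) (Fin n) L) :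
    (oneSite i T).submatrix (f ∘ ·) (f ∘ ·) = oneSite i (T.submatrix f f) := by
  ext a b
  simp [oneSite, hf.eq_iff]

theorem twoSite_submatrix {f : Fin N → Fin n} (hf : Function.Injective f) (i j : Fin m)
    (X : Matrix (Fin n × Fin n) (Fin n × Fin n) L) :
    (twoSite i j X).submatrix (f ∘ ·) (f ∘ ·) =
      twoSite i j (X.submatrix (Prod.map f f) (Prod.map f f)) := by
  ext a b
  simp [twoSite, hf.eq_iff]

theorem comp_left_injective {f : Fin N → Fin n} (hf : Function.Injective f) :
    Function.Injective (fun a : Fin m → Fin N => f ∘ a) := fun _ _ h => hf.comp_left h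

theorem bracketFactor_submatrix {f : Fin N → Fin n} (hf : Function.Injective f)
    (T : Fin m → Matrix (Fin n) (Fin n) L)
    (X : Fin m → Fin m → Matrix (Fin n × Fin n) (Fin n × Fin n) L)
    (x : Fin m × Option (Fin m)) :
    (bracketFactor T X x).submatrix (f ∘ ·) (f ∘ ·) =
      bracketFactor (fun i => (T i).submatrix f f)
        (fun i j => (X i j).submatrix (Prod.map f f) (Prod.map f f)) x := by
  obtain ⟨i, _ | j⟩ := x
  · exact oneSite_submatrix hf i _
  · simp only [bracketFactor]
    split_ifs
    · exact twoSite_submatrix hf i j _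
    · exact Matrix.submatrix_one _ (comp_left_injective hf)

theorem forall_mem_range_iff (f : Fin N → Fin n) (a : Fin m → Fin n) :
    (∀ k, a k ∈ Set.range f) ↔ ∃ b : Fin m → Fin N, f ∘ b = a := by
  constructor
  · intro h
    choose b hb using h
    exact ⟨b, funext hb⟩
  · rintro ⟨b, rfl⟩ k
    exact ⟨b k, rfl⟩

/-- The ordered product of the factors of a bracket. -/
def genBracket (T : Fin m → Matrix (Fin n) (Fin n) L)
    (X : Fin m → Fin m → Matrix (Fin n × Fin n) (Fin n × Fin n) L) :
    Matrix (Fin m → Fin n) (Fin m → Fin n) L :=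
  ((bracketLabels m (List.finRange m)).map (bracketFactor T X)).prod

/-- The product of the factors of a bracket in the opposite order. -/
def revBracket (T : Fin m → Matrix (Fin n) (Fin n) L)
    (X : Fin m → Fin m → Matrix (Fin n × Fin n) (Fin n × Fin n) L) :
    Matrix (Fin m → Fin n) (Fin m → Fin n) L :=
  ((bracketLabels m (List.finRange m)).reverse.map (bracketFactor T X)).prod

theorem genBracket_eq (T : Fin m → Matrix (Fin n) (Fin n) L)
    (X : Fin m → Fin m → Matrix (Fin n × Fin n) (Fin n × Fin n) L) :
    genBracket T X = ((List.finRange m).map fun i => oneSite i (T i) *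
      ((List.finRange m).map fun j => if i < j then twoSite i j (X i j) else 1).prod).prod := by
  have h : ∀ l : List (Fin m), ((bracketLabels m l).map (bracketFactor T X)).prod =
      (l.map fun i => oneSite i (T i) *
        ((List.finRange m).map fun j => if i < j then twoSite i j (X i j) else 1).prod).prod := by
    intro l
    induction l with
    | nil => rfl
    | cons i l ih =>
      rw [List.map_cons, List.prod_cons, ← ih, bracketLabels, List.flatMap_cons, List.map_append,
        List.prod_append, List.map_cons, List.prod_cons, List.map_map]
      rfl
  exact h _

theorem genBracket_submatrix {f : Fin N → Fin n} (hf : Function.Injective f)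
    (T : Fin m → Matrix (Fin n) (Fin n) L)
    {X : Fin m → Fin m → Matrix (Fin n × Fin n) (Fin n × Fin n) L}
    (hX : ∀ i j, ∃ c, X i j = zeroWeight c) :
    (genBracket T X).submatrix (f ∘ ·) (f ∘ ·) =
      genBracket (fun i => (T i).submatrix f f)
        (fun i j => (X i j).submatrix (Prod.map f f) (Prod.map f f)) := by
  rw [genBracket, submatrix_list_prod (comp_left_injective hf) (forall_mem_range_iff f)
    bracketRel_refl (bracketRel_of_ne_zero hX)
    (pathClosed_bracketLabels (Set.range f) (List.pairwise_lt_finRange m))]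
  simp only [bracketFactor_submatrix hf]
  rfl

/-- The supports are symmetric relations, so paths may be read backwards. The reversed product is
needed because the inverse of a bracket multiplies the inverses in the opposite order. -/
theorem revBracket_submatrix {f : Fin N → Fin n} (hf : Function.Injective f)
    (T : Fin m → Matrix (Fin n) (Fin n) L)
    {X : Fin m → Fin m → Matrix (Fin n × Fin n) (Fin n × Fin n) L}
    (hX : ∀ i j, ∃ c, X i j = zeroWeight c) :
    (revBracket T X).submatrix (f ∘ ·) (f ∘ ·) =
      revBracket (fun i => (T i).submatrix f f)
        (fun i j => (X i j).submatrix (Prod.map f f) (Prod.map f f)) := by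
  rw [revBracket, submatrix_list_prod (comp_left_injective hf) (forall_mem_range_iff f)
    bracketRel_refl (bracketRel_of_ne_zero hX)
    ((pathClosed_bracketLabels (Set.range f) (List.pairwise_lt_finRange m)).reverse
      bracketRel_symm)]
  simp only [bracketFactor_submatrix hf]
  rfl

theorem revBracket_mul_genBracket {T T' : Fin m → Matrix (Fin n) (Fin n) L}
    {X X' : Fin m → Fin m → Matrix (Fin n × Fin n) (Fin n × Fin n) L}
    (hT : ∀ i, T' i * T i = 1) (hX : ∀ i j, X' i j * X i j = 1) :
    revBracket T' X' * genBracket T X = 1 := by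
  refine reverse_prod_mul_prod (fun x => ?_) _
  obtain ⟨i, _ | j⟩ := x
  · change oneSiteHom i (T' i) * oneSiteHom i (T i) = 1
    rw [← map_mul, hT, map_one]
  · simp only [bracketFactor]
    split_ifs with h
    · rw [← twoSiteHom_apply i j h.ne, ← twoSiteHom_apply i j h.ne, ← map_mul, hX, map_one]
    · exact mul_one 1

end Bracket

/-! ### Concatenated index sequences -/

section Append

variable {m p n : ℕ}

theorem inversions_eq_sum (a : Fin m → Fin n) :
    inversions a = ∑ i, ∑ j, if i < j ∧ a j < a i then 1 else 0 := by
  rw [inversions, Finset.card_filter, Fintype.sum_prod_type]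

/-- The number of inversions between two sequences. -/
def crossInversions (a : Fin m → Fin n) (b : Fin p → Fin n) : ℕ :=
  ∑ i, ∑ j, if b j < a i then 1 else 0

theorem inversions_append (a : Fin m → Fin n) (b : Fin p → Fin n) :
    inversions (Fin.append a b) = inversions a + inversions b + crossInversions a b := by
  have h1 : ∀ (i : Fin m) (j : Fin p), Fin.castAdd p i < Fin.natAdd m j := fun i j => by
    rw [Fin.lt_def, Fin.val_castAdd, Fin.val_natAdd]
    omega
  have h2 : ∀ (i : Fin m) (j : Fin p), ¬ Fin.natAdd m j < Fin.castAdd p i :=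
    fun i j => (h1 i j).not_gt
  rw [inversions_eq_sum, inversions_eq_sum a, inversions_eq_sum b, crossInversions,
    Fin.sum_univ_add]
  simp only [Fin.sum_univ_add, Fin.append_left, Fin.append_right, h1, h2, true_and, false_and,
    if_false, Finset.sum_const_zero, zero_add, Finset.sum_add_distrib, (Fin.strictMono_castAdd p).lt_iff_lt,
    (Fin.strictMono_natAdd m).lt_iff_lt]
  omega

theorem crossInversions_comp (a : Fin m → Fin n) (b : Fin p → Fin n) (σ : Equiv.Perm (Fin m))
    (τ : Equiv.Perm (Fin p)) : crossInversions (a ∘ σ) (b ∘ τ) = crossInversions a b := by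
  rw [crossInversions, crossInversions, ← Equiv.sum_comp σ fun i => ∑ j, if b j < a i then 1 else 0]
  refine Finset.sum_congr rfl fun i _ => ?_
  exact Equiv.sum_comp τ fun j => if b j < a (σ i) then 1 else 0

theorem inversions_comp_strictMono {N : ℕ} {f : Fin n → Fin N} (hf : StrictMono f)
    (a : Fin m → Fin n) : inversions (f ∘ a) = inversions a := by
  simp only [inversions, Function.comp_apply, hf.lt_iff_lt]

/-- The permutation of `m + p` positions given by permutations of the two parts. -/
def appendPerm (σ : Equiv.Perm (Fin m)) (τ : Equiv.Perm (Fin p)) : Equiv.Perm (Fin (m + p)) :=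
  finSumFinEquiv.permCongr (Equiv.Perm.sumCongr σ τ)

theorem sign_appendPerm (σ : Equiv.Perm (Fin m)) (τ : Equiv.Perm (Fin p)) :
    Equiv.Perm.sign (appendPerm σ τ) = Equiv.Perm.sign σ * Equiv.Perm.sign τ := by
  rw [appendPerm, Equiv.Perm.sign_permCongr, Equiv.Perm.sign_sumCongr]

theorem append_comp_appendPerm {α : Type*} (a : Fin m → α) (b : Fin p → α)
    (σ : Equiv.Perm (Fin m)) (τ : Equiv.Perm (Fin p)) :
    Fin.append a b ∘ appendPerm σ τ = Fin.append (a ∘ σ) (b ∘ τ) := by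
  funext x
  refine Fin.addCases (fun i => ?_) (fun i => ?_) x <;> simp [appendPerm, Equiv.permCongr_apply]

theorem append_comp_castAdd {α : Type*} (a : Fin m → α) (b : Fin p → α) :
    Fin.append a b ∘ Fin.castAdd p = a := funext fun i => Fin.append_left a b i

theorem append_comp_natAdd {α : Type*} (a : Fin m → α) (b : Fin p → α) :
    Fin.append a b ∘ Fin.natAdd m = b := funext fun i => Fin.append_right a b i

theorem extend_castAdd_append (d a : Fin m → Fin n) (b : Fin p → Fin n) :
    Function.extend (Fin.castAdd p) d (Fin.append a b) = Fin.append d b := by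
  symm
  rw [eq_extend_iff (Fin.castAdd_injective m p)]
  refine ⟨append_comp_castAdd d b, fun x => ?_⟩
  refine Fin.addCases (fun i hi => absurd rfl (hi i)) (fun i _ => ?_) x
  rw [Fin.append_right, Fin.append_right]

theorem extend_natAdd_append (a : Fin m → Fin n) (d b : Fin p → Fin n) :
    Function.extend (Fin.natAdd m) d (Fin.append a b) = Fin.append a d := by
  symm
  rw [eq_extend_iff (Fin.natAdd_injective p m)]
  refine ⟨append_comp_natAdd a d, fun x => ?_⟩
  refine Fin.addCases (fun i _ => ?_) (fun i hi => absurd rfl (hi i)) x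
  rw [Fin.append_left, Fin.append_left]

/-- As no value of `a` occurs in `b'`, the permutation must send the second block of positions to
itself; by counting, it preserves the first block as well. -/
theorem exists_perm_of_append {α : Type*} {a a' : Fin m → α} {b b' : Fin p → α}
    (hab : ∀ i j, a i ≠ b' j) {ρ : Equiv.Perm (Fin (m + p))}
    (h : Fin.append a' b' = Fin.append a b ∘ ρ) :
    (∃ σ : Equiv.Perm (Fin m), a' = a ∘ σ) ∧ ∃ τ : Equiv.Perm (Fin p), b' = b ∘ τ := by
  have h1 : ∀ j, ∃ k, ρ (Fin.natAdd m j) = Fin.natAdd m k := by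
    intro j
    have hj := congrFun h (Fin.natAdd m j)
    rw [Fin.append_right, Function.comp_apply] at hj
    revert hj
    refine Fin.addCases (fun i hi => ?_) (fun k _ => ⟨k, rfl⟩) (ρ (Fin.natAdd m j))
    rw [Fin.append_left] at hi
    exact absurd hi.symm (hab i j)
  choose t ht using h1
  have htinj : Function.Injective t := by
    intro j k hjk
    apply Fin.natAdd_injective p m
    apply ρ.injective
    rw [ht, ht, hjk]
  have htbij := Finite.injective_iff_bijective.1 htinj
  have h2 : ∀ i, ∃ k, ρ (Fin.castAdd p i) = Fin.castAdd p k := by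
    intro i
    have key : ∀ y, ρ (Fin.castAdd p i) = y → ∃ k, y = Fin.castAdd p k := by
      intro y
      refine Fin.addCases (fun k _ => ⟨k, rfl⟩) (fun k hk => ?_) y
      obtain ⟨j, rfl⟩ := htbij.2 k
      rw [← ht] at hk
      have := congrArg Fin.val (ρ.injective hk)
      rw [Fin.val_castAdd, Fin.val_natAdd] at this
      omega
    exact key _ rfl
  choose s hs using h2
  have hsinj : Function.Injective s := by
    intro j k hjk
    apply Fin.castAdd_injective m p
    apply ρ.injective
    rw [hs, hs, hjk]
  have hsbij := Finite.injective_iff_bijective.1 hsinj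
  refine ⟨⟨Equiv.ofBijective s hsbij, ?_⟩, ⟨Equiv.ofBijective t htbij, ?_⟩⟩
  · funext i
    have hi := congrFun h (Fin.castAdd p i)
    rwa [Fin.append_left, Function.comp_apply, hs, Fin.append_left] at hi
  · funext j
    have hj := congrFun h (Fin.natAdd m j)
    rwa [Fin.append_right, Function.comp_apply, ht, Fin.append_right] at hj

variable {K : Type*} [Field K] {L : Type*} [Ring L] [Algebra K L]

theorem IsQAnti.append_left {q : K} {g : (Fin (m + p) → Fin n) → L} (hg : IsQAnti q g)
    (b : Fin p → Fin n) : IsQAnti q fun a : Fin m → Fin n => g (Fin.append a b) := by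
  intro a σ
  have h := hg (Fin.append a b) (appendPerm σ 1)
  rw [append_comp_appendPerm, sign_appendPerm, inversions_append, inversions_append,
    crossInversions_comp] at h
  have e : b ∘ (1 : Equiv.Perm (Fin p)) = b := rfl
  rw [e, map_one, mul_one] at h
  refine h.trans ?_
  congr 3
  push_cast
  ring

theorem IsQAnti.append_right {q : K} {g : (Fin (m + p) → Fin n) → L} (hg : IsQAnti q g)
    (a : Fin m → Fin n) : IsQAnti q fun b : Fin p → Fin n => g (Fin.append a b) := by
  intro b σ
  have h := hg (Fin.append a b) (appendPerm 1 σ)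
  rw [append_comp_appendPerm, sign_appendPerm, inversions_append, inversions_append,
    crossInversions_comp] at h
  have e : a ∘ (1 : Equiv.Perm (Fin m)) = a := rfl
  rw [e, map_one, one_mul] at h
  refine h.trans ?_
  congr 3
  push_cast
  ring

theorem altSum_comp_strictMono {N : ℕ} {f : Fin n → Fin N} (hf : StrictMono f) (q : K)
    (a b : Fin m → Fin n) : altSum L m N q (f ∘ a) (f ∘ b) = altSum L m n q a b := by
  rw [altSum, altSum, Matrix.sum_apply, Matrix.sum_apply]
  refine Finset.sum_congr rfl fun σ _ => ?_
  rw [Matrix.smul_apply, Matrix.smul_apply, permOp, permOp, Matrix.map_apply, Matrix.map_apply,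
    qPerm, qPerm, Matrix.of_apply, Matrix.of_apply, Function.comp_assoc,
    inversions_comp_strictMono hf, inversions_comp_strictMono hf]
  simp only [(hf.injective.comp_left).eq_iff]

/-- The rows of `m! A_m^q` are products over the two parts of a concatenation. -/
theorem altSum_append {q : K} (hq : q ≠ 0) {a : Fin (m + p) → Fin n} (ha : Function.Injective a)
    {x : Fin m → Fin n} {y : Fin p → Fin n} {ρ : Equiv.Perm (Fin (m + p))}
    (hρ : Fin.append x y = a ∘ ρ) (x' : Fin m → Fin n) (y' : Fin p → Fin n)
    (hxy : ∀ i j, x i ≠ y' j) [CharZero K] :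
    altSum L (m + p) n q a (Fin.append x' y') =
      altSum L p n q y y' * altSum L (m + p) n q a (Fin.append x y) * altSum L m n q x x' := by
  have hinj : Function.Injective (Fin.append x y) := by
    rw [hρ]
    exact ha.comp ρ.injective
  rw [Fin.append_injective_iff] at hinj
  set g := altSum L (m + p) n q a with hg
  have hga : IsQAnti q g := isQAnti_altSum hq a
  -- If both parts are rearrangements, antisymmetry is applied in each part; otherwise both sides
  -- vanish, since rows of `m! A_m^q` are supported on rearrangements.
  by_cases h : (∃ σ : Equiv.Perm (Fin m), x' = x ∘ σ) ∧ ∃ τ : Equiv.Perm (Fin p), y' = y ∘ τ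
  · obtain ⟨⟨σ, rfl⟩, τ, rfl⟩ := h
    rw [(hga.append_left (y ∘ τ)).apply_comp hq hinj.1 σ,
      (hga.append_right x).apply_comp hq hinj.2.1 τ]
    exact (altSum_central q _ _ _).eq
  · have h0 : g (Fin.append x' y') = 0 := by
      by_contra hne
      apply h
      obtain ⟨τ, hτ⟩ := altSum_apply_ne hne
      refine exists_perm_of_append (ρ := τ.trans ρ.symm) hxy ?_
      rw [hτ, hρ]
      funext k
      simp
    rw [h0]
    by_contra hne
    apply h
    have hne := Ne.symm hne
    exact ⟨altSum_apply_ne (right_ne_zero_of_mul hne),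
      altSum_apply_ne (left_ne_zero_of_mul (left_ne_zero_of_mul hne))⟩

end Append

/-! ### Splitting a bracket -/

section Split

variable {m p n : ℕ}

theorem finRange_add (m p : ℕ) : List.finRange (m + p) =
    (List.finRange m).map (Fin.castAdd p) ++ (List.finRange p).map (Fin.natAdd m) := by
  induction p with
  | zero =>
    simp
  | succ p ih =>
    have e : List.finRange (m + (p + 1)) =
      (List.finRange (m + p)).map Fin.castSucc ++ [Fin.last (m + p)] := List.finRange_succ_last
    rw [e, ih, List.finRange_succ_last, List.map_append, List.map_append, List.map_map,
      List.map_map, List.map_map, List.append_assoc]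
    rfl

theorem prod_mul_of_pairwise {M ι : Type*} [Monoid M] (T U : ι → M) (l : List ι)
    (h : l.Pairwise fun i j => Commute (U i) (T j)) :
    (l.map fun i => T i * U i).prod = (l.map T).prod * (l.map U).prod := by
  induction l with
  | nil => simp
  | cons i l ih =>
    rw [List.pairwise_cons] at h
    simp only [List.map_cons, List.prod_cons]
    rw [ih h.2]
    have := commute_list_prod l T (U i) h.1
    rw [mul_assoc, mul_assoc, ← mul_assoc (U i), this.eq, mul_assoc]

variable {L : Type*} [Ring L]

theorem list_prod_apply_of_column {ι α : Type*} [Fintype α] [DecidableEq α] (l : List ι)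
    (Y : ι → Matrix α α L) (b : α)
    (h : ∀ i ∈ l, ∀ c, Y i c b = (1 : Matrix α α L) c b) (Z : Matrix α α L) (a : α) :
    (Z * (l.map Y).prod) a b = Z a b := by
  induction l generalizing Z with
  | nil => simp
  | cons i l ih =>
    rw [List.map_cons, List.prod_cons, ← mul_assoc,
      ih (fun j hj => h j (List.mem_cons_of_mem _ hj)), Matrix.mul_apply,
      Finset.sum_congr rfl fun c _ => by rw [h i List.mem_cons_self c], ← Matrix.mul_apply,
      mul_one]

/-- `R̄ᵗ` acts as the identity on `e_i ⊗ e_j` with `i ≠ j`. This removes the crossings between the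
positions carrying `J` and those carrying indices at most `N`. -/
theorem twoSite_zeroWeight_apply_of_ne (i j : Fin m) (c : Matrix (Fin n) (Fin n) L)
    {b : Fin m → Fin n} (hb : b i ≠ b j) (a : Fin m → Fin n) :
    twoSite i j (zeroWeight c) a b = (1 : Matrix (Fin m → Fin n) (Fin m → Fin n) L) a b := by
  have h0 : ∀ x, ¬ (x ∧ b i = b j) := fun x h => hb h.2
  simp only [twoSite, Matrix.of_apply, zeroWeight_apply, h0, if_false]
  rw [← ite_and, Matrix.one_apply]
  congr 1
  apply propext
  rw [Prod.mk.injEq]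
  constructor
  · rintro ⟨h1, h2, h3⟩
    funext k
    by_cases hk : k = i
    · rw [hk, h2]
    · by_cases hk' : k = j
      · rw [hk', h3]
      · exact h1 k hk hk'
  · rintro rfl
    exact ⟨fun _ _ _ => rfl, rfl, rfl⟩

/-- The factors of the bracket on `m + p` positions that link the two parts. -/
def linkFactor (X : Fin (m + p) → Fin (m + p) → Matrix (Fin n × Fin n) (Fin n × Fin n) L)
    (i : Fin m) : Matrix (Fin (m + p) → Fin n) (Fin (m + p) → Fin n) L :=
  ((List.finRange p).map fun j =>
    twoSite (Fin.castAdd p i) (Fin.natAdd m j) (X (Fin.castAdd p i) (Fin.natAdd m j))).prod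

theorem siteEmb_list_prod {m' : ℕ} {f : Fin m → Fin m'} (hf : Function.Injective f) {ι : Type*}
    (l : List ι) (Y : ι → Matrix (Fin m → Fin n) (Fin m → Fin n) L) :
    siteEmb f (l.map Y).prod = (l.map fun i => siteEmb f (Y i)).prod := by
  rw [← siteEmbHom_apply f hf, map_list_prod, List.map_map]
  rfl

theorem siteEmb_genBracket {m' : ℕ} {f : Fin m → Fin m'} (hf : StrictMono f)
    (T : Fin m' → Matrix (Fin n) (Fin n) L)
    (X : Fin m' → Fin m' → Matrix (Fin n × Fin n) (Fin n × Fin n) L) :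
    siteEmb f (genBracket (fun i => T (f i)) fun i j => X (f i) (f j)) =
      ((List.finRange m).map fun i => oneSite (f i) (T (f i)) *
        ((List.finRange m).map fun j =>
          if f i < f j then twoSite (f i) (f j) (X (f i) (f j)) else 1).prod).prod := by
  rw [genBracket_eq, siteEmb_list_prod hf.injective]
  congr 2
  funext i
  rw [siteEmb_mul hf.injective, siteEmb_oneSite hf.injective, siteEmb_list_prod hf.injective]
  congr 3
  funext j
  simp only [hf.lt_iff_lt]
  split_ifs
  · exact siteEmb_twoSite hf.injective i j _
  · exact siteEmb_one

/-- The crossings from site `i` to the second part share no site with the first-part factors of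
later blocks, so they can all be collected in the middle. -/
theorem genBracket_add (T : Fin (m + p) → Matrix (Fin n) (Fin n) L)
    (X : Fin (m + p) → Fin (m + p) → Matrix (Fin n × Fin n) (Fin n × Fin n) L)
    (hX : ∀ i j a b c, Commute (X i j a b) c) :
    genBracket T X =
      siteEmb (Fin.castAdd p) (genBracket (fun i => T (Fin.castAdd p i)) fun i j =>
        X (Fin.castAdd p i) (Fin.castAdd p j)) *
      ((List.finRange m).map (linkFactor X)).prod *
      siteEmb (Fin.natAdd m) (genBracket (fun i => T (Fin.natAdd m i)) fun i j =>
        X (Fin.natAdd m i) (Fin.natAdd m j)) := by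
  have hlt : ∀ (i : Fin m) (j : Fin p), Fin.castAdd p i < Fin.natAdd m j := fun i j => by
    rw [Fin.lt_def, Fin.val_castAdd, Fin.val_natAdd]
    omega
  rw [siteEmb_genBracket (Fin.strictMono_castAdd p), siteEmb_genBracket (Fin.strictMono_natAdd m),
    genBracket_eq, finRange_add, List.map_append, List.prod_append, List.map_map, List.map_map]
  congr 1
  · rw [← prod_mul_of_pairwise]
    · congr 2
      funext i
      rw [Function.comp_apply, List.map_append, List.prod_append, List.map_map, List.map_map,
        mul_assoc]
      congr 3
      exact List.map_congr_left fun j _ => if_pos (hlt i j)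
    · refine (List.pairwise_lt_finRange m).imp fun {i k} hik => ?_
      have hne : ∀ j : Fin m, k ≤ j → Fin.castAdd p j ≠ Fin.castAdd p i := fun j hj e =>
        (hik.trans_le hj).ne' (Fin.castAdd_injective m p e)
      refine (Commute.symm (commute_list_prod _ _ _ fun j _ => Commute.mul_left ?_
        (Commute.symm (commute_list_prod _ _ _ fun j' _ => ?_))))
      · exact oneSite_commute_twoSite (hlt i j).ne (hne k le_rfl) (hlt k j).ne _ _ (hX _ _)
      · split_ifs with h
        · exact twoSite_commute_twoSite (hlt i j).ne h.ne (hne k le_rfl).symm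
            (hne j' ((Fin.strictMono_castAdd p).lt_iff_lt.1 h).le).symm (hlt k j).ne'
            (hlt j' j).ne' _ _ fun a b c => (hX _ _ a b c)
        · exact Commute.one_right _
  · congr 2
    funext i
    rw [Function.comp_apply, List.map_append, List.prod_append, List.map_map, List.map_map]
    congr 1
    rw [List.prod_eq_one, one_mul]
    · rfl
    · intro Y hY
      obtain ⟨j, -, rfl⟩ := List.mem_map.1 hY
      exact if_neg (hlt j i).not_gt

end Split

/-! ### Factorization of Sklyanin minors -/

section Factorization

variable {K : Type*} [Field K] {A : Type*} [Ring A] [Algebra K A] {m p n N M : ℕ}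

theorem prod_mul_reverse_prod {Λ M : Type*} [Monoid M] {Y Y' : Λ → M} (h : ∀ x, Y x * Y' x = 1)
    (l : List Λ) : (l.map Y).prod * (l.reverse.map Y').prod = 1 := by
  induction l with
  | nil => simp
  | cons x l ih =>
    rw [List.reverse_cons, List.map_append, List.prod_append, List.map_singleton,
      List.prod_singleton, List.map_cons, List.prod_cons, mul_assoc, ← mul_assoc _ _ (Y' x), ih,
      one_mul, h]

theorem genBracket_mul_revBracket {L : Type*} [Ring L] {T T' : Fin m → Matrix (Fin n) (Fin n) L}
    {X X' : Fin m → Fin m → Matrix (Fin n × Fin n) (Fin n × Fin n) L}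
    (hT : ∀ i, T i * T' i = 1) (hX : ∀ i j, X i j * X' i j = 1) :
    genBracket T X * revBracket T' X' = 1 := by
  refine prod_mul_reverse_prod (fun x => ?_) _
  obtain ⟨i, _ | j⟩ := x
  · change oneSiteHom i (T i) * oneSiteHom i (T' i) = 1
    rw [← map_mul, hT, map_one]
  · simp only [bracketFactor]
    split_ifs with h
    · rw [← twoSiteHom_apply i j h.ne, ← twoSiteHom_apply i j h.ne, ← map_mul, hX, map_one]
    · exact mul_one 1

theorem bracket_eq_genBracket (m : ℕ) (q : K) (S : Matrix (Fin n) (Fin n) (PowerSeries A)) :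
    bracket m q S = genBracket (fun i : Fin m => S.map (dilate (q ^ (2 * (i : ℕ)))))
      fun i j => crossOp A n q i j := by
  rw [bracket_eq, genBracket_eq]

theorem genBracket_map {L L' : Type*} [Ring L] [Ring L'] (φ : L →+* L')
    (T : Fin m → Matrix (Fin n) (Fin n) L)
    (X : Fin m → Fin m → Matrix (Fin n × Fin n) (Fin n × Fin n) L) :
    (genBracket T X).map φ = genBracket (fun i => (T i).map φ) fun i j => (X i j).map φ := by
  change φ.mapMatrix (genBracket T X) = _
  rw [genBracket, map_list_prod, List.map_map, genBracket]
  congr 2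
  funext x
  obtain ⟨i, _ | j⟩ := x
  · exact oneSite_map φ i _
  · simp only [Function.comp_apply, bracketFactor]
    split_ifs
    · exact twoSite_map φ i j _
    · exact map_one φ.mapMatrix

theorem crossOp_eq_zeroWeight (n : ℕ) (q : K) (i j : ℕ) :
    ∃ c, crossOp A n q i j = zeroWeight c :=
  ⟨_, zeroWeight_map _ _⟩

theorem bracket_submatrix {f : Fin N → Fin n} (hf : StrictMono f) (q : K)
    (S : Matrix (Fin n) (Fin n) (PowerSeries A)) :
    (bracket m q S).submatrix (f ∘ ·) (f ∘ ·) = bracket m q (S.submatrix f f) := by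
  rw [bracket_eq_genBracket, bracket_eq_genBracket, genBracket_submatrix hf.injective _
    fun i j => crossOp_eq_zeroWeight n q i j]
  congr 1
  funext i j
  exact congrArg (fun Y => Matrix.map Y (scalarHom K A)) (rBarCross_submatrix q _ hf)

/-- Rows of `m! A_m^q` reach only rearrangements of `a`, so intermediate tuples stay in the image of
`f`, and there the bracket compresses. -/
theorem sklyaninMinor_submatrix [CharZero K] {f : Fin N → Fin n} (hf : StrictMono f) (q : K)
    (S : Matrix (Fin n) (Fin n) (PowerSeries A)) (a b : Fin m → Fin N) :
    sklyaninMinor q (S.submatrix f f) a b = sklyaninMinor q S (f ∘ a) (f ∘ b) := by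
  rw [sklyaninMinor_eq, sklyaninMinor_eq, Matrix.mul_apply, Matrix.mul_apply]
  refine Finset.sum_of_injOn (fun c => f ∘ c) (comp_left_injective hf.injective).injOn
    (fun c _ => Finset.mem_coe.2 (Finset.mem_univ _)) ?_ ?_
  · intro c _ hc
    by_contra hne
    obtain ⟨τ, hτ⟩ := altSum_apply_ne (left_ne_zero_of_mul hne)
    exact hc ⟨a ∘ τ, Finset.mem_coe.2 (Finset.mem_univ _), hτ.symm⟩
  · intro c _
    rw [altSum_comp_strictMono hf, ← bracket_submatrix hf q S]
    rfl

theorem sdetOn_eq [CharZero K] (q : K) (S : Matrix (Fin n) (Fin n) (PowerSeries A))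
    {I : Finset (Fin n)} {a : Fin m → Fin n} (ha : StrictMono a)
    (hI : Finset.univ.image a = I) : sdetOn q S I = sklyaninMinor q S a a := by
  have hc : I.card = m := by
    rw [← hI, Finset.card_image_of_injective _ ha.injective, Finset.card_univ, Fintype.card_fin]
  subst hc
  have e : a = I.orderEmbOfFin rfl := Finset.orderEmbOfFin_unique rfl
    (fun x => by
      have : a x ∈ Finset.univ.image a := Finset.mem_image_of_mem _ (Finset.mem_univ _)
      rwa [hI] at this) ha
  rw [sdetOn, sdet, sklyaninMinor_submatrix (OrderEmbedding.strictMono _), ← e]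
  rfl

theorem map_dilate_dilate (S : Matrix (Fin n) (Fin n) (PowerSeries A)) (c d : K) :
    (S.map (dilate c)).map (dilate d) = S.map (dilate (c * d)) := by
  refine Matrix.ext fun i j => ?_
  simp only [Matrix.map_apply, dilate_dilate]
  congr 1
  ring

theorem row_eq_sum {α L : Type*} [Fintype α] [DecidableEq α] [Ring L] {F F' : Matrix α α L}
    (h : F * F' = 1) {y z : α → L} (hz : ∀ c, z c = ∑ d, y d * F d c) (d : α) :
    y d = ∑ c, z c * F' c d := by
  have hz' : z = Matrix.vecMul y F := funext hz
  have h1 : Matrix.vecMul z F' = y := by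
    rw [hz', Matrix.vecMul_vecMul, h, Matrix.vecMul_one]
  exact (congrFun h1 d).symm

/-- The factor of a bracket on `m + p` positions that comes from the last `p` positions. -/
theorem exists_inverse_tail {q : K} (hq : q ≠ 0)
    {S S' : Matrix (Fin (N + M)) (Fin (N + M)) (PowerSeries A)} (h1 : S * S' = 1)
    {σ : Matrix (Fin N) (Fin N) (PowerSeries A)}
    (hσ : S'.submatrix (Fin.castAdd M) (Fin.castAdd M) * σ = 1) (p : ℕ) :
    ∃ F' : Matrix (Fin p → Fin (N + M)) (Fin p → Fin (N + M)) (PowerSeries A),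
      genBracket (fun i : Fin p => S.map (dilate (q ^ (2 * (M + (i : ℕ))))))
        (fun i j => crossOp A (N + M) q (M + i) (M + j)) * F' = 1 ∧
      F'.submatrix (Fin.castAdd M ∘ ·) (Fin.castAdd M ∘ ·) *
        (bracket p q (σ.map (dilate (q ^ M)))).map (dilate (q ^ M)) = 1 := by
  have hG : ∀ i j : Fin p, ∃ G, G * rBarCross (N + M) q (siteArg q (M + i) (M + j)) = 1 ∧
      rBarCross (N + M) q (siteArg q (M + i) (M + j)) * G = 1 := fun i j => by
    obtain ⟨u, hu⟩ := isUnit_rBarCross hq (N + M) (isSmall_siteArg q (M + i) (M + j))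
    exact ⟨(u⁻¹).val, by rw [← hu, Units.inv_mul], by rw [← hu, Units.mul_inv]⟩
  choose G hG1 hG2 using hG
  have hmap : ∀ {n : ℕ} (c : K) {Y Z : Matrix (Fin n) (Fin n) (PowerSeries A)}, Y * Z = 1 →
      Y.map (dilate c) * Z.map (dilate c) = 1 := fun c Y Z h => by
    have := congrArg (dilateHom c).mapMatrix h
    rwa [map_mul, map_one] at this
  have hs : ∀ {ι : Type} [Fintype ι] [DecidableEq ι] {Y Z : Matrix ι ι (PowerSeries K)},
      Y * Z = 1 → Y.map (scalarHom K A) * Z.map (scalarHom K A) = 1 := fun {_ _ _ Y Z} h => by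
    have := congrArg (scalarHom K A).mapMatrix h
    rwa [map_mul, map_one] at this
  -- The inverse of the tail is the reversed product of inverses. Its compression is the reversed
  -- product of compressed inverses, hence inverse to a bracket built from `σ`.
  refine ⟨revBracket (fun i => S'.map (dilate (q ^ (2 * (M + (i : ℕ))))))
    fun i j => (G i j).map (scalarHom K A), ?_, ?_⟩
  · exact genBracket_mul_revBracket (fun i => hmap _ h1) fun i j => hs (hG2 i j)
  · rw [revBracket_submatrix (Fin.castAdd_injective N M), bracket_eq_genBracket]
    · change _ * (genBracket _ _).map (dilateHom (q ^ M)) = 1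
      rw [genBracket_map]
      refine revBracket_mul_genBracket (fun i => ?_) fun i j => ?_
      · have := hmap (q ^ (2 * (M + (i : ℕ)))) hσ
        have e : ((σ.map (dilate (q ^ M))).map (dilate (q ^ (2 * (i : ℕ))))).map
            (dilateHom (q ^ M)) = σ.map (dilate (q ^ (2 * (M + (i : ℕ))))) := by
          change ((σ.map (dilate (q ^ M))).map (dilate (q ^ (2 * (i : ℕ))))).map
            (dilate (q ^ M)) = _
          rw [map_dilate_dilate, map_dilate_dilate]
          congr 2
          ring
        rw [e]
        exact this
      · have h3 := (submatrix_inverse_mul_rBarCross hq N M (isSmall_siteArg q (M + i) (M + j))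
          (hG1 i j)).2
        have e : (crossOp A N q i j).map (dilateHom (q ^ M)) =
            (rBarCross N q ((q⁻¹ ^ (2 * M)) • siteArg q (M + i) (M + j))).map (scalarHom K A) := by
          change (crossOp A N q i j).map (dilate (q ^ M)) = _
          rw [mapMatrix_dilate_crossOp, ← siteArg_shift, smul_smul]
          -- Shifting both positions by `M` multiplies the argument of `R̄ᵗ` by `q^{4M}` and
          -- crossing by `q^{-2M}`, which leaves the effect of dilating by `q^M` only. The matrix
          -- `σ` needs `q^{2M}`, whence a second dilation inside the bracket.
          have e' : q⁻¹ ^ (2 * M) * (q ^ (2 * M)) ^ 2 = (q ^ M) ^ 2 := by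
            rw [inv_pow, pow_two, ← mul_assoc, inv_mul_cancel₀ (pow_ne_zero _ hq), one_mul]
            ring
          rw [e']
        rw [e]
        exact hs h3
    · intro i j
      obtain ⟨g, hg⟩ := (submatrix_inverse_mul_rBarCross hq N M
        (isSmall_siteArg q (M + i) (M + j)) (hG1 i j)).1
      exact ⟨_, by rw [hg, zeroWeight_map]⟩

theorem altSum_map {L L' : Type*} [Ring L] [Algebra K L] [Ring L'] [Algebra K L'] (φ : L →+* L')
    (hφ : ∀ c : K, φ (algebraMap K L c) = algebraMap K L' c) (q : K) (a b : Fin m → Fin n) :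
    φ (altSum L m n q a b) = altSum L' m n q a b := by
  rw [altSum, altSum, Matrix.sum_apply, Matrix.sum_apply, map_sum]
  refine Finset.sum_congr rfl fun σ _ => ?_
  rw [Matrix.smul_apply, Matrix.smul_apply, map_zsmul, permOp, permOp, Matrix.map_apply,
    Matrix.map_apply, hφ]

/-- The coefficient is a sign times a power of `q`. Antisymmetry expresses `1` as a scalar multiple
of it, so it can be cancelled. -/
theorem eq_of_altSum_mul_eq {L : Type*} [Ring L] [Algebra K L] {q : K} (hq : q ≠ 0)
    {a : Fin m → Fin n} (ha : Function.Injective a) (ρ : Equiv.Perm (Fin m)) {x y : L}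
    (h : altSum L m n q a (a ∘ ρ) * x = altSum L m n q a (a ∘ ρ) * y) : x = y := by
  have h1 := isQAnti_altSum (L := L) hq a (a ∘ ρ) ρ.symm
  have e : (a ∘ ρ) ∘ ρ.symm = a := by
    funext k
    simp
  rw [e, altSum_apply_self ha] at h1
  rw [← one_mul x, ← one_mul y, h1, smul_mul_assoc, smul_mul_assoc, smul_mul_assoc,
    smul_mul_assoc, h]

/-- The Sklyanin minor on `I ∪ J`, with `J` the set of the last `M` indices. -/
theorem sklyaninMinor_union [CharZero K] {q : K} (hq : q ≠ 0)
    {S S' : Matrix (Fin (N + M)) (Fin (N + M)) (PowerSeries A)} (h1 : S * S' = 1) (h2 : S' * S = 1)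
    (hF : IsFused q S) {σ : Matrix (Fin N) (Fin N) (PowerSeries A)}
    (hσ : S'.submatrix (Fin.castAdd M) (Fin.castAdd M) * σ = 1)
    {I : Fin p → Fin N} {a : Fin (M + p) → Fin (N + M)}
    (ha : Function.Injective a) {ρ : Equiv.Perm (Fin (M + p))}
    (hρ : Fin.append (Fin.natAdd N) (Fin.castAdd M ∘ I) = a ∘ ρ) :
    sklyaninMinor q S a a = sklyaninMinor q S (Fin.natAdd N) (Fin.natAdd N) *
      dilate (q ^ M) (sklyaninMinor q (σ.map (dilate (q ^ M))) I I) := by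
  obtain ⟨F', hF1, hF2⟩ := exists_inverse_tail hq h1 hσ p
  set F := genBracket (fun i : Fin p => S.map (dilate (q ^ (2 * (M + (i : ℕ))))))
        (fun i j => crossOp A (N + M) q (M + i) (M + j)) with hFdef
  set E := altSum (PowerSeries A) (M + p) (N + M) q with hE
  set W := E * bracket (M + p) q S with hW
  set ι : (Fin p → Fin N) → (Fin p → Fin (N + M)) := fun c => Fin.castAdd M ∘ c with hι
  set J : Fin M → Fin (N + M) := Fin.natAdd N with hJ
  have hιinj : Function.Injective ι := comp_left_injective (Fin.castAdd_injective N M)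
  have hJI : ∀ i (j : Fin N), J i ≠ Fin.castAdd M j := fun i j e => by
    have := congrArg Fin.val e
    rw [hJ, Fin.val_castAdd, Fin.val_natAdd] at this
    omega
  have hWanti : IsQAnti q (W a) := isQAnti_altSum_mul hq
    (fun k l hkl => push_bracket hq ⟨⟨S, S', h1, h2⟩, rfl⟩ hF hkl) a
  set C := ((List.finRange M).map (linkFactor (n := N + M) (p := p)
    fun i j => crossOp A (N + M) q i j)).prod with hC
  set Y := E * siteEmb (Fin.castAdd p) (bracket M q S) * C with hY
  -- The bracket is split with the `J`-positions first: `Y` collects the antisymmetrizer, the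
  -- bracket on these positions and the linking crossings, while `F` is the tail.
  have hWY : W = Y * siteEmb (Fin.natAdd M) F := by
    rw [hW, hY, mul_assoc, mul_assoc, ← mul_assoc (siteEmb _ _), bracket_eq_genBracket,
      genBracket_add _ _ fun i j => crossOp_central _ _ _ _, bracket_eq_genBracket]
    rfl
  have hz : ∀ c, W a (Fin.append J c) = ∑ d, Y a (Fin.append J d) * F d c := by
    intro c
    rw [hWY, mul_siteEmb_apply (Fin.natAdd_injective p M)]
    simp only [extend_natAdd_append, append_comp_natAdd]
  have hy : ∀ d, Y a (Fin.append J d) = ∑ c, W a (Fin.append J c) * F' c d :=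
    row_eq_sum hF1 hz
  -- Such a `c` repeats an index of `J`, and `W` is antisymmetric.
  have hz0 : ∀ c, c ∉ Set.range ι → W a (Fin.append J c) = 0 := by
    intro c hc
    refine hWanti.apply_eq_zero fun hinj => hc ?_
    rw [Fin.append_injective_iff] at hinj
    refine (forall_mem_range_iff (Fin.castAdd M) c).1 fun k => ?_
    have key : ∀ y, c k = y → y ∈ Set.range (Fin.castAdd (n := N) M) := by
      intro y
      refine Fin.addCases (fun i _ => ⟨i, rfl⟩) (fun i hi => ?_) y
      exact absurd hi.symm (hinj.2.2 i k)
    exact key _ rfl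
  -- After inverting the tail, both indices of `F'` are restricted to the first `N` basis vectors,
  -- so only its compression enters.
  have hy' : ∀ d, Y a (Fin.append J (ι d)) =
      ∑ c, W a (Fin.append J (ι c)) * F' (ι c) (ι d) := by
    intro d
    rw [hy]
    symm
    refine Finset.sum_of_injOn ι hιinj.injOn (fun c _ => Finset.mem_coe.2 (Finset.mem_univ _)) ?_
      fun _ _ => rfl
    intro c _ hc
    rw [hz0 c fun ⟨d, hd⟩ => hc ⟨d, Finset.mem_coe.2 (Finset.mem_univ _), hd⟩, zero_mul]
  -- Inverting the compressed `F'` brings in the bracket of the dilated `σ` in place of the tail.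
  have hzI : W a (Fin.append J (ι I)) = ∑ d, Y a (Fin.append J (ι d)) *
      (bracket p q (σ.map (dilate (q ^ M)))).map (dilate (q ^ M)) d I :=
    row_eq_sum hF2 hy' I
  -- The tuples `J` and `ι d` are disjoint, so the linking crossings disappear and the row of the
  -- antisymmetrizer factors over the two parts.
  have hyE : ∀ d, Y a (Fin.append J (ι d)) = altSum (PowerSeries A) p N q I d *
      E a (Fin.append J (ι I)) * sklyaninMinor q S J J := by
    intro d
    rw [hY, hC, list_prod_apply_of_column, mul_siteEmb_apply (Fin.castAdd_injective M p),
      sklyaninMinor_eq, Matrix.mul_apply, Finset.mul_sum]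
    · refine Finset.sum_congr rfl fun c _ => ?_
      have h5 : altSum (PowerSeries A) p (N + M) q (Fin.castAdd M ∘ I) (ι d) =
        altSum (PowerSeries A) p N q I d := altSum_comp_strictMono (Fin.strictMono_castAdd M) q I d
      rw [extend_castAdd_append, append_comp_castAdd, ← mul_assoc,
        hE, altSum_append hq ha hρ c (ι d) fun i j => hJI i (d j), h5]
    · intro i _ c
      have := list_prod_apply_of_column (List.finRange p) (fun j =>
        twoSite (Fin.castAdd p i) (Fin.natAdd M j)
          (crossOp A (N + M) q (Fin.castAdd p i : Fin (M + p)) (Fin.natAdd M j : Fin (M + p))))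
        (Fin.append J (ι d)) (fun j _ c => ?_) 1 c
      · rwa [one_mul] at this
      · obtain ⟨w, hw⟩ := crossOp_eq_zeroWeight (A := A) (N + M) q
          (Fin.castAdd p i : Fin (M + p)) (Fin.natAdd M j : Fin (M + p))
        rw [hw]
        refine twoSite_zeroWeight_apply_of_ne _ _ _ ?_ c
        rw [Fin.append_left, Fin.append_right]
        exact hJI i (d j)
  have hs : W a (Fin.append J (ι I)) = E a (Fin.append J (ι I)) * W a a := by
    have := hWanti.apply_comp hq ha ρ
    rwa [← hρ] at this
  have hdil : dilate (q ^ M) (sklyaninMinor q (σ.map (dilate (q ^ M))) I I) =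
      ∑ d, altSum (PowerSeries A) p N q I d *
        (bracket p q (σ.map (dilate (q ^ M)))).map (dilate (q ^ M)) d I := by
    rw [sklyaninMinor_eq, Matrix.mul_apply]
    change dilateHom (q ^ M) _ = _
    rw [map_sum]
    refine Finset.sum_congr rfl fun d _ => ?_
    have h6 := altSum_map (n := N) (dilateHom (A := A) (q ^ M)) (fun c : K => by
      rw [Algebra.algebraMap_eq_smul_one]
      exact (dilate_smul _ _ _).trans (congrArg (c • ·) (map_one (dilateHom (q ^ M))))) q I d
    rw [map_mul, h6]
    rfl
  rw [sklyaninMinor_eq]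
  refine eq_of_altSum_mul_eq hq ha ρ ?_
  rw [← hρ, ← hE]
  refine hs.symm.trans (hzI.trans ?_)
  rw [hdil, Finset.mul_sum, Finset.mul_sum]
  refine Finset.sum_congr rfl fun d _ => ?_
  rw [hyE, mul_assoc _ (E _ _), (altSum_central q I d _).eq]
  simp only [mul_assoc]
  rfl

end Factorization

/-! ### The reflection equation -/

section Reflection

variable {L : Type*} [Ring L] {n N : ℕ}

/-- On two positions the products in the reflection equation are a bracket and a reversed bracket,
so the compression results for brackets apply to it. -/
theorem genBracket_two (T : Fin 2 → Matrix (Fin n) (Fin n) L)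
    (X : Matrix (Fin n × Fin n) (Fin n × Fin n) L) :
    genBracket T (fun _ _ => X) = oneSite 0 (T 0) * twoSite 0 1 X * oneSite 1 (T 1) := by
  rw [genBracket_eq]
  simp [List.finRange_succ]

theorem revBracket_two (T : Fin 2 → Matrix (Fin n) (Fin n) L)
    (X : Matrix (Fin n × Fin n) (Fin n × Fin n) L) :
    revBracket T (fun _ _ => X) = oneSite 1 (T 1) * twoSite 0 1 X * oneSite 0 (T 0) := by
  rw [revBracket]
  simp [List.finRange_succ, bracketLabels, bracketFactor, mul_assoc]

/-- The reflection equation with arbitrary operators in place of `R` and `Rᵗ`. -/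
def IsReflection (R Q : Matrix (Fin n × Fin n) (Fin n × Fin n) L)
    (s s' : Matrix (Fin n) (Fin n) L) : Prop :=
  twoSite (m := 2) 0 1 R * (oneSite 0 s * twoSite 0 1 Q * oneSite 1 s') =
    oneSite 1 s' * twoSite 0 1 Q * oneSite 0 s * twoSite 0 1 R

/-- Every non-zero entry of the operator has the same indices in its row and in its column. -/
def PreservesContent (R : Matrix (Fin n × Fin n) (Fin n × Fin n) L) : Prop :=
  ∀ a b, R a b ≠ 0 → a = b ∨ (a.1 = b.2 ∧ a.2 = b.1)

theorem PreservesContent.forall_mem {R : Matrix (Fin n × Fin n) (Fin n × Fin n) L}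
    (hR : PreservesContent R) (I : Set (Fin n)) {a b : Fin 2 → Fin n}
    (h : twoSite (m := 2) 0 1 R a b ≠ 0) : (∀ k, a k ∈ I) ↔ ∀ k, b k ∈ I := by
  rw [twoSite, Matrix.of_apply] at h
  have h' : R (a 0, a 1) (b 0, b 1) ≠ 0 := by
    intro e
    rw [e, ite_self] at h
    exact h rfl
  rw [Fin.forall_fin_two, Fin.forall_fin_two]
  rcases hR _ _ h' with e | ⟨e1, e2⟩
  · rw [Prod.mk.injEq] at e
    rw [e.1, e.2]
  · simp only at e1 e2
    rw [e1, e2, and_comm]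

/-- `R` at most exchanges the two indices, so it never links a tuple inside the image of `f` with
one outside. -/
theorem PreservesContent.submatrix_mul {R : Matrix (Fin n × Fin n) (Fin n × Fin n) L}
    (hR : PreservesContent R) {f : Fin N → Fin n} (hf : Function.Injective f)
    (Z : Matrix (Fin 2 → Fin n) (Fin 2 → Fin n) L) :
    (twoSite 0 1 R * Z).submatrix (f ∘ ·) (f ∘ ·) =
      twoSite 0 1 (R.submatrix (Prod.map f f) (Prod.map f f)) *
        Z.submatrix (f ∘ ·) (f ∘ ·) := by
  rw [← twoSite_submatrix hf]
  ext a b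
  rw [Matrix.submatrix_apply, Matrix.mul_apply, Matrix.mul_apply]
  symm
  refine Finset.sum_of_injOn (f ∘ ·) (comp_left_injective hf).injOn
    (fun _ _ => Finset.mem_coe.2 (Finset.mem_univ _)) ?_ fun _ _ => rfl
  intro c _ hc
  by_contra hne
  obtain ⟨d, hd⟩ := (forall_mem_range_iff f c).1
    ((hR.forall_mem (Set.range f) (left_ne_zero_of_mul hne)).1 fun k => ⟨a k, rfl⟩)
  exact hc ⟨d, Finset.mem_coe.2 (Finset.mem_univ _), hd⟩

theorem PreservesContent.mul_submatrix {R : Matrix (Fin n × Fin n) (Fin n × Fin n) L}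
    (hR : PreservesContent R) {f : Fin N → Fin n} (hf : Function.Injective f)
    (Z : Matrix (Fin 2 → Fin n) (Fin 2 → Fin n) L) :
    (Z * twoSite 0 1 R).submatrix (f ∘ ·) (f ∘ ·) =
      Z.submatrix (f ∘ ·) (f ∘ ·) *
        twoSite 0 1 (R.submatrix (Prod.map f f) (Prod.map f f)) := by
  rw [← twoSite_submatrix hf]
  ext a b
  rw [Matrix.submatrix_apply, Matrix.mul_apply, Matrix.mul_apply]
  symm
  refine Finset.sum_of_injOn (f ∘ ·) (comp_left_injective hf).injOn
    (fun _ _ => Finset.mem_coe.2 (Finset.mem_univ _)) ?_ fun _ _ => rfl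
  intro c _ hc
  by_contra hne
  obtain ⟨d, hd⟩ := (forall_mem_range_iff f c).1
    ((hR.forall_mem (Set.range f) (right_ne_zero_of_mul hne)).2 fun k => ⟨b k, rfl⟩)
  exact hc ⟨d, Finset.mem_coe.2 (Finset.mem_univ _), hd⟩

variable {R Q : Matrix (Fin n × Fin n) (Fin n × Fin n) L} {s s' : Matrix (Fin n) (Fin n) L}

theorem gen_submatrix_two (hQ : ∃ c, Q = zeroWeight c) {f : Fin N → Fin n}
    (hf : Function.Injective f) :
    (oneSite 0 s * twoSite 0 1 Q * oneSite (1 : Fin 2) s').submatrix (f ∘ ·) (f ∘ ·) =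
      oneSite 0 (s.submatrix f f) * twoSite 0 1 (Q.submatrix (Prod.map f f) (Prod.map f f)) *
        oneSite 1 (s'.submatrix f f) := by
  have := genBracket_submatrix hf ![s, s'] (X := fun _ _ => Q) fun _ _ => hQ
  rwa [genBracket_two, genBracket_two] at this

theorem rev_submatrix_two (hQ : ∃ c, Q = zeroWeight c) {f : Fin N → Fin n}
    (hf : Function.Injective f) :
    (oneSite 1 s' * twoSite 0 1 Q * oneSite (0 : Fin 2) s).submatrix (f ∘ ·) (f ∘ ·) =
      oneSite 1 (s'.submatrix f f) * twoSite 0 1 (Q.submatrix (Prod.map f f) (Prod.map f f)) *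
        oneSite 0 (s.submatrix f f) := by
  have := revBracket_submatrix hf ![s, s'] (X := fun _ _ => Q) fun _ _ => hQ
  rwa [revBracket_two, revBracket_two] at this

theorem IsReflection.submatrix (h : IsReflection R Q s s') (hR : PreservesContent R)
    (hQ : ∃ c, Q = zeroWeight c) {f : Fin N → Fin n} (hf : Function.Injective f) :
    IsReflection (R.submatrix (Prod.map f f) (Prod.map f f))
      (Q.submatrix (Prod.map f f) (Prod.map f f)) (s.submatrix f f) (s'.submatrix f f) := by
  have h1 := congrArg (fun Z => Matrix.submatrix Z (f ∘ ·) (f ∘ ·)) h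
  simp only at h1
  rwa [hR.submatrix_mul hf, hR.mul_submatrix hf, gen_submatrix_two hQ hf,
    rev_submatrix_two hQ hf] at h1

theorem three_mul_three {n : ℕ} {i j : Fin 2} {P Q : Matrix (Fin n × Fin n) (Fin n × Fin n) L}
    {t t' s s' : Matrix (Fin n) (Fin n) L} (h1 : t * s = 1) (h2 : P * Q = 1) (h3 : t' * s' = 1) :
    oneSite i t * twoSite 0 1 P * oneSite j t' *
      (oneSite j s' * twoSite 0 1 Q * oneSite i s) = 1 := by
  have e1 : oneSite i t * oneSite i s = 1 := by
    rw [← oneSiteHom_apply, ← oneSiteHom_apply, ← map_mul, h1, map_one]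
  have e3 : oneSite j t' * oneSite j s' = 1 := by
    rw [← oneSiteHom_apply, ← oneSiteHom_apply, ← map_mul, h3, map_one]
  have e2 : twoSite (0 : Fin 2) 1 P * twoSite 0 1 Q = 1 := by
    rw [← twoSiteHom_apply 0 1 zero_ne_one, ← twoSiteHom_apply 0 1 zero_ne_one, ← map_mul, h2,
      map_one]
  calc _ = oneSite i t * (twoSite 0 1 P * (oneSite j t' * oneSite j s') * twoSite 0 1 Q) *
        oneSite i s := by simp only [mul_assoc]
    _ = 1 := by rw [e3, mul_one, e2, mul_one, e1]

/-- The reflection equation for a Schur complement. -/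
theorem IsReflection.schur (h : IsReflection R Q s s') (hR : PreservesContent R)
    {f : Fin N → Fin n} (hf : Function.Injective f)
    {t t' : Matrix (Fin n) (Fin n) L} {P : Matrix (Fin n × Fin n) (Fin n × Fin n) L}
    (hst : s * t = 1) (hts : t * s = 1) (hst' : s' * t' = 1) (hts' : t' * s' = 1)
    (hPQ : P * Q = 1) (hQP : Q * P = 1) (hP : ∃ c, P = zeroWeight c)
    {r r' : Matrix (Fin N) (Fin N) L} {Q' : Matrix (Fin N × Fin N) (Fin N × Fin N) L}
    (h1 : t.submatrix f f * r = 1) (h2 : r * t.submatrix f f = 1)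
    (h1' : t'.submatrix f f * r' = 1) (h2' : r' * t'.submatrix f f = 1)
    (h3 : P.submatrix (Prod.map f f) (Prod.map f f) * Q' = 1)
    (h4 : Q' * P.submatrix (Prod.map f f) (Prod.map f f) = 1) :
    IsReflection (R.submatrix (Prod.map f f) (Prod.map f f)) Q' r r' := by
  have key : ∀ {α : Type _} [Monoid α] {R X Y X' Y' : α}, R * X = Y * R → Y' * Y = 1 →
      X * X' = 1 → Y' * R = R * X' := fun {α _ R X Y X' Y'} h hY hX => by
    calc Y' * R = Y' * (R * X) * X' := by rw [mul_assoc, mul_assoc, hX, mul_one]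
      _ = R * X' := by rw [h, ← mul_assoc, hY, one_mul]
  -- The equation is inverted, then compressed, and the compressed equation is inverted back. Each
  -- inversion interchanges the bracket and the reversed bracket, so the original form returns.
  have e := key h (three_mul_three hts hPQ hts') (three_mul_three hst hQP hst')
  have e' := congrArg (fun Z => Matrix.submatrix Z (f ∘ ·) (f ∘ ·)) e
  simp only at e'
  rw [hR.submatrix_mul hf, hR.mul_submatrix hf, gen_submatrix_two hP hf,
    rev_submatrix_two hP hf] at e'
  exact (key e'.symm (three_mul_three h2' h4 h2) (three_mul_three h1' h3 h1)).symm

theorem IsReflection.map {L' : Type*} [Ring L'] (φ : L →+* L') (h : IsReflection R Q s s') :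
    IsReflection (R.map φ) (Q.map φ) (s.map φ) (s'.map φ) := by
  have h1 := congrArg φ.mapMatrix h
  simp only [map_mul] at h1
  have e1 : ∀ X, φ.mapMatrix (twoSite (n := n) (0 : Fin 2) 1 X) = twoSite 0 1 (X.map φ) :=
    fun X => twoSite_map φ 0 1 X
  have e2 : ∀ (i : Fin 2) X, φ.mapMatrix (oneSite (n := n) i X) = oneSite i (X.map φ) :=
    fun i X => oneSite_map φ i X
  simp only [e1, e2] at h1
  exact h1

theorem mul_smul_of_central {ι : Type*} [Fintype ι] {c : L} (hc : ∀ x, Commute c x)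
    (Y Z : Matrix ι ι L) : Y * (c • Z) = c • (Y * Z) := by
  ext a b
  rw [Matrix.smul_apply, Matrix.mul_apply, Matrix.mul_apply, Finset.smul_sum]
  refine Finset.sum_congr rfl fun d _ => ?_
  rw [Matrix.smul_apply, smul_eq_mul, smul_eq_mul, ← mul_assoc, ← mul_assoc, (hc _).eq]

/-- Cancellation suffices here: the scalars removed include multiples of a series variable, which
are not invertible. -/
theorem IsReflection.of_smul_left {c : L} (hc : ∀ x, Commute c x) (hc' : IsLeftRegular c)
    (h : IsReflection (c • R) Q s s') : IsReflection R Q s s' := by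
  rw [IsReflection, twoSite_smul, smul_mul_assoc, mul_smul_of_central hc] at h
  refine Matrix.ext fun a b => hc' ?_
  exact congrFun (congrFun h a) b

theorem isReflection_smul_right_iff {c : L} (hc : ∀ x, Commute c x) (hc' : IsLeftRegular c) :
    IsReflection R (c • Q) s s' ↔ IsReflection R Q s s' := by
  rw [IsReflection, IsReflection, twoSite_smul, mul_smul_of_central hc, mul_smul_of_central hc,
    smul_mul_assoc, smul_mul_assoc, smul_mul_assoc, mul_smul_of_central hc]
  constructor
  · intro h
    refine Matrix.ext fun a b => hc' ?_
    exact congrFun (congrFun h a) b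
  · intro h
    rw [h]

end Reflection

/-! ### Functoriality of the `R`-matrix and its degeneration at `u = q² v`. -/

section RMatrix

variable {K : Type*} [Field K] {L : Type*} [Ring L] [Algebra K L] {n N : ℕ}

theorem rMatrix_map {L' : Type*} [Ring L'] [Algebra K L'] (φ : L →+* L')
    (hφ : ∀ (c : K) y, φ (c • y) = c • φ y) (q : K) (u v : L) :
    (rMatrix n q u v).map φ = rMatrix n q (φ u) (φ v) := by
  refine Matrix.ext fun a b => ?_
  simp only [rMatrix, Matrix.map_apply, Matrix.of_apply]
  split_ifs <;> simp [hφ]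

theorem rMatrix_submatrix {f : Fin N → Fin n} (hf : StrictMono f) (q : K) (u v : L) :
    (rMatrix n q u v).submatrix (Prod.map f f) (Prod.map f f) = rMatrix N q u v := by
  refine Matrix.ext fun a b => ?_
  simp only [rMatrix, Matrix.submatrix_apply, Matrix.of_apply, Prod.map_fst, Prod.map_snd,
    hf.injective.eq_iff, hf.lt_iff_lt, (hf.injective.prodMap hf.injective).eq_iff]

theorem rMatrix_smul (q c : K) (u v : L) :
    rMatrix n q (c • u) (c • v) = c • rMatrix n q u v := by
  refine Matrix.ext fun a b => ?_
  simp only [rMatrix, Matrix.smul_apply, Matrix.of_apply]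
  split_ifs
  · rw [smul_sub, smul_comm c, smul_comm c]
  · rw [smul_sub]
  · rw [smul_comm]
  · rw [smul_comm]
  · rw [smul_zero]

theorem preservesContent_rMatrix (q : K) (u v : L) : PreservesContent (rMatrix n q u v) := by
  intro a b h
  by_contra hne
  rw [not_or] at hne
  exact h (by rw [rMatrix, Matrix.of_apply, if_neg hne.1, if_neg hne.2])

/-- At this point the coefficient `q⁻¹ u - q v` on `e_i ⊗ e_i` vanishes, and the `R`-matrix
degenerates to a multiple of `1 - P^q`. -/
theorem rMatrix_fused {q : K} (hq : q ≠ 0) (n : ℕ) (v : L) :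
    rMatrix n q (q ^ 2 • v) v = ((q ^ 2 - 1) • v) • (1 - (qFlip n q).map (algebraMap K L)) := by
  refine Matrix.ext fun a b => ?_
  obtain ⟨a1, a2⟩ := a
  obtain ⟨b1, b2⟩ := b
  have h1 : q⁻¹ * q ^ 2 - q = 0 := by
    field_simp
    simp
  have h2 : (q⁻¹ - q) * q ^ 2 = -((q ^ 2 - 1) * q) := by
    field_simp
    ring
  have h3 : q⁻¹ - q = -((q ^ 2 - 1) * q⁻¹) := by
    field_simp
    ring
  have h4 : ∀ c : K, v * algebraMap K L c = c • v := fun c => by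
    rw [Algebra.smul_def, Algebra.commutes]
  have h5 : ∀ c : K, ((q ^ 2 - 1) • v) * (0 - algebraMap K L c) = (-((q ^ 2 - 1) * c)) • v :=
    fun c => by rw [zero_sub, mul_neg, smul_mul_assoc, h4, smul_smul, neg_smul]
  simp only [rMatrix, qFlip, Matrix.smul_apply, Matrix.sub_apply, Matrix.map_apply,
    Matrix.of_apply, Matrix.one_apply, Prod.mk.injEq, smul_eq_mul]
  by_cases hd : a1 = b1 ∧ a2 = b2
  · obtain ⟨rfl, rfl⟩ := hd
    by_cases he : a1 = a2
    · subst he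
      simp [smul_smul, ← sub_smul, h1]
    · simp [he, sub_smul]
  · by_cases hf : a1 = b2 ∧ a2 = b1
    · obtain ⟨rfl, rfl⟩ := hf
      have he : a1 ≠ a2 := by
        rintro rfl
        exact hd ⟨rfl, rfl⟩
      rw [if_neg hd, if_neg hd]
      simp only [and_self, if_true, if_neg he]
      split_ifs
      · rw [h5, smul_smul, h2]
      · rw [h5, h3]
    · rw [if_neg hd, if_neg hd, if_neg hf, if_neg hf, map_zero, sub_zero, mul_zero]

end RMatrix

/-! ### The reflection equation over power series: fusion, submatrices and Schur complements. -/

section Series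

variable {K : Type*} [Field K] {A : Type*} [Ring A] [Algebra K A] {n N M : ℕ}

variable (K A) in
/-- The inclusion of double power series with scalar coefficients. -/
noncomputable def scalarHom₂ : PowerSeries (PowerSeries K) →+* PowerSeries (PowerSeries A) :=
  PowerSeries.map (scalarHom K A)

theorem isCentralHom_scalarHom₂ : IsCentralHom (scalarHom₂ K A) :=
  isCentralHom_scalarHom.powerSeries_map

theorem scalarHom_smul (c : K) (f : PowerSeries K) :
    scalarHom K A (c • f) = c • scalarHom K A f := by
  ext r
  rw [scalarHom, PowerSeries.coeff_map, PowerSeries.coeff_smul, smul_eq_mul, map_mul,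
    PowerSeries.coeff_smul, PowerSeries.coeff_map, Algebra.smul_def]

theorem scalarHom₂_smul (c : K) (f : PowerSeries (PowerSeries K)) :
    scalarHom₂ K A (c • f) = c • scalarHom₂ K A f := by
  ext1 r
  simp only [scalarHom₂, PowerSeries.coeff_map, PowerSeries.coeff_smul]
  exact scalarHom_smul c _

variable (K) in
/-- The double power series `u⁻¹ v⁻¹`. -/
noncomputable def crossArg : PowerSeries (PowerSeries K) :=
  PowerSeries.X * PowerSeries.C PowerSeries.X

theorem isSmall_crossArg : IsSmall K (crossArg K) := by
  intro c
  rw [PowerSeries.isUnit_iff_constantCoeff]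
  have : PowerSeries.constantCoeff (c • crossArg K) = 0 := by
    rw [← PowerSeries.coeff_zero_eq_constantCoeff_apply, PowerSeries.coeff_smul,
      PowerSeries.coeff_zero_eq_constantCoeff_apply, crossArg, map_mul,
      PowerSeries.constantCoeff_X, zero_mul, smul_zero]
  rw [map_sub, this, map_one, sub_zero]
  exact isUnit_one

variable (A) in
/-- The operator `R̄ᵗ(c u⁻¹ v⁻¹)` on two factors, over double power series. -/
noncomputable def crossOp₂ (n : ℕ) (q c : K) :
    Matrix (Fin n × Fin n) (Fin n × Fin n) (PowerSeries (PowerSeries A)) :=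
  (rBarCross n q (c • crossArg K)).map (scalarHom₂ K A)

theorem partialTranspose_rMatrix_eq {L : Type*} [CommRing L] [Algebra K L] (n : ℕ) (q : K) {x : L}
    (hx : IsSmall K x) : partialTranspose (rMatrix n q x 1) = (x - 1) • rBarCross n q x := by
  rw [rBarCross_eq n q hx, smul_smul, Ring.mul_inverse_cancel _ hx.isUnit_sub_one, one_smul]

theorem partialTranspose_rMatrix_map {L L' : Type*} [CommRing L] [Algebra K L] [Ring L']
    [Algebra K L'] (φ : L →+* L') (hφ : ∀ (c : K) y, φ (c • y) = c • φ y) (n : ℕ) (q : K) {x : L}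
    (hx : IsSmall K x) : partialTranspose (rMatrix n q (φ x) 1) =
      φ (x - 1) • (rBarCross n q x).map φ := by
  rw [← map_one φ, ← rMatrix_map φ hφ]
  have := congrArg (fun Y => Matrix.map Y φ) (partialTranspose_rMatrix_eq n q hx)
  refine Eq.trans this (Matrix.ext fun a b => ?_)
  simp

theorem rBarCross_map {L L' : Type*} [CommRing L] [Algebra K L] [CommRing L'] [Algebra K L']
    (q : K) {x : L} (hx : IsSmall K x) (φ : L →+* L') (hφ : ∀ (c : K) y, φ (c • y) = c • φ y) :
    (rBarCross n q x).map φ = rBarCross n q (φ x) := by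
  rw [rBarCross, zeroWeight_map, weightBar_map q hx φ hφ, rBarCross]

theorem isLeftRegular_of_isUnit {L : Type*} [Ring L] {c : L} (h : IsUnit c) : IsLeftRegular c :=
  h.isRegular.left

/-- `Rᵗ(xy, 1)` and `R̄ᵗ(xy)` differ by `xy - 1`, a central unit among double power series; the
normalized operator is the one with known inverse and compressions. -/
theorem reflection_iff (q : K) (S : Matrix (Fin n) (Fin n) (PowerSeries A)) :
    reflLeft q S = reflRight q S ↔
      IsReflection (rMatrix n q (PowerSeries.C PowerSeries.X) PowerSeries.X) (crossOp₂ A n q 1)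
        (S.map (PowerSeries.map PowerSeries.C)) (S.map PowerSeries.C) := by
  have hx : scalarHom₂ K A (crossArg K) = PowerSeries.X * PowerSeries.C PowerSeries.X := by
    simp [scalarHom₂, crossArg, scalarHom]
  rw [crossOp₂, one_smul, ← isReflection_smul_right_iff (c := scalarHom₂ K A (crossArg K - 1))
    (isCentralHom_scalarHom₂ _)
    (isLeftRegular_of_isUnit (isSmall_crossArg.isUnit_sub_one.map _)),
    ← partialTranspose_rMatrix_map _ scalarHom₂_smul n q isSmall_crossArg, hx, IsReflection,
    reflLeft, reflRight, reflR, reflRT, reflS₁, reflS₂]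
  simp only [mul_assoc]

theorem X_leftRegular {A : Type*} [Ring A] : IsLeftRegular (PowerSeries.X : PowerSeries A) := by
  intro f g h
  ext r
  have := congrArg (PowerSeries.coeff (r + 1)) h
  simpa [PowerSeries.coeff_succ_X_mul] using this

theorem smul_X_commute {A : Type*} [Ring A] [Algebra K A] (c : K) (f : PowerSeries A) :
    Commute (c • PowerSeries.X) f :=
  Commute.smul_left (PowerSeries.commute_X f).symm c

/-- The reflection equation gives the fusion relation. -/
theorem isFused_of_reflection {q : K} (hq : q ≠ 0) (hq2 : q ^ 2 ≠ 1)
    {S : Matrix (Fin n) (Fin n) (PowerSeries A)} (h : reflLeft q S = reflRight q S) :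
    IsFused q S := by
  rw [reflection_iff] at h
  -- This is the line `v = q⁻² u`, that is, `x = w` and `y = q² w`.
  have h1 := h.map (lineHom (A := A) (1 : K) (q ^ 2))
  have hline : ∀ f : PowerSeries (PowerSeries K),
      lineHom (1 : K) (q ^ 2) (scalarHom₂ K A f) = scalarHom K A (lineHom (1 : K) (q ^ 2) f) := by
    intro f
    ext r
    simp only [scalarHom₂, scalarHom, coeff_lineHom, PowerSeries.coeff_map, map_sum,
      Algebra.smul_def, map_mul]
    rfl
  have eR : (rMatrix n q (PowerSeries.C (PowerSeries.X (R := A))) PowerSeries.X).map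
      (lineHom (1 : K) (q ^ 2)) = ((q ^ 2 - 1) • (PowerSeries.X : PowerSeries A)) • antiOp A n q := by
    rw [rMatrix_map _ (lineHom_smul _ _), lineHom_C_X, lineHom_X, one_smul, rMatrix_fused hq,
      antiOp_eq]
  have eQ : (crossOp₂ A n q 1).map (lineHom (1 : K) (q ^ 2)) = crossOp A n q 0 1 := by
    have e1 : lineHom (1 : K) (q ^ 2) ((1 : K) • crossArg K) = siteArg q 0 1 := by
      rw [one_smul, crossArg, map_mul, lineHom_X, lineHom_C_X, siteArg,
        PowerSeries.smul_eq_C_mul, PowerSeries.smul_eq_C_mul]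
      simp
    rw [crossOp, ← e1, ← rBarCross_map q (isSmall_crossArg.smul 1) _ (lineHom_smul _ _)]
    exact Matrix.ext fun a b => hline _
  have eS : (S.map (PowerSeries.map PowerSeries.C)).map (lineHom (1 : K) (q ^ 2)) = S :=
    Matrix.ext fun a b => (lineHom_map_C _ _ _).trans (dilate_one _)
  have eS' : (S.map PowerSeries.C).map (lineHom (1 : K) (q ^ 2)) = S.map (dilate (q ^ 2)) :=
    Matrix.ext fun a b => lineHom_C _ _ _
  rw [eR, eQ, eS, eS'] at h1
  -- On this line `R` carries the scalar `(q² - 1) w`, which is regular because `q² ≠ 1`.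
  refine h1.of_smul_left (smul_X_commute _) ?_
  intro f g hfg
  have hne : q ^ 2 - 1 ≠ 0 := sub_ne_zero.2 hq2
  refine X_leftRegular ?_
  have := congrArg (fun y => (q ^ 2 - 1)⁻¹ • y) hfg
  simpa [smul_smul, inv_mul_cancel₀ hne] using this

theorem reflection_submatrix {q : K} {S : Matrix (Fin n) (Fin n) (PowerSeries A)}
    (h : reflLeft q S = reflRight q S) {f : Fin N → Fin n} (hf : StrictMono f) :
    reflLeft q (S.submatrix f f) = reflRight q (S.submatrix f f) := by
  rw [reflection_iff] at h ⊢
  have h1 := h.submatrix (preservesContent_rMatrix _ _ _)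
    ⟨_, zeroWeight_map _ _⟩ hf.injective
  rw [rMatrix_submatrix hf] at h1
  have e : (crossOp₂ A n q 1).submatrix (Prod.map f f) (Prod.map f f) = crossOp₂ A N q 1 :=
    congrArg (fun Y => Matrix.map Y (scalarHom₂ K A)) (rBarCross_submatrix q _ hf)
  rw [e] at h1
  exact h1

theorem dilateHom₂_C_X (c : K) : dilateHom₂ c (PowerSeries.C (PowerSeries.X (R := A))) =
    c • PowerSeries.C PowerSeries.X := by
  rw [dilateHom₂_C, dilate_X]
  ext1 r
  rw [PowerSeries.coeff_smul, PowerSeries.coeff_C, PowerSeries.coeff_C, smul_ite, smul_zero]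

theorem rMatrix_map_dilateHom₂ (q c : K) :
    (rMatrix n q (PowerSeries.C (PowerSeries.X (R := A))) PowerSeries.X).map (dilateHom₂ c) =
      algebraMap K (PowerSeries (PowerSeries A)) c •
        rMatrix n q (PowerSeries.C PowerSeries.X) PowerSeries.X := by
  rw [rMatrix_map _ (dilateHom₂_smul _), dilateHom₂_C_X, dilateHom₂_X, rMatrix_smul]
  exact Matrix.ext fun a b => Algebra.smul_def c (rMatrix n q _ _ a b)

theorem dilateHom₂_scalarHom₂ (c : K) (f : PowerSeries (PowerSeries K)) :
    dilateHom₂ c (scalarHom₂ K A f) = scalarHom₂ K A (dilateHom₂ c f) := by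
  ext1 r
  simp only [dilateHom₂, scalarHom₂, RingHom.comp_apply, dilateHom_apply, coeff_dilate,
    PowerSeries.coeff_map]
  rw [scalarHom_smul, scalarHom, dilate_map_algebraMap]

theorem crossOp₂_map_dilateHom₂ (n : ℕ) (q c d : K) :
    (crossOp₂ A n q d).map (dilateHom₂ c) = crossOp₂ A n q (d * c ^ 2) := by
  have e : dilateHom₂ c (d • crossArg K) = (d * c ^ 2) • crossArg K := by
    rw [dilateHom₂_smul, crossArg, map_mul, dilateHom₂_X, dilateHom₂_C_X, smul_mul_assoc,
      mul_smul_comm, smul_smul, smul_smul, mul_assoc, pow_two]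
  rw [crossOp₂, crossOp₂, ← e, ← rBarCross_map q (isSmall_crossArg.smul d) _ (dilateHom₂_smul c)]
  exact Matrix.ext fun a b => dilateHom₂_scalarHom₂ _ _

/-- The reflection equation for the dilated Schur complement. -/
theorem reflection_schur {q : K} (hq : q ≠ 0)
    {S S' : Matrix (Fin (N + M)) (Fin (N + M)) (PowerSeries A)} (h1 : S * S' = 1) (h2 : S' * S = 1)
    (h : reflLeft q S = reflRight q S) {σ : Matrix (Fin N) (Fin N) (PowerSeries A)}
    (hσ : S'.submatrix (Fin.castAdd M) (Fin.castAdd M) * σ = 1)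
    (hσ' : σ * S'.submatrix (Fin.castAdd M) (Fin.castAdd M) = 1) :
    reflLeft q (σ.map (dilate (q ^ M))) = reflRight q (σ.map (dilate (q ^ M))) := by
  rw [reflection_iff] at h ⊢
  obtain ⟨u, hu⟩ := isUnit_rBarCross hq (N + M) ((isSmall_crossArg (K := K)).smul 1)
  have hG : (u⁻¹).val * rBarCross (N + M) q ((1 : K) • crossArg K) = 1 := by
    rw [← hu, Units.inv_mul]
  obtain ⟨⟨g, hg⟩, h3⟩ := submatrix_inverse_mul_rBarCross hq N M
    ((isSmall_crossArg (K := K)).smul 1) hG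
  rw [smul_smul, mul_one] at h3
  have h4 := mul_eq_one_comm.1 h3
  have hs : ∀ {ι : Type} [Fintype ι] [DecidableEq ι]
      {Y Z : Matrix ι ι (PowerSeries (PowerSeries K))},
      Y * Z = 1 → Y.map (scalarHom₂ K A) * Z.map (scalarHom₂ K A) = 1 := fun {_ _ _ Y Z} h => by
    have := congrArg (scalarHom₂ K A).mapMatrix h
    rwa [map_mul, map_one] at this
  have hm : ∀ {n : ℕ} (φ : PowerSeries A →+* PowerSeries (PowerSeries A))
      {Y Z : Matrix (Fin n) (Fin n) (PowerSeries A)}, Y * Z = 1 → Y.map φ * Z.map φ = 1 :=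
    fun φ Y Z h => by
      have := congrArg φ.mapMatrix h
      rwa [map_mul, map_one] at this
  have key : IsReflection _ (crossOp₂ A N q (q⁻¹ ^ (2 * M))) _ _ :=
    h.schur (preservesContent_rMatrix _ _ _) (Fin.castAdd_injective N M)
    (hm (PowerSeries.map PowerSeries.C) h1) (hm (PowerSeries.map PowerSeries.C) h2)
    (hm PowerSeries.C h1) (hm PowerSeries.C h2) (hs hG)
    (hs (mul_eq_one_comm.1 hG)) ⟨_, by rw [hg, zeroWeight_map]⟩
    (hm (PowerSeries.map PowerSeries.C) hσ) (hm (PowerSeries.map PowerSeries.C) hσ')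
    (hm PowerSeries.C hσ) (hm PowerSeries.C hσ') (hs h3) (hs h4)
  rw [rMatrix_submatrix (Fin.strictMono_castAdd M)] at key
  -- For `σ` itself the crossing argument is `q^{-2M} x y`. Dilating both variables by `q^M`
  -- restores `x y` and, `R` being homogeneous, only rescales `R`.
  have h5 := key.map (dilateHom₂ (A := A) (q ^ M))
  have eS : (σ.map (PowerSeries.map PowerSeries.C)).map (dilateHom₂ (q ^ M)) =
      (σ.map (dilate (q ^ M))).map (PowerSeries.map PowerSeries.C) :=
    Matrix.ext fun a b => dilateHom₂_map_C _ _
  have eS' : (σ.map PowerSeries.C).map (dilateHom₂ (q ^ M)) =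
      (σ.map (dilate (q ^ M))).map PowerSeries.C :=
    Matrix.ext fun a b => dilateHom₂_C _ _
  have e' : q⁻¹ ^ (2 * M) * (q ^ M) ^ 2 = 1 := by
    rw [← pow_mul, mul_comm M 2, ← mul_pow, inv_mul_cancel₀ hq, one_pow]
  rw [rMatrix_map_dilateHom₂, crossOp₂_map_dilateHom₂, e', eS, eS'] at h5
  exact h5.of_smul_left (Algebra.commutes _)
    (isLeftRegular_of_isUnit ((pow_ne_zero M hq).isUnit.map _))

end Series

/-! ### Constant terms -/

section Entries

variable {L : Type*} [Ring L] {n m : ℕ}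

theorem extend_single (i : Fin m) (d : Fin 1 → Fin n) (a : Fin m → Fin n) :
    Function.extend ![i] d a = Function.update a i (d 0) := by
  symm
  rw [eq_extend_iff (injective_one i)]
  constructor
  · funext k
    rw [Subsingleton.elim k 0]
    simp
  · intro x hx
    exact Function.update_of_ne (fun h => hx 0 h.symm) _ _

theorem oneSite_mul_apply (i : Fin m) (s : Matrix (Fin n) (Fin n) L)
    (Z : Matrix (Fin m → Fin n) (Fin m → Fin n) L) (a b : Fin m → Fin n) :
    (oneSite i s * Z) a b = ∑ c, s (a i) c * Z (Function.update a i c) b := by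
  rw [oneSite_eq, siteEmb_mul_apply (injective_one i)]
  refine Fintype.sum_equiv (Equiv.funUnique (Fin 1) (Fin n)) _ _ fun d => ?_
  rw [extend_single]
  rfl

theorem mul_oneSite_apply (i : Fin m) (s : Matrix (Fin n) (Fin n) L)
    (Z : Matrix (Fin m → Fin n) (Fin m → Fin n) L) (a b : Fin m → Fin n) :
    (Z * oneSite i s) a b = ∑ c, Z a (Function.update b i c) * s c (b i) := by
  rw [oneSite_eq, mul_siteEmb_apply (injective_one i)]
  refine Fintype.sum_equiv (Equiv.funUnique (Fin 1) (Fin n)) _ _ fun d => ?_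
  rw [extend_single]
  rfl

theorem twoSite_apply_two (Q : Matrix (Fin n × Fin n) (Fin n × Fin n) L) (a b : Fin 2 → Fin n) :
    twoSite 0 1 Q a b = Q (a 0, a 1) (b 0, b 1) := by
  rw [twoSite, Matrix.of_apply, if_pos]
  intro k h0 h1
  fin_cases k
  · exact absurd rfl h0
  · exact absurd rfl h1

theorem gen_apply_two (Q : Matrix (Fin n × Fin n) (Fin n × Fin n) L)
    (s s' : Matrix (Fin n) (Fin n) L) (a b : Fin 2 → Fin n) :
    (oneSite 0 s * twoSite 0 1 Q * oneSite 1 s' : Matrix (Fin 2 → Fin n) (Fin 2 → Fin n) L) a b =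
      ∑ d, (∑ c, s (a 0) c * Q (c, a 1) (b 0, d)) * s' d (b 1) := by
  rw [mul_oneSite_apply]
  refine Finset.sum_congr rfl fun d _ => ?_
  rw [oneSite_mul_apply]
  congr 1

theorem rev_apply_two (Q : Matrix (Fin n × Fin n) (Fin n × Fin n) L)
    (s s' : Matrix (Fin n) (Fin n) L) (a b : Fin 2 → Fin n) :
    (oneSite 1 s' * twoSite 0 1 Q * oneSite 0 s : Matrix (Fin 2 → Fin n) (Fin 2 → Fin n) L) a b =
      ∑ e, (∑ d, s' (a 1) d * Q (a 0, d) (e, b 1)) * s e (b 0) := by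
  rw [mul_oneSite_apply]
  refine Finset.sum_congr rfl fun d _ => ?_
  rw [oneSite_mul_apply]
  congr 1

end Entries

/-! ### The reflection equation for constant terms. -/

section Constant

variable {K : Type*} [Field K] {A : Type*} [Ring A] [Algebra K A] {n N : ℕ}

/-- Setting `x = 0` leaves `R(y, 0) = y R(1, 0)`. The factor `y` has to be cancelled before `y = 0`
is set, since otherwise the relation would be trivial. -/
theorem reflection_constantCoeff {q : K} {S : Matrix (Fin n) (Fin n) (PowerSeries A)}
    (h : reflLeft q S = reflRight q S) :
    IsReflection (rMatrix n q (1 : A) 0) (partialTranspose (rMatrix n q 0 1))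
      (S.map PowerSeries.constantCoeff) (S.map PowerSeries.constantCoeff) := by
  have h1 : IsReflection
      (rMatrix n q (PowerSeries.C (PowerSeries.X (R := A))) PowerSeries.X)
      (partialTranspose (rMatrix n q (PowerSeries.X * PowerSeries.C PowerSeries.X) 1))
      (S.map (PowerSeries.map PowerSeries.C)) (S.map PowerSeries.C) := by
    rw [IsReflection]
    rw [reflLeft, reflRight, reflR, reflRT, reflS₁, reflS₂] at h
    simpa only [mul_assoc] using h
  have hcc : ∀ {B : Type _} [Ring B] [Algebra K B] (c : K) (y : PowerSeries B),
      PowerSeries.constantCoeff (c • y) = c • PowerSeries.constantCoeff y := fun c y => by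
    rw [← PowerSeries.coeff_zero_eq_constantCoeff_apply, PowerSeries.coeff_smul,
      PowerSeries.coeff_zero_eq_constantCoeff_apply]
  have h2 := h1.map (PowerSeries.constantCoeff (R := PowerSeries A))
  have e1 : (rMatrix n q (PowerSeries.C (PowerSeries.X (R := A))) PowerSeries.X).map
      (PowerSeries.constantCoeff (R := PowerSeries A)) =
        (PowerSeries.X : PowerSeries A) • rMatrix n q 1 0 := by
    rw [rMatrix_map _ hcc, PowerSeries.constantCoeff_C, PowerSeries.constantCoeff_X]
    refine Matrix.ext fun a b => ?_
    simp only [rMatrix, Matrix.of_apply, Matrix.smul_apply]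
    split_ifs <;> simp
  have e2 : (partialTranspose (rMatrix n q (PowerSeries.X * PowerSeries.C (PowerSeries.X (R := A)))
      1)).map (PowerSeries.constantCoeff (R := PowerSeries A)) =
        partialTranspose (rMatrix n q 0 1) := by
    have := rMatrix_map (n := n) (PowerSeries.constantCoeff (R := PowerSeries A)) hcc q
      (PowerSeries.X * PowerSeries.C PowerSeries.X) 1
    rw [map_mul, PowerSeries.constantCoeff_X, zero_mul, map_one] at this
    exact congrArg partialTranspose this
  rw [e1, e2] at h2
  have h3 := (h2.of_smul_left (fun x => (PowerSeries.commute_X x).symm) X_leftRegular).map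
    (PowerSeries.constantCoeff (R := A))
  have e3 : (rMatrix n q (1 : PowerSeries A) 0).map (PowerSeries.constantCoeff (R := A)) =
      rMatrix n q 1 0 := by
    rw [rMatrix_map _ hcc, map_one, map_zero]
  have e4 : (partialTranspose (rMatrix n q (0 : PowerSeries A) 1)).map
      (PowerSeries.constantCoeff (R := A)) = partialTranspose (rMatrix n q 0 1) := by
    have := rMatrix_map (n := n) (PowerSeries.constantCoeff (R := A)) hcc q 0 1
    rw [map_one, map_zero] at this
    exact congrArg partialTranspose this
  rw [e3, e4] at h3
  convert h3 using 1
  · refine Matrix.ext fun a b => ?_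
    simp only [Matrix.map_apply]
    rw [← PowerSeries.coeff_zero_eq_constantCoeff_apply (PowerSeries.map _ _),
      PowerSeries.coeff_map, PowerSeries.constantCoeff_C,
      PowerSeries.coeff_zero_eq_constantCoeff_apply]
  · refine Matrix.ext fun a b => ?_
    simp

/-- This is the entry in row `(i, i)` and column `(i, j)`. On the left only `(i, i)` contributes to
the action of `R`; on the right `(i, j)` and `(j, i)` do, with coefficients `1` and `q⁻¹ - q`. -/
theorem constant_commutation {q : K} (hq : q ≠ 0) {X : Matrix (Fin n) (Fin n) A}
    (h : IsReflection (rMatrix n q (1 : A) 0) (partialTranspose (rMatrix n q 0 1)) X X)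
    {i j : Fin n} (hij : i < j) : X i j * X i i = q ^ 2 • (X i i * X i j) := by
  have h1 := congrFun (congrFun h ![i, i]) ![i, j]
  have hne := hij.ne
  have hgen : ∀ w, (oneSite 0 X * twoSite 0 1 (partialTranspose (rMatrix n q 0 1)) *
      oneSite 1 X : Matrix (Fin 2 → Fin n) (Fin 2 → Fin n) A) ![i, i] ![i, w] = -(q • (X i i * X i w)) := by
    intro w
    rw [gen_apply_two, Finset.sum_eq_single i, Finset.sum_eq_single i]
    · simp [partialTranspose, rMatrix]
    · intro c _ hc
      simp [partialTranspose, rMatrix, hc.symm]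
    · simp
    · intro d _ hd
      rw [Finset.sum_eq_zero, zero_mul]
      intro c _
      simp [partialTranspose, rMatrix, hd.symm]
    · simp
  have hrev1 : (oneSite 1 X * twoSite 0 1 (partialTranspose (rMatrix n q 0 1)) *
      oneSite 0 X : Matrix (Fin 2 → Fin n) (Fin 2 → Fin n) A) ![i, i] ![i, j] = -(X i j * X i i) := by
    rw [rev_apply_two, Finset.sum_eq_single i, Finset.sum_eq_single j]
    · simp [partialTranspose, rMatrix, hne]
    · intro c _ hc
      simp [partialTranspose, rMatrix, hc, hne]
    · simp
    · intro d _ hd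
      rw [Finset.sum_eq_zero, zero_mul]
      intro c _
      by_cases hc : c = i
      · subst hc
        by_cases hdj : d = j
        · subst hdj
          simp [partialTranspose, rMatrix, hne, hne.symm, hij.not_ge]
        · simp [partialTranspose, rMatrix, hne, hd, hdj]
      · simp [partialTranspose, rMatrix, hd, hc]
    · simp
  have hrev2 : (oneSite 1 X * twoSite 0 1 (partialTranspose (rMatrix n q 0 1)) *
      oneSite 0 X : Matrix (Fin 2 → Fin n) (Fin 2 → Fin n) A) ![i, i] ![j, i] = -(q • (X i i * X i j)) := by
    rw [rev_apply_two, Finset.sum_eq_single i, Finset.sum_eq_single i]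
    · simp [partialTranspose, rMatrix]
    · intro c _ hc
      simp [partialTranspose, rMatrix, hc]
    · simp
    · intro d _ hd
      rw [Finset.sum_eq_zero, zero_mul]
      intro c _
      simp [partialTranspose, rMatrix, hd]
    · simp
  rw [Matrix.mul_apply, Finset.sum_eq_single ![i, i], hgen, Matrix.mul_apply,
    Fintype.sum_eq_add ![i, j] ![j, i], hrev1, hrev2] at h1
  · rw [twoSite_apply_two, twoSite_apply_two, twoSite_apply_two] at h1
    simp [rMatrix, hne, hne.symm, hij] at h1
    have h2 : X i j * X i i = (q * q⁻¹ - (q⁻¹ - q) * q) • (X i i * X i j) := by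
      rw [sub_smul, mul_smul, mul_smul]
      exact eq_sub_of_add_eq (neg_injective (by rw [neg_add]; exact h1.symm))
    rw [h2]
    congr 1
    field_simp
    ring
  · intro e
    exact hne (congrFun e 0)
  · intro c hc
    rw [twoSite_apply_two]
    have hR : rMatrix n q (1 : A) 0 (c 0, c 1) (i, j) = 0 := by
      by_contra h0
      rcases preservesContent_rMatrix _ _ _ _ _ h0 with e | ⟨e1, e2⟩
      · rw [Prod.mk.injEq] at e
        exact hc.1 (funext fun k => by fin_cases k <;> simp [e])
      · exact hc.2 (funext fun k => by fin_cases k <;> simp_all)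
    exact (congrArg _ hR).trans (mul_zero _)
  · intro c _ hc
    rw [twoSite_apply_two]
    have hR : rMatrix n q (1 : A) 0 (i, i) (c 0, c 1) = 0 := by
      by_contra h0
      rcases preservesContent_rMatrix _ _ _ _ _ h0 with e | ⟨e1, e2⟩
      · rw [Prod.mk.injEq] at e
        exact hc (funext fun k => by fin_cases k <;> simp [← e.1, ← e.2])
      · exact hc (funext fun k => by fin_cases k <;> simp_all)
    exact (congrArg (· * _) hR).trans (zero_mul _)
  · exact fun h0 => absurd (Finset.mem_univ _) h0

end Constant

/-! ### Invertibility of the constant terms -/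

section Triangular

variable {A : Type*} [Ring A] {n : ℕ}

theorem pow_apply_ne_zero {X : Matrix (Fin n) (Fin n) A} (hX : ∀ i j, X i j ≠ 0 → j < i) (k : ℕ)
    (i j : Fin n) (h : (X ^ k) i j ≠ 0) : (j : ℕ) + k ≤ i := by
  induction k generalizing j with
  | zero =>
    rw [pow_zero] at h
    by_contra hne
    exact h (Matrix.one_apply_ne (by rintro rfl; exact hne le_rfl))
  | succ k ih =>
    rw [pow_succ, Matrix.mul_apply] at h
    obtain ⟨c, -, hc⟩ := Finset.exists_ne_zero_of_sum_ne_zero h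
    have h1 := ih c (left_ne_zero_of_mul hc)
    have h2 := hX _ _ (right_ne_zero_of_mul hc)
    rw [Fin.lt_def] at h2
    omega

theorem isNilpotent_of_strictly_lower {X : Matrix (Fin n) (Fin n) A}
    (hX : ∀ i j, X i j ≠ 0 → j < i) : IsNilpotent X := by
  refine ⟨n, Matrix.ext fun i j => ?_⟩
  by_contra h
  have := pow_apply_ne_zero hX n i j h
  omega

/-- After division by its diagonal, the matrix is `1` plus a nilpotent one. -/
theorem isUnit_of_lower {X : Matrix (Fin n) (Fin n) A} (hX : ∀ i j, i < j → X i j = 0)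
    (hd : ∀ i, IsUnit (X i i)) : IsUnit X := by
  choose u hu using hd
  set D : Matrix (Fin n) (Fin n) A := Matrix.diagonal fun i => (u i).val
  set D' : Matrix (Fin n) (Fin n) A := Matrix.diagonal fun i => ((u i)⁻¹).val
  have h1 : D * D' = 1 := by simp [D, D']
  have h2 : D' * D = 1 := by simp [D, D']
  have hl : ∀ i j, (D' * X - 1) i j ≠ 0 → j < i := by
    intro i j h
    by_contra hij
    apply h
    rw [Matrix.sub_apply, Matrix.diagonal_mul]
    rcases (not_lt.1 hij).lt_or_eq with hlt | rfl
    · rw [hX i j hlt, mul_zero, Matrix.one_apply_ne hlt.ne, sub_zero]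
    · rw [← hu, Units.inv_mul, Matrix.one_apply_eq, sub_self]
  have h3 := (isNilpotent_of_strictly_lower hl).isUnit_one_add
  rw [add_sub_cancel] at h3
  have h4 : IsUnit D := ⟨⟨D, D', h1, h2⟩, rfl⟩
  have := h4.mul h3
  rwa [← mul_assoc, h1, one_mul] at this

end Triangular

/-! ### Admissible constant terms, their invertibility, and Schur complements. -/

section ConstantTerm

variable {K : Type*} [Field K] {A : Type*} [Ring A] [Algebra K A] {n N M : ℕ}

/-- The relations between the constant terms of the generating series, with the inverses as units. -/
def IsConstant (q : K) (g : Family) (X : Matrix (Fin n) (Fin n) A) : Prop :=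
  match g with
  | Family.orthogonal => (∀ i j, i < j → X i j = 0) ∧ ∀ i, X i i = 1
  | Family.symplectic =>
    (∀ i j : Fin n, i < j → ¬ (Even (i : ℕ) ∧ (j : ℕ) = i + 1) → X i j = 0) ∧
    ∀ i j : Fin n, Even (i : ℕ) → (j : ℕ) = i + 1 → IsUnit (X i j) ∧
      X j j * X i i - q ^ 2 • (X j i * X i j) = algebraMap K A (q ^ 3)

theorem IsConstant.submatrix {q : K} {g : Family} {X : Matrix (Fin n) (Fin n) A}
    (h : IsConstant q g X) {f : Fin N → Fin n} {s : ℕ} (hf : ∀ i, (f i : ℕ) = s + i)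
    (hs : g = Family.symplectic → Even s) : IsConstant q g (X.submatrix f f) := by
  have hlt : ∀ i j, i < j → f i < f j := fun i j hij => by
    rw [Fin.lt_def] at hij ⊢
    rw [hf, hf]
    omega
  cases g with
  | orthogonal => exact ⟨fun i j hij => h.1 _ _ (hlt i j hij), fun i => h.2 _⟩
  | symplectic =>
    have he : ∀ i, Even (f i : ℕ) ↔ Even (i : ℕ) := fun i => by
      rw [hf, Nat.even_add]
      simp [hs rfl]
    refine ⟨fun i j hij hne => h.1 _ _ (hlt i j hij) ?_, fun i j hi hij => h.2 _ _ ?_ ?_⟩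
    · rw [he, hf, hf]
      rintro ⟨h1, h2⟩
      exact hne ⟨h1, by omega⟩
    · rwa [he]
    · rw [hf, hf]
      omega

/-- For even `N` no pair `i, i'` straddles the two blocks, so the exceptional entries above the
diagonal do not occur here. -/
theorem IsConstant.upper_eq_zero {q : K} {g : Family} {X : Matrix (Fin (N + M)) (Fin (N + M)) A}
    (h : IsConstant q g X) (hN : g = Family.symplectic → Even N) (i : Fin N) (j : Fin M) :
    X (Fin.castAdd M i) (Fin.natAdd N j) = 0 := by
  have hlt : Fin.castAdd M i < Fin.natAdd N j := by
    rw [Fin.lt_def, Fin.val_castAdd, Fin.val_natAdd]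
    omega
  cases g with
  | orthogonal => exact h.1 _ _ hlt
  | symplectic =>
    refine h.1 _ _ hlt ?_
    rw [Fin.val_castAdd, Fin.val_natAdd]
    rintro ⟨⟨a, ha⟩, h2⟩
    obtain ⟨b, hb⟩ := hN rfl
    have := i.isLt
    omega

/-- The involution `i ↦ i'` of an even number of indices. -/
def partner (hn : Even n) (i : Fin n) : Fin n :=
  if h : Even (i : ℕ) then ⟨i + 1, by
    obtain ⟨a, ha⟩ := hn
    obtain ⟨b, hb⟩ := h
    have := i.isLt
    omega⟩
  else ⟨i - 1, by omega⟩

theorem partner_partner (hn : Even n) (i : Fin n) : partner hn (partner hn i) = i := by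
  by_cases h : Even (i : ℕ)
  · have h1 : ¬ Even ((i : ℕ) + 1) := by rwa [Nat.even_add_one, not_not]
    rw [Fin.ext_iff]
    simp [partner, h, h1]
  · have h0 : (i : ℕ) ≠ 0 := fun e => h (by rw [e]; exact Even.zero)
    have h1 : Even ((i : ℕ) - 1) := by
      rw [Nat.not_even_iff_odd] at h
      exact h.tsub_odd odd_one
    rw [Fin.ext_iff]
    simp only [partner, h, h1, dif_neg, not_false_eq_true, dif_pos]
    omega

/-- The involution `i ↦ i'` as a permutation. -/
def partnerPerm (hn : Even n) : Equiv.Perm (Fin n) :=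
  ⟨partner hn, partner hn, partner_partner hn, partner_partner hn⟩

/-- The matrix is block lower triangular with `2 × 2` blocks. Exchanging columns `i` and `i'` puts
the invertible entries `X_{ii'}` on the diagonal, and the column operation `1 + E` clears the
entries `X_{ii}` now to their right. The other diagonal entry of the block becomes a quantum
determinant divided by `X_{ii'}`, so the result is triangular with invertible diagonal. -/
theorem IsConstant.isUnit_symplectic {q : K} (hq : q ≠ 0) (hn : Even n)
    {X : Matrix (Fin n) (Fin n) A} (h : IsConstant q Family.symplectic X)
    (hX : ∀ i j, i < j → X i j * X i i = q ^ 2 • (X i i * X i j)) : IsUnit X := by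
  obtain ⟨h1, h2⟩ := h
  set w : Fin n → A := fun j => Ring.inverse (X (partner hn j) j) * X (partner hn j) (partner hn j)
  set E : Matrix (Fin n) (Fin n) A := Matrix.of fun l j =>
    if ¬ Even (j : ℕ) ∧ l = partner hn j then -w j else 0 with hE
  have hpe : ∀ j : Fin n, Even (j : ℕ) → ((partner hn j : Fin n) : ℕ) = j + 1 := fun j hj => by
    simp [partner, hj]
  have hpo : ∀ j : Fin n, ¬ Even (j : ℕ) → (j : ℕ) = (partner hn j : Fin n) + 1 ∧
      Even ((partner hn j : Fin n) : ℕ) := fun j hj => by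
    have h0 : (j : ℕ) ≠ 0 := fun e => hj (by rw [e]; exact Even.zero)
    have h3 : Even ((j : ℕ) - 1) := by
      rw [Nat.not_even_iff_odd] at hj
      exact hj.tsub_odd odd_one
    simp only [partner, hj, dif_neg, not_false_eq_true]
    exact ⟨by omega, h3⟩
  have hEE : E * E = 0 := by
    ext i j
    rw [Matrix.mul_apply, Matrix.zero_apply]
    refine Finset.sum_eq_zero fun l _ => ?_
    simp only [hE, Matrix.of_apply]
    by_cases hl : ¬ Even (j : ℕ) ∧ l = partner hn j
    · rw [if_neg, zero_mul]
      rintro ⟨h3, -⟩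
      rw [hl.2] at h3
      exact h3 (hpo j hl.1).2
    · rw [if_neg hl, mul_zero]
  have hU : IsUnit (1 + E) :=
    IsNilpotent.isUnit_one_add ⟨2, by rw [pow_two, hEE]⟩
  set Z := X.submatrix id (partnerPerm hn) with hZ
  have hZE : ∀ i j, (Z * (1 + E)) i j =
      X i (partner hn j) + if Even (j : ℕ) then 0 else -(X i j * w j) := by
    intro i j
    rw [mul_add, mul_one, Matrix.add_apply, Matrix.mul_apply]
    congr 1
    split_ifs with hj
    · refine Finset.sum_eq_zero fun l _ => ?_
      simp [hE, hj]
    · rw [Finset.sum_eq_single (partner hn j)]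
      · have : partnerPerm hn (partner hn j) = j := partner_partner hn j
        simp [hE, hj, hZ, this]
      · intro l _ hl
        simp [hE, hl]
      · simp
  have hlow : IsUnit (Z * (1 + E)) := by
    refine isUnit_of_lower (fun i j hij => ?_) fun j => ?_
    · rw [hZE]
      split_ifs with hj
      · rw [add_zero]
        have e := hpe j hj
        refine h1 _ _ (by rw [Fin.lt_def] at hij ⊢; omega) ?_
        rintro ⟨-, h3⟩
        rw [Fin.lt_def] at hij
        omega
      · obtain ⟨e, he⟩ := hpo j hj
        by_cases hi : i = partner hn j
        · have hu := (h2 _ _ he e).1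
          rw [hi, ← mul_assoc, Ring.mul_inverse_cancel _ hu, one_mul, add_neg_cancel]
        · have hne : (i : ℕ) ≠ (partner hn j : Fin n) := fun e' => hi (Fin.ext e')
          rw [Fin.lt_def] at hij
          rw [h1 i (partner hn j), h1 i j, zero_mul, neg_zero, add_zero]
          · rwa [Fin.lt_def]
          · rintro ⟨-, h3⟩
            omega
          · rw [Fin.lt_def]
            omega
          · rintro ⟨h3, h4⟩
            rw [h4] at he
            exact Nat.even_add_one.1 he h3
    · rw [hZE]
      split_ifs with hj
      · rw [add_zero]
        exact (h2 _ _ hj (hpe j hj)).1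
      · obtain ⟨e, he⟩ := hpo j hj
        obtain ⟨hu, hd⟩ := h2 _ _ he e
        have hc := hX (partner hn j) j (by rw [Fin.lt_def]; omega)
        simp only [w]
        set i := partner hn j
        obtain ⟨u, hu'⟩ := hu
        rw [← hu', Ring.inverse_unit]
        rw [← hu'] at hd hc
        -- Moving `X_{ii}` past `u = X_{ii'}` costs `q⁻²`; the relation with right side `q³` then
        -- leaves the scalar `-q`.
        have hκ : (X j i + -(X j j * (↑u⁻¹ * X i i))) * ↑u = -(algebraMap K A q) := by
          have hsu : X i i * ↑u = (q ^ 2)⁻¹ • (↑u * X i i) := by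
            rw [hc, smul_smul, inv_mul_cancel₀ (pow_ne_zero 2 hq), one_smul]
          have h5 : X j j * X i i = algebraMap K A (q ^ 3) + q ^ 2 • (X j i * ↑u) :=
            sub_eq_iff_eq_add.1 hd
          rw [add_mul, neg_mul, mul_assoc (X j j), mul_assoc (↑u⁻¹ : A), hsu, mul_smul_comm,
            ← mul_assoc, Units.inv_mul, one_mul, mul_smul_comm, h5, smul_add, smul_smul,
            inv_mul_cancel₀ (pow_ne_zero 2 hq), one_smul, Algebra.smul_def, ← map_mul]
          have h6 : (q ^ 2)⁻¹ * q ^ 3 = q := by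
            field_simp
          rw [h6, neg_add, add_comm (-_) (-_), add_neg_cancel_left]
        have h7 : IsUnit (-(algebraMap K A q)) := (hq.isUnit.map (algebraMap K A)).neg
        rw [← hκ] at h7
        exact (Units.isUnit_mul_units _ u).1 h7
  have hZu : IsUnit Z := by
    obtain ⟨v, hv⟩ := hU
    rw [← hv] at hlow
    exact (Units.isUnit_mul_units Z v).1 hlow
  obtain ⟨Z', h3, h4⟩ : ∃ Z', Z * Z' = 1 ∧ Z' * Z = 1 := by
    obtain ⟨v, hv⟩ := hZu
    exact ⟨↑v⁻¹, by rw [← hv, Units.mul_inv], by rw [← hv, Units.inv_mul]⟩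
  have hXZ : X = Z.submatrix id (partnerPerm hn) := by
    refine Matrix.ext fun i j => ?_
    have : partnerPerm hn (partnerPerm hn j) = j := partner_partner hn j
    simp [hZ, this]
  refine ⟨⟨X, Z'.submatrix (partnerPerm hn) id, ?_, ?_⟩, rfl⟩
  · rw [hXZ, Matrix.submatrix_mul_equiv, h3, Matrix.submatrix_id_id]
  · rw [hXZ]
    have := Matrix.submatrix_mul_equiv Z' Z (partnerPerm hn) (Equiv.refl _) (partnerPerm hn)
    rw [h4, Matrix.submatrix_one_equiv] at this
    exact this

theorem IsConstant.isUnit {q : K} (hq : q ≠ 0) {g : Family} (hn : g = Family.symplectic → Even n)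
    {X : Matrix (Fin n) (Fin n) A} (h : IsConstant q g X)
    (hX : ∀ i j, i < j → X i j * X i i = q ^ 2 • (X i i * X i j)) : IsUnit X := by
  cases g with
  | orthogonal =>
    exact isUnit_of_lower h.1 fun i => by
      rw [h.2 i]
      exact isUnit_one
  | symplectic => exact h.isUnit_symplectic hq (hn rfl) hX

theorem isUnit_of_reflection {q : K} (hq : q ≠ 0) {g : Family}
    (hn : g = Family.symplectic → Even n) {S : Matrix (Fin n) (Fin n) (PowerSeries A)}
    (h : reflLeft q S = reflRight q S)
    (hS : IsConstant q g (S.map PowerSeries.constantCoeff)) : IsUnit S :=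
  isUnit_matrix_of_constantCoeff S
    (hS.isUnit hq hn fun _ _ hij => constant_commutation hq (reflection_constantCoeff h) hij)

theorem mul_submatrix_split {L : Type*} [Ring L] {α β : Type*}
    (Y Z : Matrix (Fin (N + M)) (Fin (N + M)) L) (f : α → Fin (N + M)) (g : β → Fin (N + M)) :
    (Y * Z).submatrix f g = Y.submatrix f (Fin.castAdd M) * Z.submatrix (Fin.castAdd M) g +
      Y.submatrix f (Fin.natAdd N) * Z.submatrix (Fin.natAdd N) g := by
  ext a b
  simp [Matrix.mul_apply, Fin.sum_univ_add]

theorem schur_inverse {L : Type*} [Ring L] {a p : Matrix (Fin N) (Fin N) L}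
    {b x : Matrix (Fin N) (Fin M) L} {c y : Matrix (Fin M) (Fin N) L}
    {d e : Matrix (Fin M) (Fin M) L} (hde : d * e = 1) (hed : e * d = 1) (h1 : a * p + b * y = 1)
    (h2 : c * p + d * y = 0) (h3 : p * a + x * c = 1) (h4 : p * b + x * d = 0) :
    p * (a - b * e * c) = 1 ∧ (a - b * e * c) * p = 1 := by
  have hy : y = -(e * (c * p)) := by
    rw [eq_neg_of_add_eq_zero_left h2, Matrix.mul_neg, neg_neg, ← Matrix.mul_assoc, hed,
      Matrix.one_mul]
  have hx : x = -(p * b * e) := by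
    rw [eq_neg_of_add_eq_zero_left h4, Matrix.neg_mul, neg_neg, Matrix.mul_assoc, hde,
      Matrix.mul_one]
  constructor
  · rw [← h3, hx, Matrix.mul_sub, Matrix.neg_mul, sub_eq_add_neg]
    simp only [Matrix.mul_assoc]
  · rw [← h1, hy, Matrix.sub_mul, Matrix.mul_neg, sub_eq_add_neg]
    simp only [Matrix.mul_assoc]

/-- The Schur complement of the last `M` rows and columns. -/
theorem exists_schur {S S' : Matrix (Fin (N + M)) (Fin (N + M)) (PowerSeries A)} (h1 : S * S' = 1)
    (h2 : S' * S = 1) (hD : IsUnit (S.submatrix (Fin.natAdd N) (Fin.natAdd N)))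
    (h0 : ∀ i j, PowerSeries.constantCoeff (S (Fin.castAdd M i) (Fin.natAdd N j)) = 0) :
    ∃ σ : Matrix (Fin N) (Fin N) (PowerSeries A),
      S'.submatrix (Fin.castAdd M) (Fin.castAdd M) * σ = 1 ∧
      σ * S'.submatrix (Fin.castAdd M) (Fin.castAdd M) = 1 ∧
      σ.map PowerSeries.constantCoeff =
        (S.map PowerSeries.constantCoeff).submatrix (Fin.castAdd M) (Fin.castAdd M) := by
  obtain ⟨⟨D, E, hDE, hED⟩, hD'⟩ := hD
  simp only at hD'
  set ι := Fin.castAdd (n := N) M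
  set κ := Fin.natAdd (m := M) N
  have hinj := Fin.castAdd_injective N M
  have hne : ∀ i j, ι i ≠ κ j := fun i j e => by
    have := congrArg Fin.val e
    simp only [ι, κ, Fin.val_castAdd, Fin.val_natAdd] at this
    omega
  have hoff : (1 : Matrix (Fin (N + M)) (Fin (N + M)) (PowerSeries A)).submatrix κ ι = 0 :=
    Matrix.ext fun i j => Matrix.one_apply_ne (hne j i).symm
  have hoff' : (1 : Matrix (Fin (N + M)) (Fin (N + M)) (PowerSeries A)).submatrix ι κ = 0 :=
    Matrix.ext fun i j => Matrix.one_apply_ne (hne i j)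
  have e1 := mul_submatrix_split S S' ι ι
  have e2 := mul_submatrix_split S S' κ ι
  have e3 := mul_submatrix_split S' S ι ι
  have e4 := mul_submatrix_split S' S ι κ
  rw [h1, Matrix.submatrix_one _ hinj] at e1
  rw [h1, hoff] at e2
  rw [h2, Matrix.submatrix_one _ hinj] at e3
  rw [h2, hoff'] at e4
  rw [hD'] at hDE hED
  obtain ⟨h3, h4⟩ := schur_inverse hDE hED e1.symm e2.symm e3.symm e4.symm
  refine ⟨_, h3, h4, Matrix.ext fun i j => ?_⟩
  -- The correction term contains the upper right block, whose constant term is zero; so `σ` has the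
  -- constant term of the upper left block and inherits its constant relations.
  rw [Matrix.mul_assoc, Matrix.map_apply, Matrix.sub_apply, map_sub, Matrix.mul_apply, map_sum,
    Finset.sum_eq_zero, sub_zero]
  · rfl
  · intro l _
    rw [map_mul, Matrix.submatrix_apply, h0, zero_mul]

end ConstantTerm

/-! ### Naturality, and the universal property of the twisted `q`-Yangians -/

section Naturality

variable {K : Type*} [Field K] {A B : Type*} [Ring A] [Algebra K A] [Ring B] [Algebra K B] {n m : ℕ}

theorem constantCoeff_dilate (c : K) (f : PowerSeries A) :
    PowerSeries.constantCoeff (dilate c f) = PowerSeries.constantCoeff f := by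
  rw [← PowerSeries.coeff_zero_eq_constantCoeff_apply, coeff_dilate, pow_zero, one_smul,
    PowerSeries.coeff_zero_eq_constantCoeff_apply]

variable (φ : A →ₐ[K] B)

theorem map_map_smul (c : K) (f : PowerSeries (PowerSeries A)) :
    PowerSeries.map (PowerSeries.map (φ : A →+* B)) (c • f) =
      c • PowerSeries.map (PowerSeries.map (φ : A →+* B)) f := by
  ext r s
  simp

theorem reflR_map (q : K) : (reflR (A := A) n q).map
    (PowerSeries.map (PowerSeries.map (φ : A →+* B))) = reflR (A := B) n q := by
  rw [reflR, twoSite_map, rMatrix_map _ (map_map_smul φ), PowerSeries.map_C, PowerSeries.map_X,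
    PowerSeries.map_X, reflR]

theorem reflRT_map (q : K) : (reflRT (A := A) n q).map
    (PowerSeries.map (PowerSeries.map (φ : A →+* B))) = reflRT (A := B) n q := by
  have e : ∀ Y : Matrix (Fin n × Fin n) (Fin n × Fin n) (PowerSeries (PowerSeries A)),
      (partialTranspose Y).map (PowerSeries.map (PowerSeries.map (φ : A →+* B))) =
        partialTranspose (Y.map (PowerSeries.map (PowerSeries.map (φ : A →+* B)))) := fun _ => rfl
  rw [reflRT, twoSite_map, e, rMatrix_map _ (map_map_smul φ), map_mul, PowerSeries.map_C,
    PowerSeries.map_X, PowerSeries.map_X, map_one, reflRT]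

theorem reflS₁_map (S : Matrix (Fin n) (Fin n) (PowerSeries A)) : (reflS₁ S).map
    (PowerSeries.map (PowerSeries.map (φ : A →+* B))) =
      reflS₁ (S.map (PowerSeries.map (φ : A →+* B))) := by
  rw [reflS₁, oneSite_map, reflS₁]
  congr 1
  refine Matrix.ext fun a b => ?_
  ext r s
  simp [PowerSeries.coeff_C]

theorem reflS₂_map (S : Matrix (Fin n) (Fin n) (PowerSeries A)) : (reflS₂ S).map
    (PowerSeries.map (PowerSeries.map (φ : A →+* B))) =
      reflS₂ (S.map (PowerSeries.map (φ : A →+* B))) := by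
  rw [reflS₂, oneSite_map, reflS₂]
  congr 1
  refine Matrix.ext fun a b => ?_
  simp only [Matrix.map_apply, PowerSeries.map_C]

theorem reflLeft_map (q : K) (S : Matrix (Fin n) (Fin n) (PowerSeries A)) : (reflLeft q S).map
    (PowerSeries.map (PowerSeries.map (φ : A →+* B))) =
      reflLeft q (S.map (PowerSeries.map (φ : A →+* B))) := by
  rw [reflLeft, Matrix.map_mul, Matrix.map_mul, Matrix.map_mul, reflR_map, reflS₁_map, reflRT_map,
    reflS₂_map, reflLeft]

theorem reflRight_map (q : K) (S : Matrix (Fin n) (Fin n) (PowerSeries A)) : (reflRight q S).map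
    (PowerSeries.map (PowerSeries.map (φ : A →+* B))) =
      reflRight q (S.map (PowerSeries.map (φ : A →+* B))) := by
  rw [reflRight, Matrix.map_mul, Matrix.map_mul, Matrix.map_mul, reflR_map, reflS₁_map,
    reflRT_map, reflS₂_map, reflRight]

theorem crossOp_map (q : K) (i j : ℕ) :
    (crossOp A n q i j).map (PowerSeries.map (φ : A →+* B)) = crossOp B n q i j := by
  refine Matrix.ext fun a b => ?_
  ext r
  simp [crossOp, scalarHom]

theorem sklyaninMinor_map [CharZero K] (q : K) (S : Matrix (Fin n) (Fin n) (PowerSeries A))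
    (a b : Fin m → Fin n) : PowerSeries.map (φ : A →+* B) (sklyaninMinor q S a b) =
      sklyaninMinor q (S.map (PowerSeries.map (φ : A →+* B))) a b := by
  have h1 : (bracket m q S).map (PowerSeries.map (φ : A →+* B)) =
      bracket m q (S.map (PowerSeries.map (φ : A →+* B))) := by
    rw [bracket_eq_genBracket, genBracket_map, bracket_eq_genBracket]
    congr 1
    · funext i
      exact Matrix.ext fun a b => (dilate_map φ _ _).symm
    · funext i j
      exact crossOp_map φ q i j
  have h2 : (altSum (PowerSeries A) m n q).map (PowerSeries.map (φ : A →+* B)) =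
      altSum (PowerSeries B) m n q :=
    Matrix.ext fun a b => altSum_map (PowerSeries.map (φ : A →+* B)) (fun c => by
      rw [PowerSeries.algebraMap_apply, PowerSeries.algebraMap_apply, PowerSeries.map_C]
      exact congrArg _ (φ.commutes c)) q a b
  rw [sklyaninMinor_eq, sklyaninMinor_eq, ← h1, ← h2, ← Matrix.map_mul]
  rfl

theorem sdetOn_map [CharZero K] (q : K) (S : Matrix (Fin n) (Fin n) (PowerSeries A))
    (I : Finset (Fin n)) : PowerSeries.map (φ : A →+* B) (sdetOn q S I) =
      sdetOn q (S.map (PowerSeries.map (φ : A →+* B))) I :=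
  sklyaninMinor_map φ q _ id id

end Naturality

/-! ### The generator matrix and homomorphisms out of the twisted `q`-Yangian. -/

section UniversalProperty

variable {K : Type*} [Field K] {q : K} {g : Family} {N : ℕ}

theorem genMatrix_eq_map : genMatrix q g N = (freeMatrix K g N).map
    (PowerSeries.map (RingQuot.mkAlgHom K (Relation q g N) : _ →+* TwistedQYangian q g N)) := by
  refine Matrix.ext fun i j => ?_
  ext r
  simp only [genMatrix, freeMatrix, Matrix.of_apply, Matrix.map_apply, PowerSeries.coeff_mk,
    PowerSeries.coeff_map]
  rfl

theorem reflection_genMatrix :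
    reflLeft q (genMatrix q g N) = reflRight q (genMatrix q g N) := by
  rw [genMatrix_eq_map, ← reflLeft_map, ← reflRight_map]
  refine Matrix.ext fun a b => ?_
  ext r t
  simp only [Matrix.map_apply, PowerSeries.coeff_map]
  exact RingQuot.mkAlgHom_rel K (Relation.reflection a b r t)

theorem exists_oddIndex {i j : Fin N} (hi : Even (i : ℕ)) (hij : (j : ℕ) = i + 1) :
    ∃ k : Fin (N / 2), i = oddIndex k ∧ j = oddIndex' k := by
  obtain ⟨a, ha⟩ := hi
  have := j.isLt
  refine ⟨⟨a, by omega⟩, Fin.ext ?_, Fin.ext ?_⟩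
  · simp only [oddIndex]
    omega
  · simp only [oddIndex']
    omega

theorem isConstant_genMatrix :
    IsConstant q g ((genMatrix q g N).map PowerSeries.constantCoeff) := by
  have e : ∀ i j, (genMatrix q g N).map PowerSeries.constantCoeff i j =
      RingQuot.mkAlgHom K (Relation q g N) (freeGen K g i j 0) := fun i j => by
    rw [Matrix.map_apply, ← PowerSeries.coeff_zero_eq_constantCoeff_apply, genMatrix,
      Matrix.of_apply, PowerSeries.coeff_mk]
  cases g with
  | orthogonal =>
    refine ⟨fun i j hij => ?_, fun i => ?_⟩
    · rw [e, RingQuot.mkAlgHom_rel K (Relation.orthogonal_upper i j hij), map_zero]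
    · rw [e, RingQuot.mkAlgHom_rel K (Relation.orthogonal_diag i), map_one]
  | symplectic =>
    refine ⟨fun i j hij hne => ?_, fun i j hi hij => ?_⟩
    · rw [e, RingQuot.mkAlgHom_rel K (Relation.symplectic_upper i j hij ?_), map_zero]
      rintro ⟨k, rfl, rfl⟩
      exact hne ⟨even_two_mul _, rfl⟩
    · obtain ⟨k, rfl, rfl⟩ := exists_oddIndex hi hij
      simp only [e]
      refine ⟨⟨⟨_, RingQuot.mkAlgHom K (Relation q _ N) (FreeAlgebra.ι K (Generator.inv k)),
        ?_, ?_⟩, rfl⟩, ?_⟩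
      · rw [← map_mul, RingQuot.mkAlgHom_rel K (Relation.symplectic_mul_inv k), map_one]
      · rw [← map_mul, RingQuot.mkAlgHom_rel K (Relation.symplectic_inv_mul k), map_one]
      · rw [← map_mul, ← map_mul, ← map_smul, ← map_sub,
          RingQuot.mkAlgHom_rel K (Relation.symplectic_block k), AlgHom.commutes]

variable {B : Type*} [Ring B] [Algebra K B]

/-- The values of the generators in an algebra with a solution of the reflection equation. -/
noncomputable def generatorValue (T : Matrix (Fin N) (Fin N) (PowerSeries B)) : Generator g N → B
  | Generator.s i j r => PowerSeries.coeff r (T i j)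
  | Generator.inv k => Ring.inverse (PowerSeries.coeff 0 (T (oddIndex k) (oddIndex' k)))

/-- The defining relations are the reflection equation coefficientwise and the constant relations.
The formal inverses are sent to `Ring.inverse`, a true inverse since `IsConstant` makes the entries
`T_{ii'}` units at constant order. -/
theorem exists_algHom {T : Matrix (Fin N) (Fin N) (PowerSeries B)}
    (hT : reflLeft q T = reflRight q T)
    (hc : IsConstant q g (T.map PowerSeries.constantCoeff)) :
    ∃ φ : TwistedQYangian q g N →ₐ[K] B,
      (genMatrix q g N).map (PowerSeries.map (φ : TwistedQYangian q g N →+* B)) = T := by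
  set ψ : FreeAlgebra K (Generator g N) →ₐ[K] B := FreeAlgebra.lift K (generatorValue T) with hψ
  have hs : ∀ i j r, ψ (freeGen K g i j r) = PowerSeries.coeff r (T i j) := fun i j r => by
    rw [hψ, freeGen, FreeAlgebra.lift_ι_apply, generatorValue]
  have hm : (freeMatrix K g N).map (PowerSeries.map (ψ : FreeAlgebra K (Generator g N) →+* B)) =
      T := by
    refine Matrix.ext fun i j => ?_
    ext r
    simp [freeMatrix, hs]
  have hrel : ∀ ⦃x y⦄, Relation q g N x y → ψ x = ψ y := by
    have hcoe : ∀ i j, PowerSeries.coeff 0 (T i j) = T.map PowerSeries.constantCoeff i j :=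
      fun i j => PowerSeries.coeff_zero_eq_constantCoeff_apply _
    intro x y hxy
    cases hxy with
    | reflection a b r t =>
      have h1 := hT
      rw [← hm, ← reflLeft_map, ← reflRight_map] at h1
      have h2 := congrArg (fun Y => PowerSeries.coeff t (PowerSeries.coeff r (Y a b))) h1
      simp only [Matrix.map_apply, PowerSeries.coeff_map] at h2
      exact h2
    | orthogonal_upper i j h =>
      rw [hs, hcoe, map_zero, hc.1 i j h]
    | orthogonal_diag i =>
      rw [hs, hcoe, map_one, hc.2 i]
    | symplectic_upper i j h h' =>
      rw [hs, hcoe, map_zero, hc.1 i j h]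
      rintro ⟨hi, hij⟩
      exact h' (exists_oddIndex hi hij)
    | symplectic_block k =>
      rw [map_sub, map_smul, map_mul, map_mul, hs, hs, hs, hs, AlgHom.commutes]
      simp only [hcoe]
      exact (hc.2 (oddIndex k) (oddIndex' k) (even_two_mul _) rfl).2
    | symplectic_mul_inv k =>
      rw [map_mul, hs, hψ, FreeAlgebra.lift_ι_apply, generatorValue, map_one, hcoe]
      exact Ring.mul_inverse_cancel _ (hc.2 (oddIndex k) (oddIndex' k) (even_two_mul _) rfl).1
    | symplectic_inv_mul k =>
      rw [map_mul, hs, hψ, FreeAlgebra.lift_ι_apply, generatorValue, map_one, hcoe]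
      exact Ring.inverse_mul_cancel _ (hc.2 (oddIndex k) (oddIndex' k) (even_two_mul _) rfl).1
  refine ⟨RingQuot.liftAlgHom K ⟨ψ, hrel⟩, Matrix.ext fun i j => ?_⟩
  ext r
  simp [genMatrix, hs]

end UniversalProperty

/-! ### Muir's law -/

section Muir

variable {K : Type*} [Field K] {A : Type*} [Ring A] [Algebra K A] {N M : ℕ}

theorem sdetOn_natAdd [CharZero K] (q : K) (S : Matrix (Fin (N + M)) (Fin (N + M)) (PowerSeries A)) :
    sdetOn q S (Finset.univ.map (Fin.natAddEmb N)) =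
      sklyaninMinor q S (Fin.natAdd N) (Fin.natAdd N) := by
  refine sdetOn_eq q S (Fin.strictMono_natAdd N) ?_
  rw [Finset.map_eq_image]
  rfl

theorem isUnit_sdetOn_natAdd [CharZero K] {q : K} (hq : q ≠ 0) (hq2 : q ^ 2 ≠ 1)
    {S : Matrix (Fin (N + M)) (Fin (N + M)) (PowerSeries A)} (h : reflLeft q S = reflRight q S)
    (hD : IsUnit (S.submatrix (Fin.natAdd N) (Fin.natAdd N))) :
    IsUnit (sdetOn q S (Finset.univ.map (Fin.natAddEmb N))) := by
  have h1 := isUnit_sdet hq hD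
    (isFused_of_reflection hq hq2 (reflection_submatrix h (Fin.strictMono_natAdd N)))
  rw [sdet, sklyaninMinor_submatrix (Fin.strictMono_natAdd N)] at h1
  rw [sdetOn_natAdd]
  exact h1

/-- The factorization is proved with `J` listed before `I`, whereas the determinant lists `I ∪ J`
increasingly; `ρ` is the permutation between the two listings. -/
theorem sdetOn_union [CharZero K] {q : K} (hq : q ≠ 0)
    {S S' : Matrix (Fin (N + M)) (Fin (N + M)) (PowerSeries A)} (h1 : S * S' = 1) (h2 : S' * S = 1)
    (hF : IsFused q S) {σ : Matrix (Fin N) (Fin N) (PowerSeries A)}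
    (hσ : S'.submatrix (Fin.castAdd M) (Fin.castAdd M) * σ = 1) (I : Finset (Fin N)) :
    sdetOn q S (I.map (Fin.castAddEmb M) ∪ Finset.univ.map (Fin.natAddEmb N)) =
      sdetOn q S (Finset.univ.map (Fin.natAddEmb N)) *
        dilate (q ^ M) (sdetOn q (σ.map (dilate (q ^ M))) I) := by
  set p := I.card with hp
  set U := I.map (Fin.castAddEmb M) ∪ Finset.univ.map (Fin.natAddEmb N) with hU
  have hdisj : Disjoint (I.map (Fin.castAddEmb M)) (Finset.univ.map (Fin.natAddEmb N)) := by
    rw [Finset.disjoint_left]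
    intro x hx hx'
    simp only [Finset.mem_map, Finset.mem_univ, true_and, Fin.castAddEmb_apply,
      Fin.natAddEmb_apply] at hx hx'
    obtain ⟨i, -, rfl⟩ := hx
    obtain ⟨j, hj⟩ := hx'
    have := congrArg Fin.val hj
    rw [Fin.val_castAdd, Fin.val_natAdd] at this
    omega
  have hcard : U.card = M + p := by
    rw [hU, Finset.card_union_of_disjoint hdisj, Finset.card_map, Finset.card_map,
      Finset.card_univ, Fintype.card_fin, add_comm]
  set c := I.orderEmbOfFin (k := p) rfl
  set a := U.orderEmbOfFin hcard
  set e := Fin.append (Fin.natAdd (m := M) N) (Fin.castAdd M ∘ c) with he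
  have hmem : ∀ x, ∃ y, a y = e x := fun x => by
    have : e x ∈ Set.range a := by
      rw [Finset.range_orderEmbOfFin, Finset.mem_coe, hU, Finset.mem_union]
      refine Fin.addCases (fun i => ?_) (fun i => ?_) x
      · right
        rw [he, Fin.append_left]
        exact Finset.mem_map_of_mem (Fin.natAddEmb N) (Finset.mem_univ i)
      · left
        rw [he, Fin.append_right]
        exact Finset.mem_map_of_mem (Fin.castAddEmb M) (Finset.orderEmbOfFin_mem I rfl i)
    exact this
  choose ρ hρ using hmem
  have heinj : Function.Injective e := by
    rw [he, Fin.append_injective_iff]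
    refine ⟨Fin.natAdd_injective M N, (Fin.castAdd_injective N M).comp c.injective, ?_⟩
    intro i j hij
    have := congrArg Fin.val hij
    rw [Function.comp_apply, Fin.val_castAdd, Fin.val_natAdd] at this
    omega
  have hρinj : Function.Injective ρ := fun x y hxy => heinj (by rw [← hρ, ← hρ, hxy])
  rw [sdetOn_eq q _ c.strictMono (by simp [c]), sdetOn_eq q _ a.strictMono (by simp [a]),
    sdetOn_natAdd]
  exact sklyaninMinor_union hq h1 h2 hF hσ a.injective
    (ρ := Equiv.ofBijective ρ (Finite.injective_iff_bijective.1 hρinj))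
    (funext fun x => (hρ x).symm)

/-- The map `φ` sends the generator matrix of `Y_N` to the dilated Schur complement. That matrix
solves the reflection equation and has the constant term of the upper left block of `S`, so `φ` is
well defined; being natural, it carries Sklyanin minors to those of the Schur complement. -/
theorem exists_muir_hom [CharZero K] {q : K} (hq : q ≠ 0) (hq2 : q ^ 2 ≠ 1) {g : Family}
    (hg : g = Family.symplectic → Even N ∧ Even M) :
    IsUnit (sdetOn q (genMatrix q g (N + M)) (Finset.univ.map (Fin.natAddEmb N))) ∧
    ∃ φ : TwistedQYangian q g N →ₐ[K] TwistedQYangian q g (N + M), ∀ I : Finset (Fin N),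
      sdetOn q (genMatrix q g (N + M))
          (I.map (Fin.castAddEmb M) ∪ Finset.univ.map (Fin.natAddEmb N)) =
        sdetOn q (genMatrix q g (N + M)) (Finset.univ.map (Fin.natAddEmb N)) *
          dilate (q ^ M) (PowerSeries.map (φ : _ →+* TwistedQYangian q g (N + M))
            (sdetOn q (genMatrix q g N) I)) := by
  have h : reflLeft q (genMatrix q g (N + M)) = reflRight q (genMatrix q g (N + M)) :=
    reflection_genMatrix
  have hc : IsConstant q g ((genMatrix q g (N + M)).map PowerSeries.constantCoeff) :=
    isConstant_genMatrix
  set S := genMatrix q g (N + M)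
  obtain ⟨u, hu⟩ := isUnit_of_reflection hq (fun e => (hg e).1.add (hg e).2) h hc
  have h1 : S * (u⁻¹).val = 1 := by rw [← hu, Units.mul_inv]
  have h2 : (u⁻¹).val * S = 1 := by rw [← hu, Units.inv_mul]
  have hcD := hc.submatrix (f := Fin.natAdd (m := M) N) (fun i => Fin.val_natAdd N i)
    fun e => (hg e).1
  have hD : IsUnit (S.submatrix (Fin.natAdd N) (Fin.natAdd N)) :=
    isUnit_of_reflection hq (fun e => (hg e).2)
      (reflection_submatrix h (Fin.strictMono_natAdd N)) hcD
  obtain ⟨σ, h3, h4, h5⟩ := exists_schur h1 h2 hD fun i j => hc.upper_eq_zero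
    (fun e => (hg e).1) i j
  have hcσ : IsConstant q g ((σ.map (dilate (q ^ M))).map PowerSeries.constantCoeff) := by
    have e : (σ.map (dilate (q ^ M))).map PowerSeries.constantCoeff =
        σ.map PowerSeries.constantCoeff :=
      Matrix.ext fun i j => constantCoeff_dilate (q ^ M) (σ i j)
    rw [e, h5]
    exact hc.submatrix (s := 0) (fun i => by rw [Fin.val_castAdd, zero_add]) fun _ => Even.zero
  obtain ⟨φ, hφ⟩ := exists_algHom (reflection_schur hq h1 h2 h h3 h4) hcσ
  refine ⟨isUnit_sdetOn_natAdd hq hq2 h hD, φ, fun I => ?_⟩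
  rw [sdetOn_union hq h1 h2 (isFused_of_reflection hq hq2 h) h3, sdetOn_map, hφ]

end Muir

end TwistedYangian

theorem mainTheorem4 {K : Type*} [Field K] [CharZero K]
    (q : K) (hq0 : q ≠ 0) (hq : ∀ n : ℕ, 0 < n → q ^ n ≠ 1)
    (g : TwistedYangian.Family) (N M : ℕ)
    (hg : g = TwistedYangian.Family.symplectic → Even N ∧ Even M)
    (k : ℕ) (b : Fin k → K) (m : Fin k → ℕ)
    (I : (i : Fin k) → Fin (m i) → Finset (Fin N))
    (h : ∑ i, b i • (List.ofFn fun j : Fin (m i) =>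
      TwistedYangian.sdetOn q (TwistedYangian.genMatrix q g N) (I i j)).prod = 0)
    (J : Finset (Fin (N + M))) (hJ : J = Finset.univ.map (Fin.natAddEmb N)) :
    IsUnit (TwistedYangian.sdetOn q (TwistedYangian.genMatrix q g (N + M)) J) ∧
    ∑ i, b i • (List.ofFn fun j : Fin (m i) =>
      Ring.inverse (TwistedYangian.sdetOn q (TwistedYangian.genMatrix q g (N + M)) J) *
        TwistedYangian.sdetOn q (TwistedYangian.genMatrix q g (N + M))
          ((I i j).map (Fin.castAddEmb M) ∪ J)).prod = 0 := by
  subst hJ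
  obtain ⟨hu, φ, hφ⟩ := TwistedYangian.exists_muir_hom (N := N) (M := M) hq0
    (hq 2 two_pos) hg
  refine ⟨hu, ?_⟩
  -- A `K`-linear ring homomorphism sending each `sdet S_I` to `(sdet S_J)⁻¹ sdet S_{I ∪ J}`, hence
  -- each product in the identity to the corresponding product.
  set Θ := (TwistedYangian.dilateHom (q ^ M)).comp
    (PowerSeries.map (φ : TwistedYangian.TwistedQYangian q g N →+* TwistedYangian.TwistedQYangian q g (N + M))) with hΘ
  have hΘs : ∀ (c : K) f, Θ (c • f) = c • Θ f := fun c f => by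
    have e : PowerSeries.map (φ : TwistedYangian.TwistedQYangian q g N →+* TwistedYangian.TwistedQYangian q g (N + M)) (c • f) =
        c • PowerSeries.map (φ : TwistedYangian.TwistedQYangian q g N →+* TwistedYangian.TwistedQYangian q g (N + M)) f := by
      ext r
      simp
    rw [hΘ, RingHom.comp_apply, RingHom.comp_apply, e, TwistedYangian.dilateHom_apply,
      TwistedYangian.dilate_smul, TwistedYangian.dilateHom_apply]
  rw [← map_zero Θ, ← h, map_sum]
  refine Finset.sum_congr rfl fun i _ => ?_
  rw [hΘs, map_list_prod, List.map_ofFn]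
  congr 3
  funext j
  rw [hφ, Ring.inverse_mul_cancel_left _ _ hu]
  rfl
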